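/- Setting. An MDP has a finite state set $\mathcal S$ ($|\mathcal S|=S\ge 1$), a finite action set $\mathcal A$ ($|\mathcal A|=A\ge 1$), transition probabilities $P(\cdot|s,a)$, a deterministic reward $r(s,a)\in[0,1]$ and a discount factor $\gamma\in(0,1)$. For $\pi:\mathcal S\to\mathcal A$ let $V^\pi(s)=\mathbb E\big[\sum_{t\ge1}\gamma^{t-1}r(s_t,\pi(s_t))\,\big|\,s_1=s,\ s_{t+1}\sim P(\cdot|s_t,\pi(s_t))\big]$ and $V^*(s)=\max_\pi V^\pi(s)$. The $\varepsilon$-sample complexity of an algorithm that uses the policy $\pi_t$ at time $t$ is the number of $t\ge1$ with $V^*(s_t)-V^{\pi_t}(s_t)>\varepsilon$. Algorithm UCB-MultiStage, with confidence parameter $\delta$ and constant $c_1$. Put $H=\Big\lceil\max\big\{\tfrac{\ln(8/((1-\gamma)\varepsilon))}{\ln(1/\gamma)},\tfrac1{1-\gamma}\big\}\Big\rceil$, $B=\sqrt H$, $\iota=\ln(2/\delta)$, $d_1=H$, $d_{j+1}=\lfloor(1+\tfrac1H)d_j\rfloor$, $\check e_j=d_{\lceil j/B\rceil}$, $\bar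 e_j=d_j$, $N_0=c_1S^3AH^7\ln^2(4H^2S/\varepsilon)\,\iota/\varepsilon^2$, $\check J=\max\{j:\sum_{i<j}\check e_i\le N_0\}$, $\bar J=\max\{j:\sum_{i<j}\bar e_i\le N_0\}$, $\check{\mathcal L}=\{\sum_{i\le j}\check e_i:1\le j\le\check J\}$, $\bar{\mathcal L}=\{\sum_{i\le j}\bar e_i:1\le j\le\bar J\}$. Start with $Q\equiv\frac1{1-\gamma}$ and all of $N,\check N,\bar N,\check\mu,\bar\mu$ (tables on $\mathcal S\times\mathcal A$) equal to $0$; $V(s)=\max_aQ(s,a)$ throughout. At time $t$ use the greedy policy $\pi_t(s)=\arg\max_aQ(s,a)$ (any fixed tie-breaking rule), take $a=\pi_t(s_t)$ in $s=s_t$, observe $r(s,a)$ and $s'=s_{t+1}\sim P(\cdot|s,a)$; increase $N,\check N,\bar N$ at $(s,a)$ by $1$ and $\check\mu,\bar\mu$ at $(s,a)$ by $V(s')$, and write $n,\check n,\bar n,\check\mu,\bar\mu$ for the new values. If $n\in\check{\mathcal L}$, replace $Q(s,a)$ by $\min\{r(s,a)+\gamma\check\mu/\check n+\min\{2\sqrt{H^2\iota/\check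 n},\tfrac1{1-\gamma}\},Q(s,a)\}$ and reset $\check N(s,a),\check\mu(s,a)$ to $0$. Then, if $n\in\bar{\mathcal L}$, do the same with $\bar n,\bar\mu$ and reset $\bar N(s,a),\bar\mu(s,a)$ to $0$. (The memory consists of six tables of size $SA$.) Theorem. There are universal constants $k\in\mathbb N$ and $c_0>0$, and for each $c_1\ge c_0$ a constant $C>0$, such that the following holds for all $S,A\ge1$, $\gamma\in(0,1)$, $\varepsilon\in(0,\frac1{1-\gamma}]$ and $p\in(0,1)$. There is $\delta\in(0,1)$ with $\delta\cdot\big(8SA(\check J+\bar J)+H+3\big)=p$; and for every such $\delta$, every MDP with $S$ states, $A$ actions and discount factor $\gamma$, and every law of the initial state, with probability at least $1-p$ the $\varepsilon$-sample complexity of UCB-MultiStage run with $\delta$ and $c_1$ is at most $$C\,L^k\cdot\frac{SA\ln(2/p)}{\varepsilon^2(1-\gamma)^{5.5}},\qquad L=1+\ln S+\ln A+\ln\tfrac1{1-\gamma}+\ln\big(1+\tfrac1\varepsilon\big).$$ -/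

import Mathlib

open scoped ENNReal

noncomputable section

namespace UCBMultiStage

/-! ### Discounted Markov decision processes -/

/-- A finite MDP (the discount factor is kept separately): transition probabilities `P s a s'` and
a deterministic reward function with values in `[0, 1]`. -/
structure MDP (𝒮 𝒜 : Type*) [Fintype 𝒮] where
  P : 𝒮 → 𝒜 → 𝒮 → ℝ
  r : 𝒮 → 𝒜 → ℝ
  P_nonneg : ∀ s a s', 0 ≤ P s a s'
  P_sum : ∀ s a, ∑ s', P s a s' = 1
  r_nonneg : ∀ s a, 0 ≤ r s a
  r_le_one : ∀ s a, r s a ≤ 1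

namespace MDP

variable {𝒮 𝒜 : Type*} [Fintype 𝒮]

open Classical in
/-- `M.law π s t y` is the probability that the Markov chain started at `s` and driven by the
stationary policy `π` is at `y` after `t` transitions. -/
def law (M : MDP 𝒮 𝒜) (π : 𝒮 → 𝒜) (s : 𝒮) : ℕ → 𝒮 → ℝ
  | 0 => fun y => if y = s then 1 else 0
  | t + 1 => fun y => ∑ x, law M π s t x * M.P x (π x) y

/-- The value function `V^π(s)`: the expected `γ`-discounted reward collected from `s` by `π`
(the sum over `y` is the expected reward after `t` transitions). -/
def value (M : MDP 𝒮 𝒜) (γ : ℝ) (π : 𝒮 → 𝒜) (s : 𝒮) : ℝ :=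
  ∑' t : ℕ, γ ^ t * ∑ y, M.law π s t y * M.r y (π y)

/-- The optimal value function `V^*(s) = sup_π V^π(s)`. -/
def optValue (M : MDP 𝒮 𝒜) (γ : ℝ) (s : 𝒮) : ℝ :=
  ⨆ π : 𝒮 → 𝒜, M.value γ π s

end MDP

/-! ### Parameters of the algorithm and its stages -/

/-- What the algorithm is run with: the numbers `S`, `A` of states and actions, the discount factor
`γ`, the accuracy `ε`, the constant `c₁` in the visit cap, and the confidence parameter `δ`. -/
structure Params where
  S : ℕ
  A : ℕ
  γ : ℝ
  ε : ℝ
  c₁ : ℝ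
  δ : ℝ

/-- Basic stage lengths `d₁ = H`, `d_{j+1} = ⌊(1 + 1/H) d_j⌋`, where
`⌊(1 + 1/H) d⌋ = d + ⌊d / H⌋` for natural numbers (index `0` is not used). -/
def stageLen (H : ℕ) : ℕ → ℕ
  | 0 => 0
  | 1 => H
  | j + 2 => stageLen H (j + 1) + stageLen H (j + 1) / H

namespace Params

/-- `H = max { ln(8 / ((1-γ)ε)) / ln(1/γ), 1/(1-γ) }`, rounded up to an integer. -/
def H (q : Params) : ℕ :=
  ⌈max (Real.log (8 / ((1 - q.γ) * q.ε)) / Real.log (1 / q.γ)) (1 / (1 - q.γ))⌉₊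

/-- `B = √H`. -/
def B (q : Params) : ℝ := Real.sqrt q.H

/-- `ι = ln(2/δ)`. -/
def ι (q : Params) : ℝ := Real.log (2 / q.δ)

/-- Length of the `j`-th type-I stage, `j ≥ 1`. -/
def eChk (q : Params) (j : ℕ) : ℕ := stageLen q.H ⌈(j : ℝ) / q.B⌉₊

/-- Length of the `j`-th type-II stage, `j ≥ 1`. -/
def eBar (q : Params) (j : ℕ) : ℕ := stageLen q.H j

/-- The visit cap `N₀`: a state-action pair with more visits is no longer updated. -/
def N₀ (q : Params) : ℝ :=
  q.c₁ * (q.S ^ 3 * q.A * q.H ^ 7 * Real.log (4 * q.H ^ 2 * q.S / q.ε) ^ 2 * q.ι) / q.ε ^ 2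

/-- Number of type-I stages: the largest `j` with `∑_{i=1}^{j-1} ě_i ≤ N₀`. -/
def JChk (q : Params) : ℕ := sSup {j : ℕ | ((∑ i ∈ Finset.Icc 1 (j - 1), q.eChk i : ℕ) : ℝ) ≤ q.N₀}

/-- Number of type-II stages: the largest `j` with `∑_{i=1}^{j-1} ē_i ≤ N₀`. -/
def JBar (q : Params) : ℕ := sSup {j : ℕ | ((∑ i ∈ Finset.Icc 1 (j - 1), q.eBar i : ℕ) : ℝ) ≤ q.N₀}

/-- Visit numbers at which a type-I stage ends. -/
def LChk (q : Params) : Set ℕ :=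
  {n | ∃ j, 1 ≤ j ∧ j ≤ q.JChk ∧ n = ∑ i ∈ Finset.Icc 1 j, q.eChk i}

/-- Visit numbers at which a type-II stage ends. -/
def LBar (q : Params) : Set ℕ :=
  {n | ∃ j, 1 ≤ j ∧ j ≤ q.JBar ∧ n = ∑ i ∈ Finset.Icc 1 j, q.eBar i}

/-- The exploration bonus for a stage with `n` samples. -/
def bonus (q : Params) (n : ℕ) : ℝ :=
  min (2 * Real.sqrt ((q.H : ℝ) ^ 2 * q.ι / n)) (1 / (1 - q.γ))

/-- The overall failure probability to which the confidence parameter `δ` corresponds. -/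
def failure (q : Params) : ℝ :=
  (8 * q.S * q.A * (q.JChk + q.JBar) + q.H + 3) * q.δ

end Params

/-! ### The algorithm -/

/-- The memory of the algorithm: six tables indexed by state-action pairs. -/
structure Memory (𝒮 𝒜 : Type*) where
  Q : 𝒮 → 𝒜 → ℝ
  N : 𝒮 → 𝒜 → ℕ
  NChk : 𝒮 → 𝒜 → ℕ
  NBar : 𝒮 → 𝒜 → ℕ
  μChk : 𝒮 → 𝒜 → ℝ
  μBar : 𝒮 → 𝒜 → ℝ

namespace Memory

variable {𝒮 𝒜 : Type*}

/-- The initial memory. -/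
def init (q : Params) : Memory 𝒮 𝒜 where
  Q _ _ := 1 / (1 - q.γ)
  N _ _ := 0
  NChk _ _ := 0
  NBar _ _ := 0
  μChk _ _ := 0
  μBar _ _ := 0

/-- `V(s) = max_a Q(s, a)`. The algorithm refreshes `V(s)` whenever `Q(s, ·)` is updated, so this
equality holds at all times. -/
def V (m : Memory 𝒮 𝒜) (s : 𝒮) : ℝ := ⨆ a, m.Q s a

open Classical in
/-- One time step: `s` is the current state, `a` the action taken, `rew` the reward received and
`s'` the next state. First the statistics of `(s, a)` are updated, then a type-I update of `Q(s, a)`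
is made if a type-I stage has ended, then a type-II update if a type-II stage has ended. -/
def step (q : Params) (m : Memory 𝒮 𝒜) (s : 𝒮) (a : 𝒜) (rew : ℝ) (s' : 𝒮) : Memory 𝒮 𝒜 :=
  let n := m.N s a + 1
  let nChk := m.NChk s a + 1
  let nBar := m.NBar s a + 1
  let sumChk := m.μChk s a + m.V s'
  let sumBar := m.μBar s a + m.V s'
  let Q₁ := if n ∈ q.LChk then
      min (rew + q.γ * (sumChk / nChk) + q.bonus nChk) (m.Q s a) else m.Q s a
  let Q₂ := if n ∈ q.LBar then
      min (rew + q.γ * (sumBar / nBar) + q.bonus nBar) Q₁ else Q₁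
  { Q := fun x b => if x = s ∧ b = a then Q₂ else m.Q x b
    N := fun x b => if x = s ∧ b = a then n else m.N x b
    NChk := fun x b => if x = s ∧ b = a then (if n ∈ q.LChk then 0 else nChk) else m.NChk x b
    NBar := fun x b => if x = s ∧ b = a then (if n ∈ q.LBar then 0 else nBar) else m.NBar x b
    μChk := fun x b => if x = s ∧ b = a then (if n ∈ q.LChk then 0 else sumChk) else m.μChk x b
    μBar := fun x b => if x = s ∧ b = a then (if n ∈ q.LBar then 0 else sumBar) else m.μBar x b }

/-- The greedy policy for the table `Q`; ties in `arg max_a Q(s, a)` are broken by `sel`. -/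
def greedy (sel : 𝒮 → (𝒜 → ℝ) → 𝒜) (m : Memory 𝒮 𝒜) (s : 𝒮) : 𝒜 := sel s (m.Q s)

end Memory

section Run

variable {𝒮 𝒜 : Type*} [Fintype 𝒮]

/-- The memory before time step `t` when the visited states are `x 0, x 1, …` (time starts at `0`).
It depends on `x 0, …, x t` only. -/
def memory (M : MDP 𝒮 𝒜) (q : Params) (sel : 𝒮 → (𝒜 → ℝ) → 𝒜) (x : ℕ → 𝒮) : ℕ → Memory 𝒮 𝒜
  | 0 => Memory.init q
  | t + 1 =>
    let m := memory M q sel x t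
    let a := m.greedy sel (x t)
    m.step q (x t) a (M.r (x t) a) (x (t + 1))

/-- The policy `π_t` used at time `t`. -/
def policy (M : MDP 𝒮 𝒜) (q : Params) (sel : 𝒮 → (𝒜 → ℝ) → 𝒜) (x : ℕ → 𝒮) (t : ℕ) : 𝒮 → 𝒜 :=
  (memory M q sel x t).greedy sel

/-- `X` is the state process of the algorithm interacting with `M`: given the states up to time
`t`, the next state has law `P(· | s_t, a_t)` with `a_t = π_t(s_t)`. The law of the initial state is
arbitrary. -/
structure IsInteraction (M : MDP 𝒮 𝒜) (q : Params) (sel : 𝒮 → (𝒜 → ℝ) → 𝒜)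
    {Ω : Type*} [MeasurableSpace Ω] (μ : MeasureTheory.Measure Ω) (X : ℕ → Ω → 𝒮) : Prop where
  measurable : ∀ t s, MeasurableSet {ω | X t ω = s}
  transition : ∀ (t : ℕ) (x : ℕ → 𝒮),
    μ {ω | ∀ i ≤ t + 1, X i ω = x i} =
      μ {ω | ∀ i ≤ t, X i ω = x i} *
        ENNReal.ofReal (M.P (x t) (policy M q sel x t (x t)) (x (t + 1)))

/-- The `ε`-sample complexity along the states `x`: the number (possibly infinite) of times `t` with
`V^*(s_t) - V^{π_t}(s_t) > ε`. -/
def sampleComplexity (M : MDP 𝒮 𝒜) (q : Params) (sel : 𝒮 → (𝒜 → ℝ) → 𝒜) (x : ℕ → 𝒮) : ℕ∞ :=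
  {t : ℕ | M.optValue q.γ (x t) - M.value q.γ (policy M q sel x t) (x t) > q.ε}.encard

end Run

/-- The logarithmic quantity whose powers are hidden by the `Õ` notation. -/
def logFactor (S A : ℕ) (γ ε : ℝ) : ℝ :=
  1 + Real.log S + Real.log A + Real.log (1 / (1 - γ)) + Real.log (1 + 1 / ε)

end UCBMultiStage

end

open UCBMultiStage

/-!
The proof fixes a solution `W` of the Bellman optimality equation, which dominates the optimal value
function, and bounds the number of suboptimal steps along every *typical* path (`IsTypical`): a path
along which all stage averages, and two sums over all times, are close to their conditional
expectations.

*Typical paths.* Each deviation is the event that an exponential supermartingale of the interaction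
ever exceeds `exp ι = 2 / δ`. By Ville's inequality (`measure_exists_le_pathSum_le`) it has
probability at most `δ / 2`, and the union bound is `measure_atypicalPaths_le`. Maximal inequalities
make the bounds uniform in time, so that no horizon enters.

*Optimism and the crude error bound.* On a typical path `r + γ P W ≤ Q_t` and `W ≤ V_t`, as every new
estimate preserves these inequalities. A type-II stage turns the error `Q_t - (r + γ P W)` at a visit
into twice the bonus plus `γ` times the average of the errors `V - W` at the states reached in the
preceding stage. Summed over all visits, every earlier error is counted with total weight at most
`1 + 1 / H`, and `γ (1 + 1 / H) ≤ 1 - (1 - γ) / 2`; the part of the bonuses above a multiple of the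
threshold `β` is summable. Hence the errors above `β` have a finite sum of order `S A H ^ 5 ι / β`
(`sum_max_qTable_sub_backup_le`).

*The visit cap.* Pairs with more than `N₀` visits are frozen, and the crude bound has to show that
they are already accurate although it presupposes that the frozen pairs met earlier are. The
circularity is resolved by induction over the states that have been visited with a frozen pair
(`vTable_sub_le_of_isCapped`): each new state may increase the error by `ε / (12 S H)` only, since
`N₀` visits with a larger error would exceed the crude bound.

*Bellman residuals.* Type-I stages are shorter by the factor `√H`. They control the residual
`Q_t - r - γ P V_t`, whose error consists of the bonus and of the decrease of `P (V - W)` between the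
samples and the visit. As `V - W` is antitone in time, that decrease telescopes, and its sum is smaller
than the sum of `P (V - W)` by the factor `H √H`. The latter sum is controlled by the crude bound, and
`sum_residual_le` follows with `H ^ 4.5` in place of `H ^ 5`.

*Counting.* The clipped difference of `V_t` and the value of the policy `π_t` satisfies a Bellman
inequality with the clipped residual as reward (`gap_path_le`), and it changes only when an action value
is updated, so its sum over time is at most `2 / (1 - γ)` times the sum of the residuals, up to terms of
lower order. A suboptimal step contributes at least `ε / 2` to this sum (`card_suboptimal_le`). The
orders of magnitude `H ≤ 4 L / (1 - γ)` and `ι ≤ a L ln (2 / p)` then give the bound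
(`complexityBound_le`).
-/


namespace UCBMultiStage

/-! ### Bellman equations -/

namespace MDP

variable {𝒮 𝒜 : Type*} [Fintype 𝒮] (M : MDP 𝒮 𝒜)

/-- Expectation of `f` at the state that follows `s` when action `a` is taken. -/
noncomputable def next (s : 𝒮) (a : 𝒜) (f : 𝒮 → ℝ) : ℝ := ∑ s', M.P s a s' * f s'

variable {M}

theorem next_mono (s : 𝒮) (a : 𝒜) {f g : 𝒮 → ℝ} (h : ∀ y, f y ≤ g y) :
    M.next s a f ≤ M.next s a g :=
  Finset.sum_le_sum fun y _ => mul_le_mul_of_nonneg_left (h y) (M.P_nonneg s a y)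

theorem next_const (s : 𝒮) (a : 𝒜) (c : ℝ) : M.next s a (fun _ => c) = c := by
  simp [next, ← Finset.sum_mul, M.P_sum]

theorem next_add (s : 𝒮) (a : 𝒜) (f g : 𝒮 → ℝ) :
    M.next s a (fun y => f y + g y) = M.next s a f + M.next s a g := by
  simp [next, mul_add, Finset.sum_add_distrib]

theorem next_sub (s : 𝒮) (a : 𝒜) (f g : 𝒮 → ℝ) :
    M.next s a (fun y => f y - g y) = M.next s a f - M.next s a g := by
  simp [next, mul_sub, Finset.sum_sub_distrib]

theorem next_smul (s : 𝒮) (a : 𝒜) (c : ℝ) (f : 𝒮 → ℝ) :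
    M.next s a (fun y => c * f y) = c * M.next s a f := by
  simp only [next, Finset.mul_sum]
  exact Finset.sum_congr rfl fun y _ => by ring

theorem next_nonneg (s : 𝒮) (a : 𝒜) {f : 𝒮 → ℝ} (h : ∀ y, 0 ≤ f y) : 0 ≤ M.next s a f :=
  Finset.sum_nonneg fun y _ => mul_nonneg (M.P_nonneg s a y) (h y)

theorem next_le (s : 𝒮) (a : 𝒜) {f : 𝒮 → ℝ} {c : ℝ} (h : ∀ y, f y ≤ c) : M.next s a f ≤ c :=
  (next_mono s a h).trans_eq (next_const s a c)

theorem le_next (s : 𝒮) (a : 𝒜) {f : 𝒮 → ℝ} {c : ℝ} (h : ∀ y, c ≤ f y) : c ≤ M.next s a f :=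
  (next_const s a c).symm.trans_le (next_mono s a h)

theorem abs_next_sub_le (s : 𝒮) (a : 𝒜) {f g : 𝒮 → ℝ} {c : ℝ} (h : ∀ y, |f y - g y| ≤ c) :
    |M.next s a f - M.next s a g| ≤ c := by
  rw [← next_sub, abs_le]
  exact ⟨le_next s a fun y => (abs_le.1 (h y)).1, next_le s a fun y => (abs_le.1 (h y)).2⟩

/-- Jensen's inequality for the positive part. -/
theorem max_next_sub_le (s : 𝒮) (a : 𝒜) (f : 𝒮 → ℝ) (c : ℝ) :
    max (M.next s a f - c) 0 ≤ M.next s a (fun y => max (f y - c) 0) := by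
  refine max_le ?_ (next_nonneg s a fun y => le_max_right _ _)
  have h := next_mono (M := M) s a (f := fun y => f y - c) (g := fun y => max (f y - c) 0)
    fun y => le_max_left _ _
  rwa [next_sub, next_const] at h

/-! #### The value of a stationary policy -/

theorem law_nonneg (π : 𝒮 → 𝒜) (s : 𝒮) (t : ℕ) (y : 𝒮) : 0 ≤ M.law π s t y := by
  induction t generalizing y with
  | zero => simp only [law]; split_ifs <;> norm_num
  | succ t ih => exact Finset.sum_nonneg fun x _ => mul_nonneg (ih x) (M.P_nonneg _ _ _)

theorem law_sum (π : 𝒮 → 𝒜) (s : 𝒮) (t : ℕ) : ∑ y, M.law π s t y = 1 := by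
  classical
  induction t with
  | zero => simp [law]
  | succ t ih =>
    simp only [law]
    rw [Finset.sum_comm]
    simp [← Finset.mul_sum, M.P_sum, ih]

/-- Decomposition of the law of the chain at its first transition. -/
theorem law_succ (π : 𝒮 → 𝒜) (s : 𝒮) (t : ℕ) (y : 𝒮) :
    M.law π s (t + 1) y = ∑ x, M.P s (π s) x * M.law π x t y := by
  classical
  induction t generalizing y with
  | zero => simp [law]
  | succ t ih =>
    rw [law]
    simp only [ih]
    simp only [law, Finset.sum_mul, Finset.mul_sum]
    rw [Finset.sum_comm]
    exact Finset.sum_congr rfl fun x _ => Finset.sum_congr rfl fun z _ => by ring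

theorem reward_mem (π : 𝒮 → 𝒜) (s : 𝒮) (t : ℕ) :
    0 ≤ ∑ y, M.law π s t y * M.r y (π y) ∧ ∑ y, M.law π s t y * M.r y (π y) ≤ 1 := by
  refine ⟨Finset.sum_nonneg fun y _ => mul_nonneg (law_nonneg π s t y) (M.r_nonneg _ _), ?_⟩
  rw [← law_sum (M := M) π s t]
  exact Finset.sum_le_sum fun y _ => mul_le_of_le_one_right (law_nonneg π s t y) (M.r_le_one _ _)

variable {γ : ℝ}

theorem summable_value (h0 : 0 < γ) (h1 : γ < 1) (π : 𝒮 → 𝒜) (s : 𝒮) :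
    Summable fun t : ℕ => γ ^ t * ∑ y, M.law π s t y * M.r y (π y) :=
  (summable_geometric_of_lt_one h0.le h1).of_nonneg_of_le
    (fun t => mul_nonneg (pow_nonneg h0.le t) (reward_mem π s t).1)
    (fun t => mul_le_of_le_one_right (pow_nonneg h0.le t) (reward_mem π s t).2)

theorem value_nonneg (h0 : 0 < γ) (π : 𝒮 → 𝒜) (s : 𝒮) : 0 ≤ M.value γ π s :=
  tsum_nonneg fun t => mul_nonneg (pow_nonneg h0.le t) (reward_mem π s t).1

/-- Bellman's equation for a stationary policy. -/
theorem value_eq (h0 : 0 < γ) (h1 : γ < 1) (π : 𝒮 → 𝒜) (s : 𝒮) :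
    M.value γ π s = M.r s (π s) + γ * M.next s (π s) (M.value γ π) := by
  classical
  have h := (summable_value (M := M) h0 h1 π s).tsum_eq_zero_add
  rw [value, h]
  congr 1
  · simp [law]
  · simp only [next, value]
    simp_rw [← tsum_mul_left]
    rw [← Summable.tsum_finsetSum fun x _ => (summable_value h0 h1 π x).mul_left _, ← tsum_mul_left]
    refine tsum_congr fun t => ?_
    simp only [law_succ, Finset.sum_mul, Finset.mul_sum]
    rw [Finset.sum_comm]
    exact Finset.sum_congr rfl fun x _ => Finset.sum_congr rfl fun y _ => by ring

/-! #### The Bellman optimality equation -/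

variable [Nonempty 𝒜]

/-- The Bellman optimality operator is a contraction of `𝒮 → ℝ` with the sup metric. -/
theorem exists_bellman_fixedPoint [Finite 𝒜] (h0 : 0 < γ) (h1 : γ < 1) :
    ∃ W : 𝒮 → ℝ, ∀ s, W s = ⨆ a, (M.r s a + γ * M.next s a W) := by
  let T : (𝒮 → ℝ) → 𝒮 → ℝ := fun W s => ⨆ a, (M.r s a + γ * M.next s a W)
  have key : ∀ (f g : 𝒮 → ℝ) (s : 𝒮), T f s ≤ T g s + γ * dist f g := by
    intro f g s
    refine ciSup_le fun a => ?_
    have h := le_ciSup (Set.finite_range fun a => M.r s a + γ * M.next s a g).bddAbove a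
    have h' := abs_next_sub_le (M := M) s a (f := f) (g := g) (c := dist f g) fun y => by
      rw [← Real.dist_eq]; exact dist_le_pi_dist f g y
    have h'' := mul_le_mul_of_nonneg_left (abs_le.1 h').2 h0.le
    simp only [T]
    linarith
  have hT : ContractingWith ⟨γ, h0.le⟩ T := by
    refine ⟨by exact_mod_cast h1, LipschitzWith.of_dist_le_mul fun f g => ?_⟩
    refine (dist_pi_le_iff (mul_nonneg h0.le dist_nonneg)).2 fun s => ?_
    rw [Real.dist_eq, abs_le]
    have h₁ := key f g s
    have h₂ := key g f s
    rw [dist_comm g f] at h₂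
    constructor <;> linarith!
  exact ⟨hT.fixedPoint T, fun s => (congrFun hT.fixedPoint_isFixedPt s).symm⟩

/-- `W` solves the Bellman optimality equation of `M`. -/
structure IsBellmanSolution (M : MDP 𝒮 𝒜) (γ : ℝ) (W : 𝒮 → ℝ) : Prop where
  ge : ∀ s a, M.r s a + γ * M.next s a W ≤ W s
  attained : ∀ s, ∃ a, W s = M.r s a + γ * M.next s a W
  nonneg : ∀ s, 0 ≤ W s
  le : ∀ s, W s ≤ 1 / (1 - γ)

theorem exists_isBellmanSolution [Finite 𝒜] [Nonempty 𝒮] (h0 : 0 < γ) (h1 : γ < 1) :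
    ∃ W, IsBellmanSolution M γ W := by
  obtain ⟨W, hW⟩ := exists_bellman_fixedPoint (M := M) h0 h1
  have ge : ∀ s a, M.r s a + γ * M.next s a W ≤ W s := fun s a => by
    rw [hW s]
    exact le_ciSup (f := fun a => M.r s a + γ * M.next s a W) (Set.finite_range _).bddAbove a
  have att : ∀ s, ∃ a, W s = M.r s a + γ * M.next s a W := fun s => by
    obtain ⟨a, ha⟩ := exists_eq_ciSup_of_finite (f := fun a => M.r s a + γ * M.next s a W)
    exact ⟨a, by rw [hW s, ← ha]⟩
  refine ⟨W, ge, att, fun s => ?_, fun s => ?_⟩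
  · obtain ⟨s₀, hs₀⟩ := Finite.exists_min W
    refine le_trans ?_ (hs₀ s)
    obtain ⟨a⟩ := ‹Nonempty 𝒜›
    have h := ge s₀ a
    have h' := le_next (M := M) s₀ a hs₀
    have := M.r_nonneg s₀ a
    nlinarith
  · obtain ⟨s₀, hs₀⟩ := Finite.exists_max W
    refine (hs₀ s).trans ?_
    obtain ⟨a, ha⟩ := att s₀
    have h' := next_le (M := M) s₀ a hs₀
    have := M.r_le_one s₀ a
    rw [le_div_iff₀ (by linarith)]
    nlinarith

/-- A solution of the optimality equation dominates the optimal value function. (The two are equal,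
but only this inequality is needed.) -/
theorem IsBellmanSolution.optValue_le {W : 𝒮 → ℝ} (hW : IsBellmanSolution M γ W)
    (h0 : 0 < γ) (h1 : γ < 1) (s : 𝒮) : M.optValue γ s ≤ W s := by
  refine ciSup_le fun π => ?_
  have : Nonempty 𝒮 := ⟨s⟩
  obtain ⟨s₀, hs₀⟩ := Finite.exists_max fun s => M.value γ π s - W s
  have h := value_eq (M := M) h0 h1 π s₀
  have h2 := hW.ge s₀ (π s₀)
  have h3 := next_le (M := M) s₀ (π s₀) hs₀
  rw [next_sub] at h3
  have h4 := hs₀ s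
  nlinarith

end MDP

/-! ### Stage lengths -/

theorem stageLen_succ (H : ℕ) {j : ℕ} (hj : 1 ≤ j) :
    stageLen H (j + 1) = stageLen H j + stageLen H j / H := by
  obtain ⟨i, rfl⟩ := Nat.exists_eq_add_of_le' hj
  rfl

theorem stageLen_mono (H : ℕ) : Monotone (stageLen H) := by
  refine monotone_nat_of_le_succ fun j => ?_
  rcases Nat.eq_zero_or_pos j with rfl | hj
  · exact Nat.zero_le _
  · rw [stageLen_succ H hj]; exact Nat.le_add_right _ _

theorem le_stageLen (H : ℕ) {j : ℕ} (hj : 1 ≤ j) : H ≤ stageLen H j := stageLen_mono H hj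

theorem stageLen_succ_le (H : ℕ) {j : ℕ} (hj : 1 ≤ j) :
    (stageLen H (j + 1) : ℝ) ≤ (1 + 1 / H) * stageLen H j := by
  rw [stageLen_succ H hj, Nat.cast_add, add_mul, one_mul]
  have : ((stageLen H j / H : ℕ) : ℝ) ≤ stageLen H j / H := Nat.cast_div_le
  rw [one_div_mul_eq_div]
  linarith

theorem le_stageLen_succ {H : ℕ} (hH : 1 ≤ H) {j : ℕ} (hj : 1 ≤ j) :
    (stageLen H j : ℝ) ≤ 2 * H * ((stageLen H (j + 1) : ℝ) - stageLen H j) := by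
  rw [stageLen_succ H hj, Nat.cast_add, add_sub_cancel_left]
  have h1 : stageLen H j < H * (stageLen H j / H + 1) := Nat.lt_mul_div_succ _ hH
  have h2 : 1 ≤ stageLen H j / H := (Nat.one_le_div_iff hH).2 (le_stageLen H hj)
  have h3 : stageLen H j ≤ 2 * H * (stageLen H j / H) := by nlinarith
  exact_mod_cast h3

theorem stageLen_succ_le_two {H : ℕ} {j : ℕ} (hj : 1 ≤ j) :
    stageLen H (j + 1) ≤ 2 * stageLen H j := by
  rw [stageLen_succ H hj]
  have := Nat.div_le_self (stageLen H j) H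
  omega

/-- Stage lengths that stay equal for `B` consecutive stages and then grow by the factor
`1 + 1 / H`. Type-I stages have `B = √H`, type-II stages have `B = 1`. -/
noncomputable def stretchedLen (H : ℕ) (B : ℝ) (j : ℕ) : ℕ := stageLen H ⌈(j : ℝ) / B⌉₊

/-- Number of visits after which the `j`-th stage of lengths `e 1, e 2, …` ends. -/
def stageEnd (e : ℕ → ℕ) (j : ℕ) : ℕ := ∑ i ∈ Finset.Icc 1 j, e i

@[simp] theorem stageEnd_zero (e : ℕ → ℕ) : stageEnd e 0 = 0 := by simp [stageEnd]

theorem stageEnd_succ (e : ℕ → ℕ) (j : ℕ) : stageEnd e (j + 1) = stageEnd e j + e (j + 1) := by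
  rw [stageEnd, Finset.sum_Icc_succ_top (by omega), stageEnd]

/-- The properties of a sequence of stage lengths on which the analysis rests: it starts with `H`,
grows at most by the factor `1 + 1 / H` per stage, and the total length of all stages is of the
order of `H * B` times the length of the last one. -/
structure IsStageSeq (e : ℕ → ℕ) (H : ℕ) (B : ℝ) : Prop where
  one_le_H : 1 ≤ H
  one_le_B : 1 ≤ B
  first : e 1 = H
  le_len : ∀ j, 1 ≤ j → H ≤ e j
  succ_le : ∀ j, 1 ≤ j → (e (j + 1) : ℝ) ≤ (1 + 1 / H) * e j
  end_le : ∀ j, 1 ≤ j → (stageEnd e (j + 1) : ℝ) ≤ 18 * H * B * e j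
  len_le : ∀ j, (e (j + 1) : ℝ) ≤ H + 2 * stageEnd e j / (H * B)

section Stretched

variable {H : ℕ} {B : ℝ}

theorem one_le_ceil_div (hB : 1 ≤ B) {j : ℕ} (hj : 1 ≤ j) : 1 ≤ ⌈(j : ℝ) / B⌉₊ :=
  Nat.ceil_pos.2 (div_pos (by exact_mod_cast hj) (by linarith))

theorem stretchedLen_mono (hB : 1 ≤ B) : Monotone (stretchedLen H B) := fun i j h =>
  stageLen_mono H (Nat.ceil_mono (div_le_div_of_nonneg_right (by exact_mod_cast h) (by linarith)))

theorem stretchedLen_add_le (hB : 1 ≤ B) {j k m : ℕ} (h : (k : ℝ) ≤ m * B) :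
    stretchedLen H B (j + k) ≤ stageLen H (⌈(j : ℝ) / B⌉₊ + m) := by
  have hB' : 0 < B := by linarith
  refine stageLen_mono H (Nat.ceil_le.2 ?_)
  push_cast
  rw [add_div]
  exact add_le_add (Nat.le_ceil _) ((div_le_iff₀ hB').2 h)

theorem le_stretchedLen_add (hB : 1 ≤ B) {j k : ℕ} (h : B ≤ k) :
    stageLen H (⌈(j : ℝ) / B⌉₊ + 1) ≤ stretchedLen H B (j + k) := by
  have hB' : 0 < B := by linarith
  refine stageLen_mono H ?_
  rw [← Nat.ceil_add_one (by positivity)]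
  refine Nat.ceil_mono ?_
  push_cast
  rw [add_div]
  gcongr
  rwa [one_le_div hB']

theorem sum_shift_sub (f : ℕ → ℝ) (j k : ℕ) :
    ∑ i ∈ Finset.Icc 1 j, (f (i + k) - f i) =
      ∑ i ∈ Finset.Icc 1 k, f (i + j) - ∑ i ∈ Finset.Icc 1 k, f i := by
  induction j with
  | zero => simp
  | succ j ih =>
    rw [Finset.sum_Icc_succ_top (by omega), ih]
    have : ∀ k, ∑ i ∈ Finset.Icc 1 k, f (i + (j + 1)) =
        ∑ i ∈ Finset.Icc 1 k, f (i + j) + f (k + j + 1) - f (j + 1) := by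
      intro k
      induction k with
      | zero => simp
      | succ k ih =>
        rw [Finset.sum_Icc_succ_top (by omega), ih, Finset.sum_Icc_succ_top (by omega)]
        rw [show k + 1 + (j + 1) = k + 1 + j + 1 by ring, show k + 1 + j = k + j + 1 by ring]
        ring
    rw [this, show j + 1 + k = k + j + 1 by ring]
    ring

theorem isStageSeq_stretchedLen (hH : 1 ≤ H) (hB : 1 ≤ B) : IsStageSeq (stretchedLen H B) H B := by
  have hB' : 0 < B := by linarith
  have hH' : (1 : ℝ) ≤ H := by exact_mod_cast hH
  have succ_le : ∀ j, 1 ≤ j →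
      (stretchedLen H B (j + 1) : ℝ) ≤ (1 + 1 / H) * stretchedLen H B j := fun j hj =>
    (Nat.cast_le.2 (stretchedLen_add_le (H := H) (j := j) (k := 1) (m := 1) hB
      (by simpa using hB))).trans (stageLen_succ_le H (one_le_ceil_div hB hj))
  have hfirst : ∀ i : ℕ, 1 ≤ i → (i : ℝ) ≤ B → stretchedLen H B i = H := fun i hi h => by
    have : ⌈(i : ℝ) / B⌉₊ = 1 := by
      refine le_antisymm (Nat.ceil_le.2 ?_) (one_le_ceil_div hB hi)
      simpa using (div_le_one hB').2 h
    rw [stretchedLen, this]; rfl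
  have hlen : ∀ j, 1 ≤ j → H ≤ stretchedLen H B j := fun j hj =>
    le_stageLen H (one_le_ceil_div hB hj)
  -- comparing each stage with the stage `⌈B⌉` later bounds the total length by the last length
  have hend : ∀ j, 1 ≤ j → (stageEnd (stretchedLen H B) j : ℝ) ≤ 16 * H * B * stretchedLen H B j := by
    intro j hj
    set k := ⌈B⌉₊ with hk
    have hkB : B ≤ k := Nat.le_ceil B
    have hk2 : (k : ℝ) ≤ 2 * B := by
      have := Nat.ceil_lt_add_one hB'.le
      linarith
    have h1 : ∀ i ∈ Finset.Icc 1 j, (stretchedLen H B i : ℝ) ≤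
        2 * H * ((stretchedLen H B (i + k) : ℝ) - stretchedLen H B i) := fun i hi => by
      have hi1 := (Finset.mem_Icc.1 hi).1
      refine (le_stageLen_succ hH (one_le_ceil_div hB hi1)).trans ?_
      have : (stageLen H (⌈(i : ℝ) / B⌉₊ + 1) : ℝ) ≤ stretchedLen H B (i + k) :=
        Nat.cast_le.2 (le_stretchedLen_add hB hkB)
      have hdef : (stageLen H ⌈(i : ℝ) / B⌉₊ : ℝ) = stretchedLen H B i := rfl
      rw [hdef]
      gcongr
    have h2 := Finset.sum_le_sum h1
    rw [← Finset.mul_sum, sum_shift_sub (fun i => (stretchedLen H B i : ℝ))] at h2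
    have h3 : ∑ i ∈ Finset.Icc 1 k, (stretchedLen H B (i + j) : ℝ) ≤
        ∑ i ∈ Finset.Icc 1 k, (4 * stretchedLen H B j : ℝ) := by
      refine Finset.sum_le_sum fun i hi => ?_
      have hik : (i : ℝ) ≤ (2 : ℕ) * B := by
        have : (i : ℝ) ≤ k := by exact_mod_cast (Finset.mem_Icc.1 hi).2
        push_cast; linarith
      have h4 := stretchedLen_add_le (H := H) (j := j) hB hik
      have h5 : stageLen H (⌈(j : ℝ) / B⌉₊ + 2) ≤ 2 * stageLen H (⌈(j : ℝ) / B⌉₊ + 1) :=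
        stageLen_succ_le_two (by omega)
      have h6 := stageLen_succ_le_two (H := H) (one_le_ceil_div hB hj)
      have h7 : stretchedLen H B (i + j) ≤ 4 * stretchedLen H B j := by
        rw [add_comm i j]
        have : stretchedLen H B j = stageLen H ⌈(j : ℝ) / B⌉₊ := rfl
        omega
      exact_mod_cast h7
    rw [Finset.sum_const, Nat.card_Icc, nsmul_eq_mul, Nat.add_sub_cancel] at h3
    have h8 : (0 : ℝ) ≤ ∑ i ∈ Finset.Icc 1 k, (stretchedLen H B i : ℝ) :=
      Finset.sum_nonneg fun i _ => Nat.cast_nonneg _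
    rw [stageEnd, Nat.cast_sum]
    calc _ ≤ _ := h2
      _ ≤ 2 * H * (2 * B * (4 * stretchedLen H B j)) := by
        gcongr
        have : (k : ℝ) * (4 * stretchedLen H B j) ≤ 2 * B * (4 * stretchedLen H B j) := by gcongr
        linarith
      _ = _ := by ring
  refine ⟨hH, hB, hfirst 1 le_rfl (by simpa using hB), hlen, succ_le, fun j hj => ?_, fun j => ?_⟩
  · rw [stageEnd_succ, Nat.cast_add]
    have h1 := hend j hj
    have h2 := succ_le j hj
    have h3 : (1 : ℝ) / H ≤ 1 := by rw [div_le_one (by linarith)]; exact hH'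
    have h4 : (0 : ℝ) ≤ stretchedLen H B j := Nat.cast_nonneg _
    have h5 : (1 : ℝ) * (1 / H * stretchedLen H B j) ≤ stretchedLen H B j := by nlinarith
    have h6 : (1 : ℝ) ≤ H * B := by nlinarith
    nlinarith
  · -- comparing each stage with the stage `⌊B⌋` later bounds the last length by the total length
    set k := ⌊B⌋₊ with hk
    have hk1 : 1 ≤ k := Nat.one_le_floor_iff B |>.2 hB
    have hkB : (k : ℝ) ≤ B := Nat.floor_le hB'.le
    have hk2 : B ≤ 2 * k := by
      have := Nat.lt_floor_add_one B
      have : (1 : ℝ) ≤ k := by exact_mod_cast hk1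
      linarith
    have h1 : ∀ i ∈ Finset.Icc 1 j, ((stretchedLen H B (i + k) : ℝ) - stretchedLen H B i) ≤
        1 / H * stretchedLen H B i := fun i hi => by
      have hi1 := (Finset.mem_Icc.1 hi).1
      have h2 : (stretchedLen H B (i + k) : ℝ) ≤ stageLen H (⌈(i : ℝ) / B⌉₊ + 1) :=
        Nat.cast_le.2 (stretchedLen_add_le (m := 1) hB (by simpa using hkB))
      have h3 := stageLen_succ_le H (one_le_ceil_div hB hi1)
      have : stretchedLen H B i = stageLen H ⌈(i : ℝ) / B⌉₊ := rfl
      rw [this]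
      linarith
    have h2 := Finset.sum_le_sum h1
    rw [← Finset.mul_sum, sum_shift_sub (fun i => (stretchedLen H B i : ℝ)),
      ← Finset.sum_sub_distrib] at h2
    have h3 : ∑ i ∈ Finset.Icc 1 k, ((stretchedLen H B (j + 1) : ℝ) - H) ≤
        ∑ i ∈ Finset.Icc 1 k, ((stretchedLen H B (i + j) : ℝ) - stretchedLen H B i) := by
      refine Finset.sum_le_sum fun i hi => ?_
      obtain ⟨hi1, hik⟩ := Finset.mem_Icc.1 hi
      rw [hfirst i hi1 (le_trans (by exact_mod_cast hik) hkB)]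
      have : (stretchedLen H B (j + 1) : ℝ) ≤ stretchedLen H B (i + j) :=
        Nat.cast_le.2 (stretchedLen_mono hB (by omega))
      linarith
    rw [Finset.sum_const, Nat.card_Icc, nsmul_eq_mul, Nat.add_sub_cancel] at h3
    have h4 : (stageEnd (stretchedLen H B) j : ℝ) = ∑ i ∈ Finset.Icc 1 j, (stretchedLen H B i : ℝ) := by
      rw [stageEnd, Nat.cast_sum]
    rw [← h4] at h2
    have h5 : (0 : ℝ) ≤ (stretchedLen H B (j + 1) : ℝ) - H :=
      sub_nonneg.2 (Nat.cast_le.2 (hlen _ (by omega)))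
    have h6 : ((stretchedLen H B (j + 1) : ℝ) - H) ≤
        2 * stageEnd (stretchedLen H B) j / (H * B) := by
      rw [le_div_iff₀ (by positivity)]
      have h7 : (k : ℝ) * ((stretchedLen H B (j + 1) : ℝ) - H) * H ≤
          stageEnd (stretchedLen H B) j := by
        have := h3.trans h2
        rwa [one_div_mul_eq_div, le_div_iff₀ (by linarith)] at this
      have h8 : B * (((stretchedLen H B (j + 1) : ℝ) - H) * H) ≤
        2 * k * (((stretchedLen H B (j + 1) : ℝ) - H) * H) := by gcongr
      linarith
    linarith

end Stretched

theorem Params.eBar_eq (q : Params) : q.eBar = stretchedLen q.H 1 := by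
  funext j; simp [Params.eBar, stretchedLen]

namespace IsStageSeq

variable {e : ℕ → ℕ} {H : ℕ} {B : ℝ} (he : IsStageSeq e H B)
include he

theorem pos {j : ℕ} (hj : 1 ≤ j) : 1 ≤ e j := he.one_le_H.trans (he.le_len j hj)

theorem len_succ_le_two {j : ℕ} (hj : 1 ≤ j) : (e (j + 1) : ℝ) ≤ 2 * e j := by
  have h1 := he.succ_le j hj
  have hH : (1 : ℝ) ≤ H := by exact_mod_cast he.one_le_H
  have h3 : (1 : ℝ) / H ≤ 1 := by rw [div_le_one (by linarith)]; exact hH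
  have h4 : (0 : ℝ) ≤ e j := Nat.cast_nonneg _
  nlinarith

theorem stageEnd_strictMono : StrictMono (stageEnd e) :=
  strictMono_nat_of_lt_succ fun j => by
    rw [stageEnd_succ]; exact Nat.lt_add_of_pos_right (he.pos (by omega))

theorem le_stageEnd (j : ℕ) : j ≤ stageEnd e j := he.stageEnd_strictMono.le_apply

/-- Stage ends grow geometrically. -/
theorem pow_le_stageEnd (j : ℕ) :
    (1 + 1 / (18 * H * B)) ^ j ≤ (stageEnd e (j + 1) : ℝ) := by
  have hH : (1 : ℝ) ≤ H := by exact_mod_cast he.one_le_H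
  have hB := he.one_le_B
  induction j with
  | zero =>
    have := he.le_stageEnd 1
    simpa using (Nat.one_le_cast (α := ℝ)).2 this
  | succ j ih =>
    have hκ : 0 < 18 * (H : ℝ) * B := by positivity
    have h1 := he.end_le (j + 1) (by omega)
    have h2 : (stageEnd e (j + 1) : ℝ) ≤ stageEnd e (j + 2) :=
      Nat.cast_le.2 (he.stageEnd_strictMono.monotone (by omega))
    have h4 : (stageEnd e (j + 2 + 1) : ℝ) ≤ 18 * H * B * e (j + 2) := he.end_le (j + 2) (by omega)
    have h5 : (stageEnd e (j + 2) : ℝ) ≤ stageEnd e (j + 2 + 1) :=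
      Nat.cast_le.2 (he.stageEnd_strictMono.monotone (by omega))
    have h6 : (stageEnd e (j + 1) : ℝ) / (18 * H * B) ≤ e (j + 2) := by
      rw [div_le_iff₀ hκ]; linarith
    have h7 : (stageEnd e (j + 1 + 1) : ℝ) = stageEnd e (j + 1) + e (j + 2) := by
      rw [stageEnd_succ, Nat.cast_add]
    rw [pow_succ, h7]
    have h8 : 0 ≤ 1 / (18 * (H : ℝ) * B) := by positivity
    calc _ ≤ (stageEnd e (j + 1) : ℝ) * (1 + 1 / (18 * H * B)) := by gcongr
      _ = (stageEnd e (j + 1) : ℝ) + stageEnd e (j + 1) / (18 * H * B) := by ring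
      _ ≤ _ := by linarith

end IsStageSeq

/-- Number of stages that begin within the first `N₀` visits. -/
noncomputable def stageCount (e : ℕ → ℕ) (N₀ : ℝ) : ℕ := sSup {j : ℕ | (stageEnd e (j - 1) : ℝ) ≤ N₀}

theorem Params.JChk_eq (q : Params) : q.JChk = stageCount q.eChk q.N₀ := rfl

theorem Params.JBar_eq (q : Params) : q.JBar = stageCount q.eBar q.N₀ := rfl

namespace IsStageSeq

variable {e : ℕ → ℕ} {H : ℕ} {B N₀ : ℝ} (he : IsStageSeq e H B)
include he

theorem le_of_stageEnd_le {j : ℕ} (h : (stageEnd e (j - 1) : ℝ) ≤ N₀) : (j : ℝ) ≤ N₀ + 1 := by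
  have h1 : j ≤ stageEnd e (j - 1) + 1 := by
    have := he.le_stageEnd (j - 1); omega
  have h2 : (j : ℝ) ≤ stageEnd e (j - 1) + 1 := by exact_mod_cast h1
  linarith

theorem bddAbove_stageCount : BddAbove {j : ℕ | (stageEnd e (j - 1) : ℝ) ≤ N₀} :=
  ⟨⌊N₀ + 1⌋₊, fun _ h => Nat.le_floor (he.le_of_stageEnd_le h)⟩

theorem succ_le_stageCount {j : ℕ} (h : (stageEnd e j : ℝ) ≤ N₀) : j + 1 ≤ stageCount e N₀ :=
  le_csSup he.bddAbove_stageCount h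

theorem stageEnd_stageCount_le (h : 0 ≤ N₀) : (stageEnd e (stageCount e N₀ - 1) : ℝ) ≤ N₀ :=
  Nat.sSup_mem (s := {j : ℕ | (stageEnd e (j - 1) : ℝ) ≤ N₀}) ⟨0, by simpa using h⟩
    he.bddAbove_stageCount

theorem stageCount_le (h : 0 ≤ N₀) : (stageCount e N₀ : ℝ) ≤ N₀ + 1 :=
  he.le_of_stageEnd_le (he.stageEnd_stageCount_le h)

theorem stageCount_mono {N₁ : ℝ} (h : 0 ≤ N₀) (h' : N₀ ≤ N₁) : stageCount e N₀ ≤ stageCount e N₁ :=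
  le_csSup he.bddAbove_stageCount ((he.stageEnd_stageCount_le h).trans h')

theorem stageCount_le_log (h : 0 ≤ N₀) :
    (stageCount e N₀ : ℝ) ≤ 2 + 36 * H * B * Real.log (1 + N₀) := by
  have hH : (1 : ℝ) ≤ H := by exact_mod_cast he.one_le_H
  have hB := he.one_le_B
  have hlog : 0 ≤ Real.log (1 + N₀) := Real.log_nonneg (by linarith)
  rcases Nat.lt_or_ge (stageCount e N₀) 2 with h2 | h2
  · have : (stageCount e N₀ : ℝ) ≤ 2 := by exact_mod_cast h2.le
    have : 0 ≤ 36 * H * B * Real.log (1 + N₀) := by positivity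
    linarith
  · obtain ⟨j, hj⟩ := Nat.exists_eq_add_of_le' h2
    have h3 := he.stageEnd_stageCount_le h
    rw [hj, show j + 2 - 1 = j + 1 by omega] at h3
    have hκ : 0 < 18 * (H : ℝ) * B := by positivity
    have hκ1 : 1 ≤ 18 * (H : ℝ) * B := by nlinarith
    have h4 : (1 + 1 / (18 * H * B)) ^ j ≤ 1 + N₀ := (he.pow_le_stageEnd j).trans (by linarith)
    have h5 := Real.log_le_log (by positivity) h4
    rw [Real.log_pow] at h5
    have h6 : 1 / (36 * (H : ℝ) * B) ≤ Real.log (1 + 1 / (18 * H * B)) := by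
      have h7 := Real.one_sub_inv_le_log_of_pos (x := 1 + 1 / (18 * (H : ℝ) * B)) (by positivity)
      refine le_trans ?_ h7
      have h8 : 1 - (1 + 1 / (18 * (H : ℝ) * B))⁻¹ = 1 / (18 * H * B + 1) := by
        field_simp; ring
      rw [h8]
      exact one_div_le_one_div_of_le (by positivity) (by linarith)
    have h9 : (j : ℝ) * (1 / (36 * (H : ℝ) * B)) ≤ Real.log (1 + N₀) :=
      (mul_le_mul_of_nonneg_left h6 (Nat.cast_nonneg j)).trans h5
    rw [mul_one_div, div_le_iff₀ (by positivity)] at h9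
    rw [hj]; push_cast
    linarith

end IsStageSeq

/-! ### Counting visits along a sequence -/

section Visits

variable {Z : Type*} (ζ : ℕ → Z) (z : Z)

open Classical in
/-- Number of visits of the sequence `ζ` to `z` before time `t`. -/
noncomputable def visits (t : ℕ) : ℕ := Nat.count (fun u => ζ u = z) t

/-- Time of the visit of `ζ` to `z` that is preceded by `k` visits (`0` if there is none). -/
noncomputable def visitTime (k : ℕ) : ℕ := Nat.nth (fun u => ζ u = z) k

@[simp] theorem visits_zero : visits ζ z 0 = 0 := by simp [visits]

variable {ζ z}

theorem visits_succ_of_eq {t : ℕ} (h : ζ t = z) : visits ζ z (t + 1) = visits ζ z t + 1 := by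
  simp [visits, Nat.count_succ, h]

theorem visits_succ_of_ne {t : ℕ} (h : ζ t ≠ z) : visits ζ z (t + 1) = visits ζ z t := by
  simp [visits, Nat.count_succ, h]

theorem visitTime_visits {t : ℕ} (h : ζ t = z) : visitTime ζ z (visits ζ z t) = t := by
  classical
  exact Nat.nth_count (p := fun u => ζ u = z) h

theorem visits_mono : Monotone (visits ζ z) := by
  classical
  exact Nat.count_monotone _

theorem visitTime_spec {k t : ℕ} (h : k < visits ζ z t) :
    ζ (visitTime ζ z k) = z ∧ visitTime ζ z k < t ∧ visits ζ z (visitTime ζ z k) = k := by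
  induction t with
  | zero => simp at h
  | succ t ih =>
    by_cases hk : k < visits ζ z t
    · obtain ⟨h1, h2, h3⟩ := ih hk
      exact ⟨h1, by omega, h3⟩
    · by_cases hz : ζ t = z
      · rw [visits_succ_of_eq hz] at h
        obtain rfl : k = visits ζ z t := by omega
        rw [visitTime_visits hz]
        exact ⟨hz, by omega, rfl⟩
      · rw [visits_succ_of_ne hz] at h
        exact absurd h hk

theorem visitTime_lt_visitTime {k l t : ℕ} (hkl : k < l) (hl : l < visits ζ z t) :
    visitTime ζ z k < visitTime ζ z l := by
  by_contra h
  have h1 := (visitTime_spec hl).2.2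
  have h2 := (visitTime_spec (hkl.trans hl)).2.2
  have h3 := visits_mono (ζ := ζ) (z := z) (not_lt.1 h)
  omega

open Classical in
theorem sum_visits_eq (F : ℕ → ℕ → ℝ) (T : ℕ) :
    ∑ u ∈ Finset.range T, (if ζ u = z then F (visits ζ z u) u else 0) =
      ∑ k ∈ Finset.range (visits ζ z T), F k (visitTime ζ z k) := by
  induction T with
  | zero => simp
  | succ T ih =>
    rw [Finset.sum_range_succ, ih]
    by_cases h : ζ T = z
    · rw [visits_succ_of_eq h, Finset.sum_range_succ, if_pos h, visitTime_visits h]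
    · rw [visits_succ_of_ne h, if_neg h, add_zero]

/-- A sum over time is a sum over all points `z` and all visits to `z`. -/
theorem sum_time_eq_sum_visits [Fintype Z] (F : Z → ℕ → ℕ → ℝ) (T : ℕ) :
    ∑ u ∈ Finset.range T, F (ζ u) (visits ζ (ζ u) u) u =
      ∑ z, ∑ k ∈ Finset.range (visits ζ z T), F z k (visitTime ζ z k) := by
  classical
  simp_rw [← sum_visits_eq]
  rw [Finset.sum_comm]
  refine Finset.sum_congr rfl fun u _ => ?_
  rw [Finset.sum_eq_single (ζ u)]
  · simp
  · intro b _ hb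
    rw [if_neg (Ne.symm hb)]
  · simp

end Visits

/-! ### Accumulators that are reset at stage ends -/

section Accumulators

open Classical in
/-- A counter of visits that is reset whenever the total number of visits lies in `L`. -/
noncomputable def stageCounter (L : Set ℕ) : ℕ → ℕ
  | 0 => 0
  | n + 1 => if n + 1 ∈ L then 0 else stageCounter L n + 1

open Classical in
/-- An accumulator of the values `v 0, v 1, …` that is reset whenever the total number of visits
lies in `L`. -/
noncomputable def stageTotal (L : Set ℕ) (v : ℕ → ℝ) : ℕ → ℝ
  | 0 => 0
  | n + 1 => if n + 1 ∈ L then 0 else stageTotal L v n + v n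

/-- The numbers of visits at which one of the first `J` stages ends. -/
def stageEnds (e : ℕ → ℕ) (J : ℕ) : Set ℕ := {n | ∃ j, 1 ≤ j ∧ j ≤ J ∧ n = stageEnd e j}

variable {e : ℕ → ℕ} {H : ℕ} {B : ℝ} (he : IsStageSeq e H B)
include he

theorem IsStageSeq.stageCounter_eq {J j n : ℕ} (hj : j < J) (h1 : stageEnd e j ≤ n)
    (h2 : n < stageEnd e (j + 1)) (v : ℕ → ℝ) :
    stageCounter (stageEnds e J) n = n - stageEnd e j ∧
      stageTotal (stageEnds e J) v n = ∑ k ∈ Finset.Ico (stageEnd e j) n, v k := by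
  induction n, h1 using Nat.le_induction with
  | base =>
    rcases Nat.eq_zero_or_pos j with rfl | hj0
    · simp [stageCounter, stageTotal]
    · obtain ⟨m, hm⟩ : ∃ m, stageEnd e j = m + 1 :=
        Nat.exists_eq_add_of_le' (hj0.trans_le (he.le_stageEnd j))
      have hmem : m + 1 ∈ stageEnds e J := ⟨j, hj0, hj.le, hm.symm⟩
      rw [hm]
      simp [stageCounter, stageTotal, hmem]
  | succ n hn ih =>
    obtain ⟨ih1, ih2⟩ := ih (by omega)
    have hmem : n + 1 ∉ stageEnds e J := by
      rintro ⟨i, _, _, hi⟩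
      have h3 : j < i := he.stageEnd_strictMono.lt_iff_lt.1 (by omega)
      have h4 := he.stageEnd_strictMono.monotone (show j + 1 ≤ i by omega)
      omega
    rw [stageCounter, stageTotal, if_neg hmem, if_neg hmem, ih1, ih2, Finset.sum_Ico_succ_top hn]
    exact ⟨by omega, rfl⟩

end Accumulators

/-! ### The run of the algorithm along a path -/

section Path

variable {𝒮 𝒜 : Type*} [Fintype 𝒮] (M : MDP 𝒮 𝒜) (q : Params) (sel : 𝒮 → (𝒜 → ℝ) → 𝒜) (x : ℕ → 𝒮)

/-- The state-action pair visited at time `t`. -/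
noncomputable def pairAt (t : ℕ) : 𝒮 × 𝒜 := (x t, policy M q sel x t (x t))

/-- The optimistic action values before time step `t`. -/
noncomputable def qTable (t : ℕ) (z : 𝒮 × 𝒜) : ℝ := (memory M q sel x t).Q z.1 z.2

/-- The optimistic state values before time step `t`. -/
noncomputable def vTable (t : ℕ) (s : 𝒮) : ℝ := (memory M q sel x t).V s

/-- The value `V(s')` that is added to the accumulators at the visit to `z` preceded by `k` visits. -/
noncomputable def target (z : 𝒮 × 𝒜) (k : ℕ) : ℝ :=
  vTable M q sel x (visitTime (pairAt M q sel x) z k) (x (visitTime (pairAt M q sel x) z k + 1))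

/-- The new estimate of the action value at `z` formed at the end of the `j`-th stage (`1 ≤ j`),
for stages of lengths `e`. -/
noncomputable def stageEstimate (e : ℕ → ℕ) (z : 𝒮 × 𝒜) (j : ℕ) : ℝ :=
  M.r z.1 z.2 + q.γ * ((∑ k ∈ Finset.Ico (stageEnd e (j - 1)) (stageEnd e j), target M q sel x z k) /
    (e j : ℝ)) + q.bonus (e j)

variable {M q sel x}

theorem memory_succ (t : ℕ) : memory M q sel x (t + 1) =
    (memory M q sel x t).step q (x t) (policy M q sel x t (x t))
      (M.r (x t) (policy M q sel x t (x t))) (x (t + 1)) := rfl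

theorem tables_eq (t : ℕ) (z : 𝒮 × 𝒜) :
    (memory M q sel x t).N z.1 z.2 = visits (pairAt M q sel x) z t ∧
    (memory M q sel x t).NChk z.1 z.2 = stageCounter q.LChk (visits (pairAt M q sel x) z t) ∧
    (memory M q sel x t).NBar z.1 z.2 = stageCounter q.LBar (visits (pairAt M q sel x) z t) ∧
    (memory M q sel x t).μChk z.1 z.2 =
      stageTotal q.LChk (target M q sel x z) (visits (pairAt M q sel x) z t) ∧
    (memory M q sel x t).μBar z.1 z.2 =
      stageTotal q.LBar (target M q sel x z) (visits (pairAt M q sel x) z t) := by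
  induction t with
  | zero => simp [memory, Memory.init, stageCounter, stageTotal]
  | succ t ih =>
    obtain ⟨h1, h2, h3, h4, h5⟩ := ih
    by_cases h : pairAt M q sel x t = z
    · have hv : target M q sel x z (visits (pairAt M q sel x) z t) =
          (memory M q sel x t).V (x (t + 1)) := by
        rw [target, visitTime_visits h, vTable]
      rw [visits_succ_of_eq h, memory_succ]
      simp only [stageCounter, stageTotal, hv]
      rw [← h1] at h2 h3 h4 h5 ⊢
      rw [← h2, ← h3, ← h4, ← h5]
      subst h
      simp only [Memory.step, pairAt, and_self, if_true]
      refine ⟨trivial, ?_, ?_, ?_, ?_⟩ <;> congr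
    · rw [visits_succ_of_ne h, memory_succ]
      have h' : ¬ (z.1 = x t ∧ z.2 = policy M q sel x t (x t)) := fun hh =>
        h (Prod.ext hh.1.symm hh.2.symm)
      simp only [Memory.step, if_neg h']
      exact ⟨h1, h2, h3, h4, h5⟩

theorem qTable_succ_of_ne {t : ℕ} {z : 𝒮 × 𝒜} (h : pairAt M q sel x t ≠ z) :
    qTable M q sel x (t + 1) z = qTable M q sel x t z := by
  have h' : ¬ (z.1 = x t ∧ z.2 = policy M q sel x t (x t)) := fun hh =>
    h (Prod.ext hh.1.symm hh.2.symm)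
  simp only [qTable, memory_succ, Memory.step, if_neg h']

open Classical in
/-- The update of the action value at the visited pair, in terms of the stage estimates. -/
theorem qTable_succ_of_eq (e₁ : IsStageSeq q.eChk q.H q.B) (e₂ : IsStageSeq q.eBar q.H 1)
    {t : ℕ} {z : 𝒮 × 𝒜} (h : pairAt M q sel x t = z) :
    (∃ j, 1 ≤ j ∧ j ≤ q.JChk ∧ visits (pairAt M q sel x) z t + 1 = stageEnd q.eChk j ∧
      ∃ i, 1 ≤ i ∧ i ≤ q.JBar ∧ visits (pairAt M q sel x) z t + 1 = stageEnd q.eBar i ∧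
      qTable M q sel x (t + 1) z = min (stageEstimate M q sel x q.eBar z i)
        (min (stageEstimate M q sel x q.eChk z j) (qTable M q sel x t z))) ∨
    (∃ j, 1 ≤ j ∧ j ≤ q.JChk ∧ visits (pairAt M q sel x) z t + 1 = stageEnd q.eChk j ∧
      visits (pairAt M q sel x) z t + 1 ∉ q.LBar ∧
      qTable M q sel x (t + 1) z =
        min (stageEstimate M q sel x q.eChk z j) (qTable M q sel x t z)) ∨
    (visits (pairAt M q sel x) z t + 1 ∉ q.LChk ∧
      ∃ i, 1 ≤ i ∧ i ≤ q.JBar ∧ visits (pairAt M q sel x) z t + 1 = stageEnd q.eBar i ∧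
      qTable M q sel x (t + 1) z =
        min (stageEstimate M q sel x q.eBar z i) (qTable M q sel x t z)) ∨
    (visits (pairAt M q sel x) z t + 1 ∉ q.LChk ∧ visits (pairAt M q sel x) z t + 1 ∉ q.LBar ∧
      qTable M q sel x (t + 1) z = qTable M q sel x t z) := by
  obtain ⟨h1, h2, h3, h4, h5⟩ := tables_eq (M := M) (q := q) (sel := sel) (x := x) t z
  set n := visits (pairAt M q sel x) z t with hn
  have hv : target M q sel x z n = (memory M q sel x t).V (x (t + 1)) := by
    rw [target, hn, visitTime_visits h, vTable]
  -- at a stage end, the accumulators contain exactly the samples of the stage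
  have key : ∀ {e : ℕ → ℕ} {B : ℝ} {J j : ℕ}, IsStageSeq e q.H B → 1 ≤ j → j ≤ J →
      n + 1 = stageEnd e j →
      M.r z.1 z.2 + q.γ * ((stageTotal (stageEnds e J) (target M q sel x z) n +
        (memory M q sel x t).V (x (t + 1))) / ((stageCounter (stageEnds e J) n + 1 : ℕ) : ℝ)) +
        q.bonus (stageCounter (stageEnds e J) n + 1) = stageEstimate M q sel x e z j := by
    intro e B J j he hj hJ hnj
    obtain ⟨i, rfl⟩ := Nat.exists_eq_add_of_le' hj
    have hlt : stageEnd e i < stageEnd e (i + 1) := he.stageEnd_strictMono (by omega)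
    obtain ⟨c1, c2⟩ := he.stageCounter_eq (J := J) (j := i) (n := n) (by omega) (by omega) (by omega)
      (target M q sel x z)
    have hse := stageEnd_succ e i
    have c3 : stageCounter (stageEnds e J) n + 1 = e (i + 1) := by omega
    rw [c3, c2, ← hv, stageEstimate, ← hnj, Nat.add_sub_cancel,
      Finset.sum_Ico_succ_top (by omega : stageEnd e i ≤ n)]
  have hval : qTable M q sel x (t + 1) z =
      (if n + 1 ∈ q.LBar then min (M.r z.1 z.2 + q.γ * ((stageTotal q.LBar (target M q sel x z) n +
        (memory M q sel x t).V (x (t + 1))) / ((stageCounter q.LBar n + 1 : ℕ) : ℝ)) +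
        q.bonus (stageCounter q.LBar n + 1))
        (if n + 1 ∈ q.LChk then min (M.r z.1 z.2 + q.γ * ((stageTotal q.LChk (target M q sel x z) n +
        (memory M q sel x t).V (x (t + 1))) / ((stageCounter q.LChk n + 1 : ℕ) : ℝ)) +
        q.bonus (stageCounter q.LChk n + 1)) (qTable M q sel x t z) else qTable M q sel x t z)
      else (if n + 1 ∈ q.LChk then
        min (M.r z.1 z.2 + q.γ * ((stageTotal q.LChk (target M q sel x z) n +
        (memory M q sel x t).V (x (t + 1))) / ((stageCounter q.LChk n + 1 : ℕ) : ℝ)) +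
        q.bonus (stageCounter q.LChk n + 1)) (qTable M q sel x t z) else qTable M q sel x t z)) := by
    rw [← h2, ← h3, ← h4, ← h5, ← h1]
    subst h
    simp [qTable, memory_succ, Memory.step, pairAt]
  by_cases hC : n + 1 ∈ q.LChk <;> by_cases hB : n + 1 ∈ q.LBar
  · obtain ⟨j, j1, j2, j3⟩ := hC
    obtain ⟨i, i1, i2, i3⟩ := hB
    refine Or.inl ⟨j, j1, j2, j3, i, i1, i2, i3, ?_⟩
    rw [hval, if_pos ⟨i, i1, i2, i3⟩, if_pos ⟨j, j1, j2, j3⟩, ← key e₁ j1 j2 j3, ← key e₂ i1 i2 i3]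
    rfl
  · obtain ⟨j, j1, j2, j3⟩ := hC
    refine Or.inr (Or.inl ⟨j, j1, j2, j3, hB, ?_⟩)
    rw [hval, if_neg hB, if_pos ⟨j, j1, j2, j3⟩, ← key e₁ j1 j2 j3]
    rfl
  · obtain ⟨i, i1, i2, i3⟩ := hB
    refine Or.inr (Or.inr (Or.inl ⟨hC, i, i1, i2, i3, ?_⟩))
    rw [hval, if_pos ⟨i, i1, i2, i3⟩, if_neg hC, ← key e₂ i1 i2 i3]
    rfl
  · refine Or.inr (Or.inr (Or.inr ⟨hC, hB, ?_⟩))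
    rw [hval, if_neg hB, if_neg hC]

end Path

/-! ### Admissible parameters -/

/-- The admissible values of the parameters. -/
structure Params.IsValid (q : Params) : Prop where
  S_pos : 1 ≤ q.S
  A_pos : 1 ≤ q.A
  γ_pos : 0 < q.γ
  γ_lt : q.γ < 1
  ε_pos : 0 < q.ε
  ε_le : q.ε ≤ 1 / (1 - q.γ)
  δ_pos : 0 < q.δ
  δ_lt : q.δ < 1
  c₁_pos : 0 < q.c₁

namespace Params.IsValid

variable {q : Params} (hq : q.IsValid)
include hq

theorem one_sub_pos : 0 < 1 - q.γ := sub_pos.2 hq.γ_lt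

theorem horizon_pos : 0 < 1 / (1 - q.γ) := one_div_pos.2 hq.one_sub_pos

theorem one_le_horizon : 1 ≤ 1 / (1 - q.γ) := by
  rw [le_div_iff₀ hq.one_sub_pos]; linarith [hq.γ_pos]

omit hq in
theorem horizon_le_H : 1 / (1 - q.γ) ≤ q.H := (le_max_right _ _).trans (Nat.le_ceil _)

theorem one_le_H_cast : (1 : ℝ) ≤ q.H := hq.one_le_horizon.trans horizon_le_H

theorem one_le_H : 1 ≤ q.H := by exact_mod_cast hq.one_le_H_cast

theorem one_le_B : 1 ≤ q.B := Real.one_le_sqrt.2 hq.one_le_H_cast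

theorem ε_le_H : q.ε ≤ q.H := hq.ε_le.trans horizon_le_H

theorem one_le_one_sub_mul_H : 1 ≤ (1 - q.γ) * q.H := by
  have := horizon_le_H (q := q)
  rwa [div_le_iff₀' hq.one_sub_pos] at this

theorem half_lt_ι : 1 / 2 < q.ι := by
  have h1 : Real.log 2 ≤ q.ι := Real.log_le_log (by norm_num) (by
    rw [le_div_iff₀ hq.δ_pos]; nlinarith [hq.δ_lt])
  have := Real.log_two_gt_d9
  linarith

theorem eight_le : 8 ≤ 8 / ((1 - q.γ) * q.ε) := by
  have h := hq.ε_le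
  rw [le_div_iff₀ hq.one_sub_pos] at h
  have : 0 < (1 - q.γ) * q.ε := mul_pos hq.one_sub_pos hq.ε_pos
  rw [le_div_iff₀ this]
  linarith

theorem two_le_log : 2 ≤ Real.log (8 / ((1 - q.γ) * q.ε)) := by
  have h1 : Real.log 8 ≤ Real.log (8 / ((1 - q.γ) * q.ε)) := Real.log_le_log (by norm_num) hq.eight_le
  have h2 : Real.log 8 = 3 * Real.log 2 := by
    rw [show (8 : ℝ) = 2 ^ 3 by norm_num, Real.log_pow]; norm_num
  have := Real.log_two_gt_d9
  linarith

/-- One Bellman backup contracts by more than the factor `1 + 1 / H` by which stages grow. -/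
theorem γ_mul_growth_le : q.γ * (1 + 1 / q.H) ≤ 1 - (1 - q.γ) / 2 := by
  have h1 : 0 < Real.log (1 / q.γ) := Real.log_pos (by
    rw [lt_div_iff₀ hq.γ_pos]; linarith [hq.γ_lt])
  have h2 : Real.log (1 / q.γ) ≤ 1 / q.γ - 1 := Real.log_le_sub_one_of_pos (one_div_pos.2 hq.γ_pos)
  have h3 : Real.log (8 / ((1 - q.γ) * q.ε)) / Real.log (1 / q.γ) ≤ q.H :=
    (le_max_left _ _).trans (Nat.le_ceil _)
  rw [div_le_iff₀ h1] at h3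
  have hH := hq.one_le_H_cast
  have h4 : 2 ≤ (q.H : ℝ) * (1 / q.γ - 1) :=
    hq.two_le_log.trans (h3.trans (mul_le_mul_of_nonneg_left h2 (by linarith)))
  have h5 : 2 * q.γ ≤ q.H * (1 - q.γ) := by
    have h6 := mul_le_mul_of_nonneg_right h4 hq.γ_pos.le
    have h7 : (q.H : ℝ) * (1 / q.γ - 1) * q.γ = q.H * (1 - q.γ) := by
      have := hq.γ_pos.ne'
      field_simp
    linarith
  have h6 : q.γ * (1 / q.H) ≤ (1 - q.γ) / 2 := by
    rw [mul_one_div, div_le_iff₀ (by linarith)]; linarith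
  linarith

theorem eChk_isStageSeq : IsStageSeq q.eChk q.H q.B := isStageSeq_stretchedLen hq.one_le_H hq.one_le_B

theorem eBar_isStageSeq : IsStageSeq q.eBar q.H 1 := by
  rw [q.eBar_eq]; exact isStageSeq_stretchedLen hq.one_le_H le_rfl

theorem bonus_nonneg (n : ℕ) : 0 ≤ q.bonus n :=
  le_min (by positivity) hq.horizon_pos.le

theorem N₀_nonneg : 0 ≤ q.N₀ := by
  have h1 := hq.half_lt_ι
  have h2 := hq.c₁_pos
  have h3 := hq.ε_pos
  unfold Params.N₀
  positivity

end Params.IsValid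

/-! ### Monotonicity and optimism of the action values -/

section Path

variable {𝒮 𝒜 : Type*} [Fintype 𝒮] [Finite 𝒜] [Nonempty 𝒜] {M : MDP 𝒮 𝒜} {q : Params}
  {sel : 𝒮 → (𝒜 → ℝ) → 𝒜} {x : ℕ → 𝒮}

omit [Finite 𝒜] [Nonempty 𝒜] in

omit [Finite 𝒜] [Nonempty 𝒜] in
theorem qTable_antitone (hq : q.IsValid) (z : 𝒮 × 𝒜) : Antitone fun t => qTable M q sel x t z := by
  refine antitone_nat_of_succ_le fun t => ?_
  by_cases h : pairAt M q sel x t = z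
  · rcases qTable_succ_of_eq hq.eChk_isStageSeq hq.eBar_isStageSeq h with
      ⟨j, -, -, -, i, -, -, -, h⟩ | ⟨j, -, -, -, -, h⟩ | ⟨-, i, -, -, -, h⟩ | ⟨-, -, h⟩ <;> rw [h]
    · exact (min_le_right _ _).trans (min_le_right _ _)
    · exact min_le_right _ _
    · exact min_le_right _ _
  · rw [qTable_succ_of_ne h]

omit [Finite 𝒜] [Nonempty 𝒜] in
theorem qTable_le (hq : q.IsValid) (t : ℕ) (z : 𝒮 × 𝒜) : qTable M q sel x t z ≤ 1 / (1 - q.γ) :=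
  qTable_antitone hq z (Nat.zero_le t)

omit [Nonempty 𝒜] in
theorem qTable_le_vTable (t : ℕ) (s : 𝒮) (a : 𝒜) :
    qTable M q sel x t (s, a) ≤ vTable M q sel x t s :=
  le_ciSup (f := fun a => (memory M q sel x t).Q s a) (Set.finite_range _).bddAbove a

theorem vTable_antitone (hq : q.IsValid) (s : 𝒮) : Antitone fun t => vTable M q sel x t s :=
  fun t _ htu => ciSup_le fun a =>
    (qTable_antitone hq (s, a) htu).trans (qTable_le_vTable t s a)

omit [Finite 𝒜] in
theorem vTable_le (hq : q.IsValid) (t : ℕ) (s : 𝒮) : vTable M q sel x t s ≤ 1 / (1 - q.γ) :=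
  ciSup_le fun a => qTable_le hq t (s, a)

theorem vTable_eq (hsel : ∀ (s : 𝒮) (f : 𝒜 → ℝ) (a : 𝒜), f a ≤ f (sel s f)) (t : ℕ) (s : 𝒮) :
    vTable M q sel x t s = qTable M q sel x t (s, policy M q sel x t s) :=
  le_antisymm (ciSup_le fun a => hsel s ((memory M q sel x t).Q s) a) (qTable_le_vTable t s _)

theorem vTable_path_eq (hsel : ∀ (s : 𝒮) (f : 𝒜 → ℝ) (a : 𝒜), f a ≤ f (sel s f)) (t : ℕ) :
    vTable M q sel x t (x t) = qTable M q sel x t (pairAt M q sel x t) :=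
  vTable_eq hsel t (x t)

omit [Finite 𝒜] [Nonempty 𝒜] in
/-- A lower bound on action values that survives every update holds at all times. -/
theorem le_qTable (hq : q.IsValid) {R : 𝒮 × 𝒜 → ℝ} (h0 : ∀ z, R z ≤ 1 / (1 - q.γ))
    (hC : ∀ z T j, (∀ u < T, ∀ z', R z' ≤ qTable M q sel x u z') → 1 ≤ j → j ≤ q.JChk →
      stageEnd q.eChk j ≤ visits (pairAt M q sel x) z T → R z ≤ stageEstimate M q sel x q.eChk z j)
    (hB : ∀ z T j, (∀ u < T, ∀ z', R z' ≤ qTable M q sel x u z') → 1 ≤ j → j ≤ q.JBar →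
      stageEnd q.eBar j ≤ visits (pairAt M q sel x) z T → R z ≤ stageEstimate M q sel x q.eBar z j)
    (t : ℕ) : ∀ z, R z ≤ qTable M q sel x t z := by
  induction t using Nat.strong_induction_on with
  | _ t ih =>
    rcases t with _ | t
    · exact h0
    intro z
    have hold := ih t (by omega) z
    by_cases h : pairAt M q sel x t = z
    · have hv := visits_succ_of_eq h
      rcases qTable_succ_of_eq hq.eChk_isStageSeq hq.eBar_isStageSeq h with
        ⟨j, j1, j2, j3, i, i1, i2, i3, h⟩ | ⟨j, j1, j2, j3, -, h⟩ | ⟨-, i, i1, i2, i3, h⟩ | ⟨-, -, h⟩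
        <;> rw [h]
      · exact le_min (hB z (t + 1) i ih i1 i2 (by omega))
          (le_min (hC z (t + 1) j ih j1 j2 (by omega)) hold)
      · exact le_min (hC z (t + 1) j ih j1 j2 (by omega)) hold
      · exact le_min (hB z (t + 1) i ih i1 i2 (by omega)) hold
      · exact hold
    · rw [qTable_succ_of_ne h]; exact hold

theorem stageEstimate_nonneg (hq : q.IsValid) {e : ℕ → ℕ} (z : 𝒮 × 𝒜) (T j : ℕ)
    (ih : ∀ u < T, ∀ z', 0 ≤ qTable M q sel x u z')
    (h : stageEnd e j ≤ visits (pairAt M q sel x) z T) : 0 ≤ stageEstimate M q sel x e z j := by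
  have h1 : 0 ≤ ∑ k ∈ Finset.Ico (stageEnd e (j - 1)) (stageEnd e j), target M q sel x z k := by
    refine Finset.sum_nonneg fun k hk => ?_
    have hk' := (visitTime_spec ((Finset.mem_Ico.1 hk).2.trans_le h)).2.1
    obtain ⟨a⟩ := ‹Nonempty 𝒜›
    exact (ih _ hk' (_, a)).trans (qTable_le_vTable _ _ a)
  have h2 := M.r_nonneg z.1 z.2
  have h3 := hq.bonus_nonneg (e j)
  have h4 := hq.γ_pos
  unfold stageEstimate
  positivity

theorem qTable_nonneg (hq : q.IsValid) (t : ℕ) (z : 𝒮 × 𝒜) : 0 ≤ qTable M q sel x t z :=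
  le_qTable (R := fun _ => 0) hq (fun _ => hq.horizon_pos.le)
    (fun z T j ih _ _ h => stageEstimate_nonneg hq z T j ih h)
    (fun z T j ih _ _ h => stageEstimate_nonneg hq z T j ih h) t z

theorem vTable_nonneg (hq : q.IsValid) (t : ℕ) (s : 𝒮) : 0 ≤ vTable M q sel x t s := by
  obtain ⟨a⟩ := ‹Nonempty 𝒜›
  exact (qTable_nonneg hq t (s, a)).trans (qTable_le_vTable t s a)

omit [Finite 𝒜] [Nonempty 𝒜] in
theorem qTable_le_stageEstimate_chk (hq : q.IsValid) {z : 𝒮 × 𝒜} {t j : ℕ} (j1 : 1 ≤ j)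
    (j2 : j ≤ q.JChk) (h : stageEnd q.eChk j ≤ visits (pairAt M q sel x) z t) :
    qTable M q sel x t z ≤ stageEstimate M q sel x q.eChk z j := by
  induction t with
  | zero =>
    have := hq.eChk_isStageSeq.le_stageEnd j
    rw [visits_zero] at h
    omega
  | succ t ih =>
    by_cases hh : stageEnd q.eChk j ≤ visits (pairAt M q sel x) z t
    · exact (qTable_antitone hq z (Nat.le_succ t)).trans (ih hh)
    · by_cases hz : pairAt M q sel x t = z
      · rw [visits_succ_of_eq hz] at h
        have hj : visits (pairAt M q sel x) z t + 1 = stageEnd q.eChk j := by omega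
        rcases qTable_succ_of_eq hq.eChk_isStageSeq hq.eBar_isStageSeq hz with
          ⟨j', -, -, j3, i, -, -, -, hQ⟩ | ⟨j', -, -, j3, -, hQ⟩ | ⟨hn, -⟩ | ⟨hn, -⟩
        · obtain rfl := hq.eChk_isStageSeq.stageEnd_strictMono.injective (j3.symm.trans hj)
          rw [hQ]; exact (min_le_right _ _).trans (min_le_left _ _)
        · obtain rfl := hq.eChk_isStageSeq.stageEnd_strictMono.injective (j3.symm.trans hj)
          rw [hQ]; exact min_le_left _ _
        · exact absurd ⟨j, j1, j2, hj⟩ hn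
        · exact absurd ⟨j, j1, j2, hj⟩ hn
      · rw [visits_succ_of_ne hz] at h
        exact absurd h hh

omit [Finite 𝒜] [Nonempty 𝒜] in
theorem qTable_le_stageEstimate_bar (hq : q.IsValid) {z : 𝒮 × 𝒜} {t j : ℕ} (j1 : 1 ≤ j)
    (j2 : j ≤ q.JBar) (h : stageEnd q.eBar j ≤ visits (pairAt M q sel x) z t) :
    qTable M q sel x t z ≤ stageEstimate M q sel x q.eBar z j := by
  induction t with
  | zero =>
    have := hq.eBar_isStageSeq.le_stageEnd j
    rw [visits_zero] at h
    omega
  | succ t ih =>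
    by_cases hh : stageEnd q.eBar j ≤ visits (pairAt M q sel x) z t
    · exact (qTable_antitone hq z (Nat.le_succ t)).trans (ih hh)
    · by_cases hz : pairAt M q sel x t = z
      · rw [visits_succ_of_eq hz] at h
        have hj : visits (pairAt M q sel x) z t + 1 = stageEnd q.eBar j := by omega
        rcases qTable_succ_of_eq hq.eChk_isStageSeq hq.eBar_isStageSeq hz with
          ⟨j', -, -, -, i, -, -, i3, hQ⟩ | ⟨-, -, -, -, hn, -⟩ | ⟨-, i, -, -, i3, hQ⟩ | ⟨-, hn, -⟩
        · obtain rfl := hq.eBar_isStageSeq.stageEnd_strictMono.injective (i3.symm.trans hj)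
          rw [hQ]; exact min_le_left _ _
        · exact absurd ⟨j, j1, j2, hj⟩ hn
        · obtain rfl := hq.eBar_isStageSeq.stageEnd_strictMono.injective (i3.symm.trans hj)
          rw [hQ]; exact min_le_left _ _
        · exact absurd ⟨j, j1, j2, hj⟩ hn
      · rw [visits_succ_of_ne hz] at h
        exact absurd h hh

omit [Finite 𝒜] [Nonempty 𝒜] in
theorem memory_Q_eq_of_qTable_eq {t u : ℕ} (h : ∀ z, qTable M q sel x t z = qTable M q sel x u z) :
    (memory M q sel x t).Q = (memory M q sel x u).Q := by
  funext s a; exact h (s, a)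

/-! ### The number of updates -/

omit [Finite 𝒜] [Nonempty 𝒜] in
open Classical in
theorem stageEnds_card_le (e : ℕ → ℕ) (J n : ℕ) :
    ((Finset.range n).filter fun k => k + 1 ∈ stageEnds e J).card ≤ J := by
  have h : ((Finset.range n).filter fun k => k + 1 ∈ stageEnds e J).image (fun k => k + 1) ⊆
      (Finset.Icc 1 J).image (stageEnd e) := by
    intro m hm
    obtain ⟨k, hk, rfl⟩ := Finset.mem_image.1 hm
    obtain ⟨j, j1, j2, j3⟩ := (Finset.mem_filter.1 hk).2
    exact Finset.mem_image.2 ⟨j, Finset.mem_Icc.2 ⟨j1, j2⟩, j3.symm⟩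
  calc _ = (((Finset.range n).filter fun k => k + 1 ∈ stageEnds e J).image (fun k => k + 1)).card :=
        (Finset.card_image_of_injective _ (add_left_injective 1)).symm
    _ ≤ _ := Finset.card_le_card h
    _ ≤ _ := Finset.card_image_le
    _ = J := by simp

omit [Finite 𝒜] [Nonempty 𝒜] in
open Classical in
theorem card_updates_le [Fintype 𝒜] (hq : q.IsValid) (n : ℕ) :
    (((Finset.range n).filter fun t =>
      (memory M q sel x (t + 1)).Q ≠ (memory M q sel x t).Q).card : ℝ) ≤
      Fintype.card 𝒮 * Fintype.card 𝒜 * (q.JChk + q.JBar) := by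
  have h1 : (((Finset.range n).filter fun t =>
      (memory M q sel x (t + 1)).Q ≠ (memory M q sel x t).Q).card : ℝ) ≤
      ∑ t ∈ Finset.range n,
        (fun (_ : 𝒮 × 𝒜) (k : ℕ) (_ : ℕ) => ((if k + 1 ∈ q.LChk then 1 else 0) +
          (if k + 1 ∈ q.LBar then 1 else 0) : ℝ)) (pairAt M q sel x t)
          (visits (pairAt M q sel x) (pairAt M q sel x t) t) t := by
    rw [Finset.card_filter, Nat.cast_sum]
    refine Finset.sum_le_sum fun t _ => ?_
    by_cases hC : visits (pairAt M q sel x) (pairAt M q sel x t) t + 1 ∈ q.LChk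
    · simp only [hC, if_true]
      split_ifs <;> norm_num
    by_cases hB : visits (pairAt M q sel x) (pairAt M q sel x t) t + 1 ∈ q.LBar
    · simp only [hB, if_true]
      split_ifs <;> norm_num
    rw [if_neg]
    · simp [hC, hB]
    · rw [not_ne_iff]
      refine memory_Q_eq_of_qTable_eq fun z => ?_
      by_cases hz : pairAt M q sel x t = z
      · subst hz
        rcases qTable_succ_of_eq hq.eChk_isStageSeq hq.eBar_isStageSeq (rfl : pairAt M q sel x t = _)
          with ⟨j, j1, j2, j3, -⟩ | ⟨j, j1, j2, j3, -⟩ | ⟨-, i, i1, i2, i3, -⟩ | ⟨-, -, h⟩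
        · exact absurd ⟨j, j1, j2, j3⟩ hC
        · exact absurd ⟨j, j1, j2, j3⟩ hC
        · exact absurd ⟨i, i1, i2, i3⟩ hB
        · exact h
      · exact qTable_succ_of_ne hz
  refine (h1.trans_eq (sum_time_eq_sum_visits (ζ := pairAt M q sel x)
    (fun _ k _ => (if k + 1 ∈ q.LChk then 1 else 0) + (if k + 1 ∈ q.LBar then 1 else 0)) n)).trans ?_
  calc _ ≤ ∑ z : 𝒮 × 𝒜, ((q.JChk : ℝ) + q.JBar) := by
        refine Finset.sum_le_sum fun z _ => ?_
        rw [Finset.sum_add_distrib, Finset.sum_boole, Finset.sum_boole]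
        gcongr
        · exact stageEnds_card_le _ _ _
        · exact stageEnds_card_le _ _ _
    _ = _ := by
        rw [Finset.sum_const, Finset.card_univ, Fintype.card_prod, nsmul_eq_mul]
        push_cast; ring

end Path

/-! ### Sums over stages -/

/-- The positive part confines the sum of `A / √k` to the terms with `k ≤ (A / b) ^ 2`. -/
theorem sum_max_div_sqrt_sub_le {A b : ℝ} (hA : 0 ≤ A) (hb : 0 < b) (K : ℕ) :
    ∑ k ∈ Finset.range K, max (A / √(k + 1) - b) 0 ≤ 2 * A ^ 2 / b := by
  have key : ∑ k ∈ Finset.range K, max (A / √(k + 1) - b) 0 ≤ 2 * A * min (√K) (A / b) := by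
    induction K with
    | zero => simp; positivity
    | succ K ih =>
      rw [Finset.sum_range_succ]
      push_cast
      have hs : √(K : ℝ) ≤ √(K + 1) := Real.sqrt_le_sqrt (by linarith)
      have hp : 0 < √((K : ℝ) + 1) := Real.sqrt_pos.2 (by positivity)
      rcases le_or_gt (√((K : ℝ) + 1)) (A / b) with h | h
      · rw [min_eq_left h]
        rw [min_eq_left (hs.trans h)] at ih
        have h1 : max (A / √(K + 1) - b) 0 ≤ A / √(K + 1) :=
          max_le (by linarith) (by positivity)
        have h2 : A / √((K : ℝ) + 1) ≤ 2 * A * (√(K + 1) - √K) := by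
          rw [div_le_iff₀ hp]
          have h3 : √((K : ℝ) + 1) * √(K + 1) = K + 1 := Real.mul_self_sqrt (by positivity)
          have h4 : √(K : ℝ) * √K = K := Real.mul_self_sqrt (by positivity)
          have h5 : 1 ≤ 2 * (√((K : ℝ) + 1) - √K) * √(K + 1) := by nlinarith [sq_nonneg (√((K : ℝ) + 1) - √K)]
          nlinarith
        linarith
      · rw [max_eq_right, add_zero]
        · refine ih.trans ?_
          gcongr
        · rw [sub_nonpos, div_le_iff₀ hp]
          rw [div_lt_iff₀ hb] at h
          linarith
  refine key.trans ?_
  calc _ ≤ 2 * A * (A / b) := by gcongr; exact min_le_right _ _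
    _ = _ := by ring

theorem sum_index_mul_sub (ρ : ℕ → ℝ) (n : ℕ) :
    ∑ i ∈ Finset.range n, (i : ℝ) * (ρ i - ρ (i + 1)) + n * ρ n =
      ∑ i ∈ Finset.range n, ρ (i + 1) := by
  induction n with
  | zero => simp
  | succ n ih =>
    rw [Finset.sum_range_succ, Finset.sum_range_succ, ← ih]
    push_cast; ring

/-- Number of stages that are complete after `k` visits. -/
def stagesDone (e : ℕ → ℕ) (k : ℕ) : ℕ := Nat.findGreatest (fun j => stageEnd e j ≤ k) k

/-- Average of `F` over the last stage that is complete after `k` visits. -/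
noncomputable def stageAvg (e : ℕ → ℕ) (F : ℕ → ℝ) (k : ℕ) : ℝ :=
  (∑ i ∈ Finset.Ico (stageEnd e (stagesDone e k - 1)) (stageEnd e (stagesDone e k)), F i) /
    (e (stagesDone e k) : ℝ)

namespace IsStageSeq

variable {e : ℕ → ℕ} {H : ℕ} {B : ℝ} (he : IsStageSeq e H B)
include he

omit he in
theorem stageEnd_stagesDone_le (k : ℕ) : stageEnd e (stagesDone e k) ≤ k :=
  Nat.findGreatest_spec (P := fun j => stageEnd e j ≤ k) (Nat.zero_le k) (by simp)

theorem lt_stageEnd_stagesDone (k : ℕ) : k < stageEnd e (stagesDone e k + 1) := by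
  by_contra h
  have h1 := not_lt.1 h
  have h2 := he.le_stageEnd (stagesDone e k + 1)
  have := Nat.le_findGreatest (P := fun j => stageEnd e j ≤ k) (h2.trans h1) h1
  have h3 : stagesDone e k + 1 ≤ stagesDone e k := this
  omega

theorem stagesDone_eq_iff {k j : ℕ} :
    stagesDone e k = j ↔ stageEnd e j ≤ k ∧ k < stageEnd e (j + 1) := by
  constructor
  · rintro rfl
    exact ⟨stageEnd_stagesDone_le k, he.lt_stageEnd_stagesDone k⟩
  · rintro ⟨h1, h2⟩
    have h3 := he.stageEnd_strictMono.lt_iff_lt.1 ((stageEnd_stagesDone_le k).trans_lt h2)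
    have h4 := he.stageEnd_strictMono.lt_iff_lt.1 (h1.trans_lt (he.lt_stageEnd_stagesDone k))
    omega

theorem stageEnd_one : stageEnd e 1 = H := by
  rw [show (1 : ℕ) = 0 + 1 from rfl, stageEnd_succ, stageEnd_zero, zero_add, zero_add, he.first]

theorem stagesDone_eq_zero_iff {k : ℕ} : stagesDone e k = 0 ↔ k < H := by
  rw [he.stagesDone_eq_iff, stageEnd_zero, zero_add, he.stageEnd_one]
  simp

omit he in
theorem stageEnd_sub {j : ℕ} (hj : 1 ≤ j) : stageEnd e j - stageEnd e (j - 1) = e j := by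
  obtain ⟨i, rfl⟩ := Nat.exists_eq_add_of_le' hj
  rw [stageEnd_succ, Nat.add_sub_cancel, Nat.add_sub_cancel_left]

omit he in
theorem stageAvg_mono {F G : ℕ → ℝ} {k : ℕ} (h : ∀ i < k, F i ≤ G i) :
    stageAvg e F k ≤ stageAvg e G k := by
  refine div_le_div_of_nonneg_right (Finset.sum_le_sum fun i hi => h i ?_) (Nat.cast_nonneg _)
  exact (Finset.mem_Ico.1 hi).2.trans_le (stageEnd_stagesDone_le k)

omit he in
theorem stageAvg_add (F G : ℕ → ℝ) (k : ℕ) :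
    stageAvg e (fun i => F i + G i) k = stageAvg e F k + stageAvg e G k := by
  simp [stageAvg, Finset.sum_add_distrib, add_div]

theorem stageAvg_const (c : ℝ) {k : ℕ} (hk : H ≤ k) : stageAvg e (fun _ => c) k = c := by
  have h1 : 1 ≤ stagesDone e k := by
    by_contra h
    have := he.stagesDone_eq_zero_iff.1 (show stagesDone e k = 0 by omega)
    omega
  have h2 : (e (stagesDone e k) : ℝ) ≠ 0 := by
    have := he.pos h1
    positivity
  rw [stageAvg, Finset.sum_const, Nat.card_Ico, stageEnd_sub h1, nsmul_eq_mul,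
    mul_div_cancel_left₀ _ h2]

/-- As stages grow at most by the factor `1 + 1 / H`, so does the total weight that the averages
over the preceding stages give to a sample. -/
theorem sum_stageAvg_le {F : ℕ → ℝ} (hF : ∀ i, 0 ≤ F i) (K : ℕ) :
    ∑ k ∈ Finset.Ico H K, stageAvg e F k ≤ (1 + 1 / H) * ∑ i ∈ Finset.range K, F i := by
  have h1 : ∀ k ∈ Finset.Ico H K, stageAvg e F k =
      ∑ i ∈ Finset.range K, if stagesDone e i + 1 = stagesDone e k then
        F i / e (stagesDone e i + 1) else 0 := by
    intro k hk
    obtain ⟨hk1, hk2⟩ := Finset.mem_Ico.1 hk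
    have hj : 1 ≤ stagesDone e k := by
      by_contra h
      have := he.stagesDone_eq_zero_iff.1 (show stagesDone e k = 0 by omega)
      omega
    rw [stageAvg, Finset.sum_div, ← Finset.sum_filter]
    refine Finset.sum_congr_of_eq_on_inter ?_ ?_ ?_
    · intro i hi hi'
      exfalso
      apply hi'
      obtain ⟨i1, i2⟩ := Finset.mem_Ico.1 hi
      rw [Finset.mem_filter, Finset.mem_range]
      refine ⟨by have := stageEnd_stagesDone_le (e := e) k; omega, ?_⟩
      have : stagesDone e i = stagesDone e k - 1 := by
        rw [he.stagesDone_eq_iff, Nat.sub_add_cancel hj]; exact ⟨i1, i2⟩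
      omega
    · intro i hi hi'
      exfalso
      apply hi'
      have h2 := (Finset.mem_filter.1 hi).2
      have h3 := stageEnd_stagesDone_le (e := e) i
      have h4 := he.lt_stageEnd_stagesDone i
      rw [h2] at h4
      rw [show stagesDone e i = stagesDone e k - 1 by omega] at h3
      exact Finset.mem_Ico.2 ⟨h3, h4⟩
    · intro i _ hi
      rw [(Finset.mem_filter.1 hi).2]
  rw [Finset.sum_congr rfl h1, Finset.sum_comm, Finset.mul_sum]
  refine Finset.sum_le_sum fun i _ => ?_
  rw [← Finset.sum_filter, Finset.sum_const, nsmul_eq_mul]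
  set j := stagesDone e i + 1 with hj
  have hcard : ((Finset.Ico H K).filter fun k => j = stagesDone e k).card ≤ e (j + 1) := by
    calc _ ≤ (Finset.Ico (stageEnd e j) (stageEnd e (j + 1))).card := by
          refine Finset.card_le_card fun k hk => ?_
          have := (he.stagesDone_eq_iff (k := k) (j := j)).1 (Finset.mem_filter.1 hk).2.symm
          exact Finset.mem_Ico.2 this
      _ = _ := by rw [Nat.card_Ico, stageEnd_succ, Nat.add_sub_cancel_left]
  have hpos : (0 : ℝ) < e j := by exact_mod_cast he.pos (by omega : 1 ≤ j)
  calc _ ≤ (e (j + 1) : ℝ) * (F i / e j) := by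
        gcongr
        exact div_nonneg (hF i) hpos.le
    _ ≤ ((1 + 1 / H) * e j) * (F i / e j) := by
        gcongr
        · exact div_nonneg (hF i) hpos.le
        · exact he.succ_le j (by omega)
    _ = _ := by field_simp

/-- The total decrease of `ρ` between the visits of a stage and those of the next one. Stages are
shorter than the elapsed time by the factor `H * B`, up to a constant. -/
theorem sum_stageAvg_sub_le {ρ : ℕ → ℝ} (h0 : ∀ i, 0 ≤ ρ i) (hρ : Antitone ρ) (K : ℕ) :
    ∑ k ∈ Finset.Ico H K, (stageAvg e ρ k - ρ k) ≤
      6 / (H * B) * ∑ i ∈ Finset.range K, ρ i + 3 * H * ρ 0 := by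
  have hB := he.one_le_B
  have hH : (1 : ℝ) ≤ H := by exact_mod_cast he.one_le_H
  have hHB : 0 < (H : ℝ) * B := by positivity
  have hD : ∀ i, 0 ≤ ρ i - ρ (i + 1) := fun i => sub_nonneg.2 (hρ (Nat.le_succ i))
  -- each difference telescopes over the visits between the two stages
  have h1 : ∀ k ∈ Finset.Ico H K, stageAvg e ρ k - ρ k ≤
      ∑ i ∈ Finset.range K, if stageEnd e (stagesDone e k - 1) ≤ i ∧ i < k then
        ρ i - ρ (i + 1) else 0 := by
    intro k hk
    obtain ⟨hk1, hk2⟩ := Finset.mem_Ico.1 hk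
    have hm : stageEnd e (stagesDone e k - 1) ≤ k :=
      (he.stageEnd_strictMono.monotone (Nat.sub_le _ _)).trans (stageEnd_stagesDone_le k)
    have h2 : stageAvg e ρ k ≤ ρ (stageEnd e (stagesDone e k - 1)) := by
      rw [← he.stageAvg_const (ρ (stageEnd e (stagesDone e k - 1))) hk1]
      refine div_le_div_of_nonneg_right (Finset.sum_le_sum fun i hi => ?_) (Nat.cast_nonneg _)
      exact hρ (Finset.mem_Ico.1 hi).1
    have h3 : ∑ i ∈ Finset.Ico (stageEnd e (stagesDone e k - 1)) k, (ρ i - ρ (i + 1)) =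
        ρ (stageEnd e (stagesDone e k - 1)) - ρ k := by
      have := Finset.sum_Ico_sub (fun i => ρ i) hm
      have h4 : ∑ i ∈ Finset.Ico (stageEnd e (stagesDone e k - 1)) k, (ρ i - ρ (i + 1)) =
        -∑ i ∈ Finset.Ico (stageEnd e (stagesDone e k - 1)) k, (ρ (i + 1) - ρ i) := by
        rw [← Finset.sum_neg_distrib]; exact Finset.sum_congr rfl fun i _ => by ring
      rw [h4, this]; ring
    rw [← Finset.sum_filter]
    have h5 : ((Finset.range K).filter fun i => stageEnd e (stagesDone e k - 1) ≤ i ∧ i < k) =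
        Finset.Ico (stageEnd e (stagesDone e k - 1)) k := by
      ext i
      simp only [Finset.mem_filter, Finset.mem_range, Finset.mem_Ico]
      omega
    rw [h5, h3]
    linarith
  refine (Finset.sum_le_sum h1).trans ?_
  rw [Finset.sum_comm]
  -- the visits `k` whose preceding stage begins no later than `i < k` lie in two stages
  have h6 : ∀ i ∈ Finset.range K, ∑ k ∈ Finset.Ico H K,
      (if stageEnd e (stagesDone e k - 1) ≤ i ∧ i < k then ρ i - ρ (i + 1) else 0) ≤
      6 / (H * B) * (i * (ρ i - ρ (i + 1))) + 3 * H * (ρ i - ρ (i + 1)) := by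
    intro i _
    rw [← Finset.sum_filter, Finset.sum_const, nsmul_eq_mul]
    set j := stagesDone e i with hj
    have hi1 : stageEnd e j ≤ i := stageEnd_stagesDone_le i
    have hi2 : i < stageEnd e (j + 1) := he.lt_stageEnd_stagesDone i
    have hcard : ((Finset.Ico H K).filter fun k => stageEnd e (stagesDone e k - 1) ≤ i ∧ i < k).card ≤
        e (j + 1) + e (j + 2) := by
      calc _ ≤ (Finset.Ico (stageEnd e j) (stageEnd e (j + 2))).card := by
            refine Finset.card_le_card fun k hk => ?_
            obtain ⟨k1, k2⟩ := (Finset.mem_filter.1 hk).2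
            refine Finset.mem_Ico.2 ⟨by omega, ?_⟩
            have h7 : stagesDone e k - 1 < j + 1 :=
              he.stageEnd_strictMono.lt_iff_lt.1 (k1.trans_lt hi2)
            exact (he.lt_stageEnd_stagesDone k).trans_le
              (he.stageEnd_strictMono.monotone (by omega))
        _ = _ := by
            rw [Nat.card_Ico, stageEnd_succ, stageEnd_succ, add_assoc, Nat.add_sub_cancel_left]
    have hcard' : (((Finset.Ico H K).filter fun k =>
        stageEnd e (stagesDone e k - 1) ≤ i ∧ i < k).card : ℝ) ≤ 6 / (H * B) * i + 3 * H := by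
      have h8 : (((Finset.Ico H K).filter fun k =>
        stageEnd e (stagesDone e k - 1) ≤ i ∧ i < k).card : ℝ) ≤ e (j + 1) + e (j + 2) := by
          exact_mod_cast hcard
      have h9 : (e (j + 2) : ℝ) ≤ 2 * e (j + 1) := he.len_succ_le_two (by omega)
      have h10 := he.len_le j
      have h11 : 2 * (stageEnd e j : ℝ) / (H * B) ≤ 2 * i / (H * B) := by
        gcongr
      have h12 : 6 / (H * B) * i = 3 * (2 * (i : ℝ) / (H * B)) := by ring
      linarith
    calc _ ≤ (6 / (H * B) * i + 3 * H) * (ρ i - ρ (i + 1)) :=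
          mul_le_mul_of_nonneg_right hcard' (hD i)
      _ = _ := by ring
  refine (Finset.sum_le_sum h6).trans ?_
  rw [Finset.sum_add_distrib, ← Finset.mul_sum, ← Finset.mul_sum]
  have h13 := sum_index_mul_sub ρ K
  have h14 : ∑ i ∈ Finset.range K, ρ (i + 1) ≤ ∑ i ∈ Finset.range K, ρ i :=
    Finset.sum_le_sum fun i _ => hρ (Nat.le_succ i)
  have h15 : 0 ≤ (K : ℝ) * ρ K := mul_nonneg (Nat.cast_nonneg _) (h0 K)
  have h16 := Finset.sum_range_sub' ρ K
  have h17 := h0 K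
  refine add_le_add ?_ ?_
  · exact mul_le_mul_of_nonneg_left (by linarith) (by positivity)
  · exact mul_le_mul_of_nonneg_left (by linarith) (by positivity)

omit he in
/-- The total bonus, up to the threshold `b`. -/
theorem sum_bonus_le {q : Params} (he : IsStageSeq e q.H B) (hι : 0 ≤ q.ι) {b : ℝ} (hb : 0 < b)
    (K : ℕ) :
    ∑ k ∈ Finset.Ico q.H K, max (2 * q.bonus (e (stagesDone e k)) - b) 0 ≤
      576 * q.H ^ 3 * B * q.ι / b := by
  have hB := he.one_le_B
  have hH : (1 : ℝ) ≤ q.H := by exact_mod_cast he.one_le_H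
  set A : ℝ := 4 * √(18 * q.H ^ 3 * B * q.ι) with hA
  have h1 : ∀ k ∈ Finset.Ico q.H K, max (2 * q.bonus (e (stagesDone e k)) - b) 0 ≤
      max (A / √(k + 1) - b) 0 := by
    intro k hk
    refine max_le_max (sub_le_sub_right ?_ b) le_rfl
    have hj : 1 ≤ stagesDone e k := by
      by_contra h
      have h2 := he.stagesDone_eq_zero_iff.1 (show stagesDone e k = 0 by omega)
      have := (Finset.mem_Ico.1 hk).1
      omega
    have h2 : ((k : ℝ) + 1) ≤ 18 * q.H * B * e (stagesDone e k) := by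
      refine le_trans ?_ (he.end_le _ hj)
      exact_mod_cast he.lt_stageEnd_stagesDone k
    have hpos : (0 : ℝ) < e (stagesDone e k) := by exact_mod_cast he.pos hj
    have h3 : (q.H : ℝ) ^ 2 * q.ι / e (stagesDone e k) ≤ 18 * q.H ^ 3 * B * q.ι / (k + 1) := by
      rw [div_le_div_iff₀ hpos (by positivity)]
      calc (q.H : ℝ) ^ 2 * q.ι * (k + 1) ≤ q.H ^ 2 * q.ι * (18 * q.H * B * e (stagesDone e k)) := by
            gcongr
        _ = _ := by ring
    calc 2 * q.bonus (e (stagesDone e k)) ≤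
        2 * (2 * √((q.H : ℝ) ^ 2 * q.ι / e (stagesDone e k))) := by
          gcongr; exact min_le_left _ _
      _ ≤ 2 * (2 * √(18 * q.H ^ 3 * B * q.ι / (k + 1))) := by gcongr
      _ = A / √(k + 1) := by
          rw [Real.sqrt_div (by positivity), hA]; ring
  refine (Finset.sum_le_sum h1).trans ?_
  refine (Finset.sum_le_sum_of_subset_of_nonneg (t := Finset.range K) ?_ ?_).trans
    ((sum_max_div_sqrt_sub_le (by positivity) hb K).trans_eq ?_)
  · intro k hk; exact Finset.mem_range.2 (Finset.mem_Ico.1 hk).2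
  · intro k _ _; exact le_max_right _ _
  · rw [hA, mul_pow, Real.sq_sqrt (by positivity)]; ring

end IsStageSeq

/-! ### Typical paths -/

section Typical

variable {𝒮 𝒜 : Type*} [Fintype 𝒮]

/-- The action value `r + γ P W` obtained from `W` by one Bellman backup. -/
noncomputable def backup (M : MDP 𝒮 𝒜) (γ : ℝ) (W : 𝒮 → ℝ) (z : 𝒮 × 𝒜) : ℝ :=
  M.r z.1 z.2 + γ * M.next z.1 z.2 W

variable (M : MDP 𝒮 𝒜) (q : Params) (sel : 𝒮 → (𝒜 → ℝ) → 𝒜) (x : ℕ → 𝒮) (W : 𝒮 → ℝ)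

/-- The state reached from `z` after the visit to `z` that is preceded by `k` visits. -/
noncomputable def nextState (z : 𝒮 × 𝒜) (k : ℕ) : 𝒮 :=
  x (visitTime (pairAt M q sel x) z k + 1)

/-- The optimism gap `V_t - W` beyond the threshold `(1 - γ) ε / 4`. -/
noncomputable def excess (t : ℕ) (s : 𝒮) : ℝ :=
  max (vTable M q sel x t s - W s - (1 - q.γ) * q.ε / 4) 0

/-- The regret bound `V_t - V^{π_t}` beyond the threshold `ε / 2`. -/
noncomputable def gap (t : ℕ) (s : 𝒮) : ℝ :=
  max (vTable M q sel x t s - M.value q.γ (policy M q sel x t) s - q.ε / 2) 0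

/-- The paths along which all empirical means are close to the corresponding conditional
expectations: over each stage, for the fixed function `W` and for the running estimates `V_t`, and
over all times, for the nonnegative functions `excess` and `gap`. -/
structure IsTypical : Prop where
  dev_chk : ∀ z j T, 1 ≤ j → j ≤ q.JChk → stageEnd q.eChk j ≤ visits (pairAt M q sel x) z T →
    |∑ k ∈ Finset.Ico (stageEnd q.eChk (j - 1)) (stageEnd q.eChk j),
      (W (nextState M q sel x z k) - M.next z.1 z.2 W)| ≤ q.eChk j * q.bonus (q.eChk j)
  dev_bar : ∀ z j T, 1 ≤ j → j ≤ q.JBar → stageEnd q.eBar j ≤ visits (pairAt M q sel x) z T →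
    |∑ k ∈ Finset.Ico (stageEnd q.eBar (j - 1)) (stageEnd q.eBar j),
      (W (nextState M q sel x z k) - M.next z.1 z.2 W)| ≤ q.eBar j * q.bonus (q.eBar j)
  dev_target : ∀ z j T, 1 ≤ j → j ≤ q.JChk → stageEnd q.eChk j ≤ visits (pairAt M q sel x) z T →
    ∑ k ∈ Finset.Ico (stageEnd q.eChk (j - 1)) (stageEnd q.eChk j), (target M q sel x z k -
      M.next z.1 z.2 (vTable M q sel x (visitTime (pairAt M q sel x) z k))) ≤
        q.eChk j * q.bonus (q.eChk j)
  excess_sum : ∀ n, ∑ t ∈ Finset.range n,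
      M.next (x t) (policy M q sel x t (x t)) (excess M q sel x W t) ≤
    2 * ∑ t ∈ Finset.range n, excess M q sel x W t (x (t + 1)) + 2 * (1 / (1 - q.γ)) * q.ι
  gap_sum : ∀ n, ∑ t ∈ Finset.range n,
      M.next (x t) (policy M q sel x t (x t)) (gap M q sel x t) ≤
    (1 + (1 - q.γ) / 2) * ∑ t ∈ Finset.range n, gap M q sel x t (x (t + 1)) +
      4 * (1 / (1 - q.γ)) ^ 2 * q.ι

/-- Shifting the time index of an antitone family of functions along a path costs at most its
bound for each state. -/
theorem sum_shift_path_le (x : ℕ → 𝒮) {f : ℕ → 𝒮 → ℝ} {c : ℝ} (h0 : ∀ t s, 0 ≤ f t s)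
    (hc : ∀ t s, f t s ≤ c) (hf : ∀ s, Antitone fun t => f t s) (n : ℕ) :
    ∑ t ∈ Finset.range n, f t (x (t + 1)) ≤
      ∑ t ∈ Finset.range n, f t (x t) + (Fintype.card 𝒮 + 1) * c := by
  have h1 : ∑ t ∈ Finset.range n, (f t (x (t + 1)) - f (t + 1) (x (t + 1))) ≤
      ∑ t ∈ Finset.range n, ∑ s, (f t s - f (t + 1) s) :=
    Finset.sum_le_sum fun t _ => Finset.single_le_sum (f := fun s => f t s - f (t + 1) s)
      (fun s _ => sub_nonneg.2 (hf s (Nat.le_succ t))) (Finset.mem_univ _)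
  rw [Finset.sum_comm] at h1
  have h2 : ∑ s, ∑ t ∈ Finset.range n, (f t s - f (t + 1) s) ≤ ∑ _s : 𝒮, c := by
    refine Finset.sum_le_sum fun s _ => ?_
    rw [Finset.sum_range_sub' (fun t => f t s)]
    linarith [h0 n s, hc 0 s]
  rw [Finset.sum_const, Finset.card_univ, nsmul_eq_mul] at h2
  have h3 : ∑ t ∈ Finset.range n, f (t + 1) (x (t + 1)) - ∑ t ∈ Finset.range n, f t (x t) =
      f n (x n) - f 0 (x 0) := by
    rw [← Finset.sum_sub_distrib]; exact Finset.sum_range_sub (fun t => f t (x t)) n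
  rw [Finset.sum_sub_distrib] at h1
  linarith [h0 0 (x 0), hc n (x n)]

end Typical

/-! ### Optimism, and the error of the optimistic values -/

section Errors

variable {𝒮 𝒜 : Type*} [Fintype 𝒮] [Fintype 𝒜] [Nonempty 𝒜] {M : MDP 𝒮 𝒜} {q : Params}
  {sel : 𝒮 → (𝒜 → ℝ) → 𝒜} {x : ℕ → 𝒮} {W : 𝒮 → ℝ}

omit [Fintype 𝒜] [Nonempty 𝒜] in
theorem target_eq (z : 𝒮 × 𝒜) (k : ℕ) : target M q sel x z k =
    vTable M q sel x (visitTime (pairAt M q sel x) z k) (nextState M q sel x z k) := rfl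

omit [Fintype 𝒜] [Nonempty 𝒜] in
theorem backup_le_of_bellman (hW : MDP.IsBellmanSolution M q.γ W) (z : 𝒮 × 𝒜) :
    backup M q.γ W z ≤ W z.1 := hW.ge z.1 z.2

omit [Nonempty 𝒜] in
theorem le_vTable_of_le_qTable (hW : MDP.IsBellmanSolution M q.γ W) {t : ℕ}
    (h : ∀ z, backup M q.γ W z ≤ qTable M q sel x t z) (s : 𝒮) : W s ≤ vTable M q sel x t s := by
  obtain ⟨a, ha⟩ := hW.attained s
  rw [ha]
  exact (h (s, a)).trans (qTable_le_vTable t s a)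

omit [Nonempty 𝒜] in
theorem backup_le_stageEstimate (hq : q.IsValid) (hW : MDP.IsBellmanSolution M q.γ W) {e : ℕ → ℕ}
    (z : 𝒮 × 𝒜) (T j : ℕ) (hpos : 1 ≤ e j)
    (ih : ∀ u < T, ∀ z', backup M q.γ W z' ≤ qTable M q sel x u z')
    (h : stageEnd e j ≤ visits (pairAt M q sel x) z T) (hj : 1 ≤ j)
    (hdev : |∑ k ∈ Finset.Ico (stageEnd e (j - 1)) (stageEnd e j),
      (W (nextState M q sel x z k) - M.next z.1 z.2 W)| ≤ e j * q.bonus (e j)) :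
    backup M q.γ W z ≤ stageEstimate M q sel x e z j := by
  have hpos' : (0 : ℝ) < e j := by exact_mod_cast hpos
  have h1 : ∑ k ∈ Finset.Ico (stageEnd e (j - 1)) (stageEnd e j), W (nextState M q sel x z k) ≤
      ∑ k ∈ Finset.Ico (stageEnd e (j - 1)) (stageEnd e j), target M q sel x z k := by
    refine Finset.sum_le_sum fun k hk => ?_
    have hk' := (visitTime_spec ((Finset.mem_Ico.1 hk).2.trans_le h)).2.1
    exact le_vTable_of_le_qTable hW (ih _ hk') _
  rw [Finset.sum_sub_distrib, Finset.sum_const, Nat.card_Ico, IsStageSeq.stageEnd_sub hj,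
    nsmul_eq_mul] at hdev
  have h2 := (abs_le.1 hdev).1
  have h3 : M.next z.1 z.2 W - q.bonus (e j) ≤
      (∑ k ∈ Finset.Ico (stageEnd e (j - 1)) (stageEnd e j), target M q sel x z k) / e j := by
    rw [le_div_iff₀ hpos']
    linarith
  have h4 := mul_le_mul_of_nonneg_left h3 hq.γ_pos.le
  have h5 := hq.bonus_nonneg (e j)
  have h6 := hq.γ_lt
  unfold backup stageEstimate
  nlinarith

omit [Nonempty 𝒜] in
/-- Optimism: along a typical path, all estimates dominate the optimal values. -/
theorem backup_le_qTable (hq : q.IsValid) (hW : MDP.IsBellmanSolution M q.γ W)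
    (hx : IsTypical M q sel x W) (t : ℕ) (z : 𝒮 × 𝒜) :
    backup M q.γ W z ≤ qTable M q sel x t z :=
  le_qTable hq (fun z => (backup_le_of_bellman hW z).trans (hW.le _))
    (fun z T j ih h1 h2 h => backup_le_stageEstimate hq hW z T j (hq.eChk_isStageSeq.pos h1) ih h h1
      (hx.dev_chk z j T h1 h2 h))
    (fun z T j ih h1 h2 h => backup_le_stageEstimate hq hW z T j (hq.eBar_isStageSeq.pos h1) ih h h1
      (hx.dev_bar z j T h1 h2 h)) t z

omit [Nonempty 𝒜] in
theorem le_vTable (hq : q.IsValid) (hW : MDP.IsBellmanSolution M q.γ W)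
    (hx : IsTypical M q sel x W) (t : ℕ) (s : 𝒮) : W s ≤ vTable M q sel x t s :=
  le_vTable_of_le_qTable hW (backup_le_qTable hq hW hx t) s

variable (M q sel x) in
/-- Number of those visits to `z` before time `n` that are preceded by at most `N₀` visits. -/
noncomputable def activeVisits (z : 𝒮 × 𝒜) (n : ℕ) : ℕ :=
  min (visits (pairAt M q sel x) z n) (⌊q.N₀⌋₊ + 1)

omit [Fintype 𝒜] [Nonempty 𝒜] in
theorem lt_activeVisits {z : 𝒮 × 𝒜} {n k : ℕ} (hq : q.IsValid) :
    k < activeVisits M q sel x z n ↔ k < visits (pairAt M q sel x) z n ∧ (k : ℝ) ≤ q.N₀ := by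
  rw [activeVisits, lt_min_iff, Nat.lt_succ_iff, Nat.le_floor_iff hq.N₀_nonneg]

omit [Nonempty 𝒜] in
/-- A sum over time of nonnegative terms that vanish once a pair has had more than `N₀` visits. -/
theorem sum_time_le_sum_activeVisits (hq : q.IsValid) (F : 𝒮 × 𝒜 → ℕ → ℕ → ℝ)
    (n : ℕ) (h : ∀ t < n, q.N₀ < visits (pairAt M q sel x) (pairAt M q sel x t) t →
      F (pairAt M q sel x t) (visits (pairAt M q sel x) (pairAt M q sel x t) t) t ≤ 0) :
    ∑ t ∈ Finset.range n,
        F (pairAt M q sel x t) (visits (pairAt M q sel x) (pairAt M q sel x t) t) t ≤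
      ∑ z, ∑ k ∈ Finset.range (activeVisits M q sel x z n),
        F z k (visitTime (pairAt M q sel x) z k) := by
  rw [sum_time_eq_sum_visits (ζ := pairAt M q sel x) F n]
  refine Finset.sum_le_sum fun z _ => ?_
  have hle : activeVisits M q sel x z n ≤ visits (pairAt M q sel x) z n := min_le_left _ _
  rw [← Finset.sum_range_add_sum_Ico _ hle]
  refine add_le_of_nonpos_right (Finset.sum_nonpos fun k hk => ?_)
  obtain ⟨h1, h2⟩ := Finset.mem_Ico.1 hk
  obtain ⟨h3, h4, h5⟩ := visitTime_spec h2
  have h6 : q.N₀ < k := by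
    by_contra hcon
    exact absurd ((lt_activeVisits hq).2 ⟨h2, not_lt.1 hcon⟩) (by omega)
  have := h _ h4
  rw [h3, h5] at this
  exact this h6

omit [Fintype 𝒜] [Nonempty 𝒜] in
/-- Error propagation over a type-II stage: the error at a visit is at most twice the bonus plus
the average error at the successors seen in the preceding stage. -/
theorem qTable_sub_backup_le (hq : q.IsValid)
    (hx : IsTypical M q sel x W) {z : 𝒮 × 𝒜} {n k : ℕ} (hk : k < activeVisits M q sel x z n)
    (hH : q.H ≤ k) :
    qTable M q sel x (visitTime (pairAt M q sel x) z k) z - backup M q.γ W z ≤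
      2 * q.bonus (q.eBar (stagesDone q.eBar k)) + q.γ * stageAvg q.eBar (fun i =>
        vTable M q sel x (visitTime (pairAt M q sel x) z i) (nextState M q sel x z i) -
          W (nextState M q sel x z i)) k := by
  obtain ⟨k1, k2⟩ := (lt_activeVisits hq).1 hk
  obtain ⟨-, -, h3⟩ := visitTime_spec k1
  have he := hq.eBar_isStageSeq
  set j := stagesDone q.eBar k with hj
  have hj1 : 1 ≤ j := by
    by_contra h
    have := he.stagesDone_eq_zero_iff.1 (show stagesDone q.eBar k = 0 by omega)
    omega
  have hjk : stageEnd q.eBar j ≤ k := IsStageSeq.stageEnd_stagesDone_le k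
  have hjJ : j ≤ q.JBar := by
    have : j + 1 ≤ stageCount q.eBar q.N₀ :=
      he.succ_le_stageCount (le_trans (by exact_mod_cast hjk) k2)
    rw [q.JBar_eq]; omega
  have h4 := qTable_le_stageEstimate_bar (M := M) (sel := sel) (x := x) hq hj1 hjJ
    (t := visitTime (pairAt M q sel x) z k) (z := z) (by rw [h3]; exact hjk)
  have h5 := hx.dev_bar z j (visitTime (pairAt M q sel x) z k) hj1 hjJ (by rw [h3]; exact hjk)
  have hpos : (0 : ℝ) < q.eBar j := by exact_mod_cast he.pos hj1
  rw [Finset.sum_sub_distrib, Finset.sum_const, Nat.card_Ico, IsStageSeq.stageEnd_sub hj1,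
    nsmul_eq_mul] at h5
  have h6 : stageAvg q.eBar (fun i => W (nextState M q sel x z i)) k ≤
      M.next z.1 z.2 W + q.bonus (q.eBar j) := by
    rw [stageAvg, ← hj, div_le_iff₀ hpos]
    linarith [(abs_le.1 h5).2]
  have h7 : stageAvg q.eBar (target M q sel x z) k = stageAvg q.eBar (fun i =>
        vTable M q sel x (visitTime (pairAt M q sel x) z i) (nextState M q sel x z i) -
          W (nextState M q sel x z i)) k + stageAvg q.eBar (fun i => W (nextState M q sel x z i)) k := by
    rw [← IsStageSeq.stageAvg_add]
    congr 1
    funext i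
    rw [target_eq]; ring
  have h8 : stageEstimate M q sel x q.eBar z j = M.r z.1 z.2 +
      q.γ * stageAvg q.eBar (target M q sel x z) k + q.bonus (q.eBar j) := rfl
  rw [h8, h7] at h4
  have h9 := mul_le_mul_of_nonneg_left h6 hq.γ_pos.le
  have h10 := hq.bonus_nonneg (q.eBar j)
  have h11 := hq.γ_lt
  unfold backup
  nlinarith

/-- The part of the error of the visited action values that exceeds a threshold `β`, summed over
the active visits. Errors propagate through type-II stages; each backup shrinks the sum by a
factor of `1 - (1 - γ) / 2`, and the threshold makes the sum of the bonuses finite. -/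
theorem sum_max_qTable_sub_backup_le (hq : q.IsValid) (hS : q.S = Fintype.card 𝒮)
    (hA : q.A = Fintype.card 𝒜) (hsel : ∀ (s : 𝒮) (f : 𝒜 → ℝ) (a : 𝒜), f a ≤ f (sel s f))
    (hW : MDP.IsBellmanSolution M q.γ W)
    (hx : IsTypical M q sel x W) {β : ℝ} (hβ : 0 < β) (hβ1 : β ≤ 1) (n : ℕ)
    (hcap : ∀ t < n, q.N₀ < visits (pairAt M q sel x) (pairAt M q sel x t) t →
      vTable M q sel x t (x t) - W (x t) ≤ β) :
    ∑ z, ∑ k ∈ Finset.range (activeVisits M q sel x z n),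
        max (qTable M q sel x (visitTime (pairAt M q sel x) z k) z - backup M q.γ W z - β) 0 ≤
      1164 * (q.S * q.A * q.H ^ 5 * q.ι / β) ∧
    ∑ t ∈ Finset.range n, max (vTable M q sel x t (x (t + 1)) - W (x (t + 1)) - β) 0 ≤
      1164 * (q.S * q.A * q.H ^ 5 * q.ι / β) + (q.S + 1) * q.H := by
  have he := hq.eBar_isStageSeq
  have hH := hq.one_le_H_cast
  have hG := Params.IsValid.horizon_le_H (q := q)
  have hι := hq.half_lt_ι
  have hS1 : (1 : ℝ) ≤ q.S := by exact_mod_cast hq.S_pos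
  have hA1 : (1 : ℝ) ≤ q.A := by exact_mod_cast hq.A_pos
  have hg := hq.one_sub_pos
  set G : ℝ := 1 / (1 - q.γ) with hGdef
  have hG0 : 0 < G := hq.horizon_pos
  set X := ∑ z, ∑ k ∈ Finset.range (activeVisits M q sel x z n),
    max (qTable M q sel x (visitTime (pairAt M q sel x) z k) z - backup M q.γ W z - β) 0 with hX
  set f : ℕ → 𝒮 → ℝ := fun t s => max (vTable M q sel x t s - W s - β) 0 with hf
  have hf0 : ∀ t s, 0 ≤ f t s := fun t s => le_max_right _ _
  have hfG : ∀ t s, f t s ≤ G := fun t s =>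
    max_le (by linarith [vTable_le (M := M) (sel := sel) (x := x) hq t s, hW.nonneg s]) hG0.le
  have hfa : ∀ s, Antitone fun t => f t s := fun s t u htu =>
    max_le_max (sub_le_sub_right (sub_le_sub_right (vTable_antitone hq s htu) _) _) le_rfl
  -- the errors at the visited states are dominated by those at the visited pairs
  have hY : ∑ t ∈ Finset.range n, f t (x t) ≤ X := by
    have h1 : ∑ t ∈ Finset.range n, f t (x t) ≤ ∑ t ∈ Finset.range n,
        (fun (z : 𝒮 × 𝒜) (k : ℕ) (t : ℕ) => if (k : ℝ) ≤ q.N₀ then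
          max (qTable M q sel x t z - backup M q.γ W z - β) 0 else 0) (pairAt M q sel x t)
          (visits (pairAt M q sel x) (pairAt M q sel x t) t) t := by
      refine Finset.sum_le_sum fun t ht => ?_
      dsimp only
      split_ifs with h
      · refine max_le_max (sub_le_sub_right ?_ β) le_rfl
        rw [vTable_path_eq hsel]
        exact sub_le_sub_left (backup_le_of_bellman hW (pairAt M q sel x t)) _
      · exact max_le (by linarith [hcap t (Finset.mem_range.1 ht) (not_le.1 h)]) le_rfl
    refine h1.trans ((sum_time_le_sum_activeVisits (sel := sel) (x := x) (M := M) hq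
      (fun (z : 𝒮 × 𝒜) (k : ℕ) (t : ℕ) => if (k : ℝ) ≤ q.N₀ then
          max (qTable M q sel x t z - backup M q.γ W z - β) 0 else 0) n ?_).trans_eq ?_)
    · intro t _ h
      simp only [if_neg (not_le.2 h), le_refl]
    · refine Finset.sum_congr rfl fun z _ => Finset.sum_congr rfl fun k hk => ?_
      rw [if_pos ((lt_activeVisits hq).1 (Finset.mem_range.1 hk)).2]
  have hshift := sum_shift_path_le x hf0 hfG hfa n
  have hper : ∀ z : 𝒮 × 𝒜, ∑ k ∈ Finset.range (activeVisits M q sel x z n),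
      max (qTable M q sel x (visitTime (pairAt M q sel x) z k) z - backup M q.γ W z - β) 0 ≤
      q.H * G + 576 * q.H ^ 3 * 1 * q.ι / ((1 - q.γ) * β) +
      q.γ * ((1 + 1 / q.H) * ∑ i ∈ Finset.range (activeVisits M q sel x z n),
        f (visitTime (pairAt M q sel x) z i) (nextState M q sel x z i)) := by
    intro z
    set K := activeVisits M q sel x z n with hK
    set D : ℕ → ℝ := fun k =>
      max (qTable M q sel x (visitTime (pairAt M q sel x) z k) z - backup M q.γ W z - β) 0 with hD
    have hD0 : ∀ k, 0 ≤ D k := fun k => le_max_right _ _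
    have hb0 : 0 ≤ backup M q.γ W z := add_nonneg (M.r_nonneg _ _)
      (mul_nonneg hq.γ_pos.le (MDP.next_nonneg _ _ hW.nonneg))
    have hDG : ∀ k, D k ≤ G := fun k => by
      have := qTable_le (M := M) (sel := sel) (x := x) hq (visitTime (pairAt M q sel x) z k) z
      exact max_le (by linarith) hG0.le
    have h1 : ∑ k ∈ Finset.range K, D k ≤
        ∑ k ∈ Finset.range q.H, D k + ∑ k ∈ Finset.Ico q.H K, D k := by
      rcases le_total q.H K with h | h
      · rw [Finset.sum_range_add_sum_Ico _ h]
      · rw [Finset.Ico_eq_empty_of_le h, Finset.sum_empty, add_zero]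
        exact Finset.sum_le_sum_of_subset_of_nonneg (Finset.range_mono h) fun k _ _ => hD0 k
    have h2 : ∑ k ∈ Finset.range q.H, D k ≤ q.H * G := by
      refine (Finset.sum_le_sum fun k _ => hDG k).trans_eq ?_
      simp
    have h3 : ∑ k ∈ Finset.Ico q.H K, D k ≤ ∑ k ∈ Finset.Ico q.H K,
        (max (2 * q.bonus (q.eBar (stagesDone q.eBar k)) - (1 - q.γ) * β) 0 +
          q.γ * stageAvg q.eBar (fun i =>
            f (visitTime (pairAt M q sel x) z i) (nextState M q sel x z i)) k) := by
      refine Finset.sum_le_sum fun k hk => ?_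
      obtain ⟨k1, k2⟩ := Finset.mem_Ico.1 hk
      have h4 := qTable_sub_backup_le hq hx k2 k1
      have h5 : stageAvg q.eBar (fun i =>
          vTable M q sel x (visitTime (pairAt M q sel x) z i) (nextState M q sel x z i) -
            W (nextState M q sel x z i)) k ≤ stageAvg q.eBar (fun i =>
            f (visitTime (pairAt M q sel x) z i) (nextState M q sel x z i)) k + β := by
        conv_rhs => rw [← he.stageAvg_const β k1, ← IsStageSeq.stageAvg_add]
        refine IsStageSeq.stageAvg_mono fun i _ => ?_
        have := le_max_left (vTable M q sel x (visitTime (pairAt M q sel x) z i)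
          (nextState M q sel x z i) - W (nextState M q sel x z i) - β) 0
        simp only [hf]
        linarith
      have h6 := mul_le_mul_of_nonneg_left h5 hq.γ_pos.le
      have h7 := le_max_left (2 * q.bonus (q.eBar (stagesDone q.eBar k)) - (1 - q.γ) * β) 0
      have h8 : 0 ≤ stageAvg q.eBar (fun i =>
            f (visitTime (pairAt M q sel x) z i) (nextState M q sel x z i)) k :=
        div_nonneg (Finset.sum_nonneg fun i _ => hf0 _ _) (Nat.cast_nonneg _)
      refine max_le (by linarith) (add_nonneg (le_max_right _ _) (mul_nonneg hq.γ_pos.le h8))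
    rw [Finset.sum_add_distrib, ← Finset.mul_sum] at h3
    have h9 := IsStageSeq.sum_bonus_le he (by linarith) (mul_pos hg hβ) K
    have h10 := mul_le_mul_of_nonneg_left (he.sum_stageAvg_le
      (F := fun i => f (visitTime (pairAt M q sel x) z i) (nextState M q sel x z i))
      (fun i => hf0 _ _) K) hq.γ_pos.le
    linarith
  have hsum := Finset.sum_le_sum fun z (_ : z ∈ Finset.univ) => hper z
  rw [← hX, Finset.sum_add_distrib, Finset.sum_const, Finset.card_univ, Fintype.card_prod,
    ← Finset.mul_sum, ← Finset.mul_sum, nsmul_eq_mul, Nat.cast_mul, ← hS, ← hA] at hsum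
  have hsucc : ∑ z, ∑ i ∈ Finset.range (activeVisits M q sel x z n),
      f (visitTime (pairAt M q sel x) z i) (nextState M q sel x z i) ≤
      ∑ t ∈ Finset.range n, f t (x (t + 1)) := by
    rw [sum_time_eq_sum_visits (ζ := pairAt M q sel x) (fun _ _ t => f t (x (t + 1))) n]
    exact Finset.sum_le_sum fun z _ => Finset.sum_le_sum_of_subset_of_nonneg
      (Finset.range_mono (min_le_left _ _)) fun k _ _ => hf0 _ _
  rw [← hS] at hshift
  set Z := ∑ z, ∑ i ∈ Finset.range (activeVisits M q sel x z n),
      f (visitTime (pairAt M q sel x) z i) (nextState M q sel x z i) with hZ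
  have hZ0 : 0 ≤ Z := Finset.sum_nonneg fun z _ => Finset.sum_nonneg fun i _ => hf0 _ _
  have hcontr : q.γ * ((1 + 1 / q.H) * Z) ≤ (1 - (1 - q.γ) / 2) * (X + (q.S + 1) * G) := by
    rw [← mul_assoc]
    exact mul_le_mul hq.γ_mul_growth_le (by linarith) hZ0 (by linarith [hq.γ_pos])
  -- solve the resulting inequality for `X`
  set u : ℝ := q.S * q.A * q.H ^ 4 * q.ι / β with hu
  have hu1 : (q.S : ℝ) * q.A * (q.H * G) ≤ 2 * u := by
    rw [show 2 * u = 2 * (q.S * q.A * q.H ^ 4 * q.ι) / β by rw [hu]; ring, le_div_iff₀ hβ]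
    have h1 : (q.H : ℝ) * G * β ≤ q.H ^ 2 := by
      calc (q.H : ℝ) * G * β ≤ q.H * q.H * 1 := by gcongr
        _ = _ := by ring
    have h2 : (q.H : ℝ) ^ 2 ≤ q.H ^ 4 := pow_le_pow_right₀ hH (by norm_num)
    have h3 : (q.H : ℝ) ^ 4 ≤ 2 * (q.H ^ 4 * q.ι) := by nlinarith [pow_pos (zero_lt_one.trans_le hH) 4]
    have h4 : (q.H : ℝ) * G * β ≤ 2 * (q.H ^ 4 * q.ι) := by linarith
    have h5 : (0 : ℝ) ≤ q.S * q.A := by positivity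
    nlinarith [mul_le_mul_of_nonneg_left h4 h5]
  have hu2 : (q.S : ℝ) * q.A * (576 * q.H ^ 3 * 1 * q.ι / ((1 - q.γ) * β)) ≤ 576 * u := by
    have h1 : 576 * (q.H : ℝ) ^ 3 * 1 * q.ι / ((1 - q.γ) * β) = G * (576 * q.H ^ 3 * q.ι / β) := by
      rw [hGdef]; field_simp
    rw [h1]
    calc _ ≤ (q.S : ℝ) * q.A * (q.H * (576 * q.H ^ 3 * q.ι / β)) := by gcongr
      _ = _ := by rw [hu]; ring
  have hu3 : ((q.S : ℝ) + 1) * G ≤ 4 * u := by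
    have h1 : ((q.S : ℝ) + 1) * G ≤ 2 * (q.S * q.A * (q.H * G)) := by
      have h2 : (q.S : ℝ) ≤ q.S * q.A := by nlinarith
      have h3 : G ≤ q.H * G := by nlinarith
      have h4 : (q.S : ℝ) * q.A * G ≤ q.S * q.A * (q.H * G) := by gcongr
      nlinarith
    linarith
  have hX2 : (1 - q.γ) / 2 * X ≤ 582 * u := by
    rw [mul_add] at hsum
    have : (1 - (1 - q.γ) / 2) * ((q.S + 1) * G) ≤ ((q.S : ℝ) + 1) * G := by
      refine mul_le_of_le_one_left (by positivity) (by linarith)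
    nlinarith
  have hXfin : X ≤ 1164 * (q.S * q.A * q.H ^ 5 * q.ι / β) := by
    have h1 : X = 2 * G * ((1 - q.γ) / 2 * X) := by rw [hGdef]; field_simp
    rw [h1]
    calc _ ≤ 2 * (q.H : ℝ) * (582 * u) := by
          have : 0 ≤ (1 - q.γ) / 2 * X := mul_nonneg (by linarith)
            (Finset.sum_nonneg fun z _ => Finset.sum_nonneg fun k _ => le_max_right _ _)
          gcongr
      _ = _ := by rw [hu]; ring
  refine ⟨hXfin, ?_⟩
  have : ((q.S : ℝ) + 1) * G ≤ (q.S + 1) * q.H := by gcongr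
  linarith

end Errors

/-! ### Pairs beyond the visit cap -/

section Capped

variable {𝒮 𝒜 : Type*} [Fintype 𝒮] [Fintype 𝒜] [Nonempty 𝒜] {M : MDP 𝒮 𝒜} {q : Params}
  {sel : 𝒮 → (𝒜 → ℝ) → 𝒜} {x : ℕ → 𝒮} {W : 𝒮 → ℝ}

variable (M q sel x) in
/-- At time `t` the visited pair has already had more than `N₀` visits. -/
def IsCapped (t : ℕ) : Prop := q.N₀ < visits (pairAt M q sel x) (pairAt M q sel x t) t

/-- The accuracy reached at a pair beyond the visit cap, per state that has been visited with such
a pair. -/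
noncomputable def Params.capError (q : Params) : ℝ := q.ε / (12 * q.S * q.H)

/-- The constant of the visit cap from which the analysis works. -/
def capConstant : ℝ := 167616

theorem Params.IsValid.capError_pos (hq : q.IsValid) : 0 < q.capError := by
  have h1 : (0 : ℝ) < q.S := by exact_mod_cast hq.S_pos
  have h2 := hq.one_le_H_cast
  have h3 := hq.ε_pos
  unfold Params.capError
  positivity

theorem Params.IsValid.capError_mul_le (hq : q.IsValid) {m : ℝ} (h : m ≤ 3 * q.S) :
    m * q.capError ≤ (1 - q.γ) * q.ε / 4 := by
  have h1 : (0 : ℝ) < q.S := by exact_mod_cast hq.S_pos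
  have h2 := hq.one_le_H_cast
  have h3 := hq.ε_pos
  have h4 := hq.capError_pos
  calc m * q.capError ≤ 3 * q.S * q.capError := by gcongr
    _ = q.ε / (4 * q.H) := by unfold Params.capError; field_simp; norm_num
    _ ≤ _ := by
      rw [div_le_iff₀ (by positivity)]
      nlinarith [hq.one_le_one_sub_mul_H]

theorem Params.IsValid.one_le_log (hq : q.IsValid) :
    1 ≤ Real.log (4 * q.H ^ 2 * q.S / q.ε) := by
  have h1 : (1 : ℝ) ≤ q.S := by exact_mod_cast hq.S_pos
  have h2 := hq.one_le_H_cast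
  have h3 := hq.ε_pos
  have h4 := hq.ε_le_H
  rw [Real.le_log_iff_exp_le (by positivity), le_div_iff₀ h3]
  have h5 := Real.exp_one_lt_d9
  have h6 : (q.H : ℝ) ≤ q.H ^ 2 * q.S := by nlinarith
  nlinarith

/-- The visit cap is large enough for the accuracy `capError`. -/
theorem Params.IsValid.le_N₀_mul (hq : q.IsValid) (hc : capConstant ≤ q.c₁) :
    1164 * (q.S * q.A * q.H ^ 5 * q.ι / q.capError) ≤ q.N₀ * q.capError := by
  have h1 : (1 : ℝ) ≤ q.S := by exact_mod_cast hq.S_pos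
  have h1' : (1 : ℝ) ≤ q.A := by exact_mod_cast hq.A_pos
  have h2 := hq.one_le_H_cast
  have h3 := hq.ε_pos
  have h4 := hq.half_lt_ι
  have h5 := hq.one_le_log
  have h6 := hq.capError_pos
  set ℓ := Real.log (4 * q.H ^ 2 * q.S / q.ε) with hℓ
  rw [mul_div_assoc', div_le_iff₀ h6]
  have h7 : q.N₀ * q.capError * q.capError = q.c₁ / 144 * ℓ ^ 2 * (q.S * q.A * q.H ^ 5 * q.ι) := by
    unfold Params.N₀ Params.capError
    rw [← hℓ]
    field_simp
    norm_num
  rw [h7]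
  have h8 : 1 ≤ ℓ ^ 2 := one_le_pow₀ h5
  have h9 : 1164 ≤ q.c₁ / 144 := by
    rw [le_div_iff₀ (by norm_num)]; unfold capConstant at hc; linarith
  have h10 : 1164 ≤ q.c₁ / 144 * ℓ ^ 2 := by nlinarith
  gcongr

/-- If all earlier visits to capped pairs had error at most `β`, the error at a capped pair is at
most `β + capError`: otherwise all of its first `N₀` visits had a larger error. -/
theorem qTable_sub_backup_le_of_isCapped (hq : q.IsValid) (hS : q.S = Fintype.card 𝒮)
    (hA : q.A = Fintype.card 𝒜) (hc : capConstant ≤ q.c₁)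
    (hsel : ∀ (s : 𝒮) (f : 𝒜 → ℝ) (a : 𝒜), f a ≤ f (sel s f))
    (hW : MDP.IsBellmanSolution M q.γ W)
    (hx : IsTypical M q sel x W) {β : ℝ} (hβ : q.capError ≤ β) (hβ1 : β ≤ 1) {t : ℕ}
    (hcap : ∀ u < t, IsCapped M q sel x u → vTable M q sel x u (x u) - W (x u) ≤ β)
    (ht : IsCapped M q sel x t) :
    qTable M q sel x t (pairAt M q sel x t) - backup M q.γ W (pairAt M q sel x t) ≤
      β + q.capError := by
  have hy := hq.capError_pos
  obtain ⟨h1, -⟩ := sum_max_qTable_sub_backup_le hq hS hA hsel hW hx (hy.trans_le hβ) hβ1 t hcap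
  set z := pairAt M q sel x t with hz
  set d := max (qTable M q sel x t z - backup M q.γ W z - β) 0 with hd
  have hd0 : 0 ≤ d := le_max_right _ _
  have hact : activeVisits M q sel x z t = ⌊q.N₀⌋₊ + 1 := by
    refine min_eq_right ?_
    have : ⌊q.N₀⌋₊ < visits (pairAt M q sel x) z t := (Nat.floor_lt hq.N₀_nonneg).2 ht
    exact this
  have h2 : ∑ k ∈ Finset.range (activeVisits M q sel x z t), d ≤
      ∑ k ∈ Finset.range (activeVisits M q sel x z t),
        max (qTable M q sel x (visitTime (pairAt M q sel x) z k) z - backup M q.γ W z - β) 0 := by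
    refine Finset.sum_le_sum fun k hk => max_le_max ?_ le_rfl
    have h3 := (visitTime_spec ((lt_activeVisits hq).1 (Finset.mem_range.1 hk)).1).2.1
    have := qTable_antitone (M := M) (sel := sel) (x := x) hq z h3.le
    dsimp only at this
    linarith
  have h3 := Finset.single_le_sum (f := fun z => ∑ k ∈ Finset.range (activeVisits M q sel x z t),
    max (qTable M q sel x (visitTime (pairAt M q sel x) z k) z - backup M q.γ W z - β) 0)
    (fun z _ => Finset.sum_nonneg fun k _ => le_max_right _ _) (Finset.mem_univ z)
  rw [Finset.sum_const, Finset.card_range, nsmul_eq_mul] at h2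
  have h4 : q.N₀ ≤ (activeVisits M q sel x z t : ℝ) := by
    rw [hact]; push_cast; exact (Nat.lt_floor_add_one _).le
  have h5 : 1164 * (q.S * q.A * q.H ^ 5 * q.ι / β) ≤ q.N₀ * q.capError := by
    refine le_trans ?_ (hq.le_N₀_mul hc)
    have := hq.half_lt_ι
    gcongr
  have hN : 0 < q.N₀ := by
    have h6 : (0 : ℝ) < q.S := by exact_mod_cast hq.S_pos
    have h6' : (0 : ℝ) < q.A := by exact_mod_cast hq.A_pos
    have h7 := hq.one_le_H_cast
    have h8 := hq.half_lt_ι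
    have h9 : 0 < 1164 * (q.S * q.A * q.H ^ 5 * q.ι / q.capError) := by positivity
    have := h9.trans_le (hq.le_N₀_mul hc)
    exact (pos_iff_pos_of_mul_pos this).2 hy
  have h6 : q.N₀ * d ≤ q.N₀ * q.capError :=
    (mul_le_mul_of_nonneg_right h4 hd0).trans ((h2.trans h3).trans (h1.trans h5))
  have h7 := le_of_mul_le_mul_left h6 hN
  have h8 := le_max_left (qTable M q sel x t z - backup M q.γ W z - β) 0
  linarith

open Classical in
/-- The error at a state visited with a capped pair grows at most by `capError` with each new state
to which this happens, hence stays below `(S + 1) * capError`. -/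
theorem vTable_sub_le_of_isCapped (hq : q.IsValid) (hS : q.S = Fintype.card 𝒮)
    (hA : q.A = Fintype.card 𝒜) (hc : capConstant ≤ q.c₁)
    (hsel : ∀ (s : 𝒮) (f : 𝒜 → ℝ) (a : 𝒜), f a ≤ f (sel s f))
    (hW : MDP.IsBellmanSolution M q.γ W) (hx : IsTypical M q sel x W) {t : ℕ}
    (ht : IsCapped M q sel x t) :
    vTable M q sel x t (x t) - W (x t) ≤ (q.S + 1) * q.capError := by
  have hy := hq.capError_pos
  have hS1 : (1 : ℝ) ≤ q.S := by exact_mod_cast hq.S_pos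
  let F : ℕ → Finset 𝒮 := fun t => Finset.univ.filter fun s => ∃ u < t, x u = s ∧ IsCapped M q sel x u
  have hFmono : Monotone F := fun t t' h s hs => by
    obtain ⟨u, hu, h1, h2⟩ := (Finset.mem_filter.1 hs).2
    exact Finset.mem_filter.2 ⟨Finset.mem_univ s, u, by omega, h1, h2⟩
  have hFcard : ∀ t, ((F t).card : ℝ) ≤ q.S := fun t => by
    rw [hS]; exact_mod_cast Finset.card_le_univ _
  suffices h : ∀ t, IsCapped M q sel x t →
      vTable M q sel x t (x t) - W (x t) ≤ ((F (t + 1)).card + 1) * q.capError from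
    (h t ht).trans (mul_le_mul_of_nonneg_right (by linarith [hFcard (t + 1)]) hy.le)
  intro t
  induction t using Nat.strong_induction_on with
  | _ t ih =>
    intro ht
    by_cases hmem : x t ∈ F t
    · obtain ⟨u, hu, h1, h2⟩ := (Finset.mem_filter.1 hmem).2
      have h3 := ih u hu h2
      rw [h1] at h3
      have h4 := vTable_antitone (M := M) (sel := sel) (x := x) hq (x t) hu.le
      dsimp only at h4
      have h5 : ((F (u + 1)).card : ℝ) ≤ (F (t + 1)).card := by
        exact_mod_cast Finset.card_le_card (hFmono (by omega))
      nlinarith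
    · have hcard : (F t).card + 1 ≤ (F (t + 1)).card := by
        rw [← Finset.card_insert_of_notMem hmem]
        refine Finset.card_le_card (Finset.insert_subset ?_ (hFmono (Nat.le_succ t)))
        exact Finset.mem_filter.2 ⟨Finset.mem_univ _, t, Nat.lt_succ_self t, rfl, ht⟩
      have hβ1 : ((F t).card + 1) * q.capError ≤ 1 := by
        have h6 := hq.capError_mul_le (m := (F t).card + 1) (by linarith [hFcard t])
        have h7 := hq.ε_le
        rw [le_div_iff₀ hq.one_sub_pos] at h7
        linarith
      have h3 := qTable_sub_backup_le_of_isCapped hq hS hA hc hsel hW hx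
        (β := ((F t).card + 1) * q.capError) (le_mul_of_one_le_left hy.le (by simp)) hβ1
        (fun u hu hcu => (ih u hu hcu).trans (mul_le_mul_of_nonneg_right (by
          have : ((F (u + 1)).card : ℝ) ≤ (F t).card := by
            exact_mod_cast Finset.card_le_card (hFmono hu)
          linarith) hy.le)) ht
      rw [← vTable_path_eq hsel] at h3
      have h4 := backup_le_of_bellman hW (pairAt M q sel x t)
      have h5 : ((F t).card : ℝ) + 1 ≤ (F (t + 1)).card := by exact_mod_cast hcard
      have h6 : W (pairAt M q sel x t).1 = W (x t) := rfl
      nlinarith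

theorem vTable_sub_le_quarter_of_isCapped (hq : q.IsValid) (hS : q.S = Fintype.card 𝒮)
    (hA : q.A = Fintype.card 𝒜) (hc : capConstant ≤ q.c₁)
    (hsel : ∀ (s : 𝒮) (f : 𝒜 → ℝ) (a : 𝒜), f a ≤ f (sel s f))
    (hW : MDP.IsBellmanSolution M q.γ W) (hx : IsTypical M q sel x W) {t : ℕ}
    (ht : IsCapped M q sel x t) :
    vTable M q sel x t (x t) - W (x t) ≤ (1 - q.γ) * q.ε / 4 ∧
    qTable M q sel x t (pairAt M q sel x t) - backup M q.γ W (pairAt M q sel x t) ≤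
      (1 - q.γ) * q.ε / 4 := by
  have hy := hq.capError_pos
  have hS1 : (1 : ℝ) ≤ q.S := by exact_mod_cast hq.S_pos
  have h1 := fun u (hu : IsCapped M q sel x u) =>
    vTable_sub_le_of_isCapped hq hS hA hc hsel hW hx hu
  have h7 := hq.ε_le
  rw [le_div_iff₀ hq.one_sub_pos] at h7
  have h2 := hq.capError_mul_le (m := q.S + 1) (by linarith)
  refine ⟨(h1 t ht).trans h2, ?_⟩
  have h3 := qTable_sub_backup_le_of_isCapped hq hS hA hc hsel hW hx
    (β := (q.S + 1) * q.capError) (le_mul_of_one_le_left hy.le (by linarith))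
    (by linarith) (fun u _ hu => h1 u hu) ht
  have h4 := hq.capError_mul_le (m := q.S + 2) (by linarith)
  linarith

end Capped

/-! ### Bellman residuals and the number of suboptimal steps -/

section Residual

variable {𝒮 𝒜 : Type*} [Fintype 𝒮] [Fintype 𝒜] [Nonempty 𝒜] {M : MDP 𝒮 𝒜} {q : Params}
  {sel : 𝒮 → (𝒜 → ℝ) → 𝒜} {x : ℕ → 𝒮} {W : 𝒮 → ℝ}

variable (M q sel x) in
/-- The Bellman residual `Q_t - r - γ P V_t` at the pair `z`. -/
noncomputable def residual (t : ℕ) (z : 𝒮 × 𝒜) : ℝ :=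
  qTable M q sel x t z - M.r z.1 z.2 - q.γ * M.next z.1 z.2 (vTable M q sel x t)

omit [Fintype 𝒜] [Nonempty 𝒜] in
/-- The Bellman residual at a visit is at most twice the bonus plus the decrease of `P V` since the
preceding type-I stage. -/
theorem residual_le (hq : q.IsValid) (hx : IsTypical M q sel x W) {z : 𝒮 × 𝒜} {n k : ℕ}
    (hk : k < activeVisits M q sel x z n) (hH : q.H ≤ k) :
    residual M q sel x (visitTime (pairAt M q sel x) z k) z ≤
      2 * q.bonus (q.eChk (stagesDone q.eChk k)) + q.γ * (stageAvg q.eChk (fun i =>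
        M.next z.1 z.2 (vTable M q sel x (visitTime (pairAt M q sel x) z i))) k -
        M.next z.1 z.2 (vTable M q sel x (visitTime (pairAt M q sel x) z k))) := by
  obtain ⟨k1, k2⟩ := (lt_activeVisits hq).1 hk
  obtain ⟨-, -, h3⟩ := visitTime_spec k1
  have he := hq.eChk_isStageSeq
  set j := stagesDone q.eChk k with hj
  have hj1 : 1 ≤ j := by
    by_contra h
    have := he.stagesDone_eq_zero_iff.1 (show stagesDone q.eChk k = 0 by omega)
    omega
  have hjk : stageEnd q.eChk j ≤ k := IsStageSeq.stageEnd_stagesDone_le k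
  have hjJ : j ≤ q.JChk := by
    have : j + 1 ≤ stageCount q.eChk q.N₀ :=
      he.succ_le_stageCount (le_trans (by exact_mod_cast hjk) k2)
    rw [q.JChk_eq]; omega
  have h4 := qTable_le_stageEstimate_chk (M := M) (sel := sel) (x := x) hq hj1 hjJ
    (t := visitTime (pairAt M q sel x) z k) (z := z) (by rw [h3]; exact hjk)
  have h5 := hx.dev_target z j (visitTime (pairAt M q sel x) z k) hj1 hjJ (by rw [h3]; exact hjk)
  have hpos : (0 : ℝ) < q.eChk j := by exact_mod_cast he.pos hj1
  rw [Finset.sum_sub_distrib] at h5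
  have h6 : stageAvg q.eChk (target M q sel x z) k ≤ stageAvg q.eChk (fun i =>
        M.next z.1 z.2 (vTable M q sel x (visitTime (pairAt M q sel x) z i))) k +
        q.bonus (q.eChk j) := by
    rw [stageAvg, stageAvg, ← hj, div_add' _ _ _ hpos.ne', div_le_div_iff_of_pos_right hpos]
    linarith
  have h8 : stageEstimate M q sel x q.eChk z j = M.r z.1 z.2 +
      q.γ * stageAvg q.eChk (target M q sel x z) k + q.bonus (q.eChk j) := rfl
  rw [h8] at h4
  have h9 := mul_le_mul_of_nonneg_left h6 hq.γ_pos.le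
  have h10 := hq.bonus_nonneg (q.eChk j)
  have h11 := hq.γ_lt
  unfold residual
  nlinarith

/-- Collection of the terms that bound the sum of the Bellman residuals. -/
theorem residual_bound_le {S A H B ι ε G β : ℝ} (hS1 : 1 ≤ S) (hA1 : 1 ≤ A) (hH : 1 ≤ H)
    (hB : 1 ≤ B) (hBH : B * B = H) (hι : 1 / 2 < ι) (hε : 0 < ε) (hεH : ε ≤ H)
    (hG : G ≤ H) (hβH : ε / (4 * H) ≤ β) :
    S * A * (H * G + 576 * H ^ 3 * B * ι / β + 3 * H * G) +
      6 / (H * B) * (2 * (1164 * (S * A * H ^ 5 * ι / β) + (S + 1) * H) + 2 * H * ι) ≤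
    60000 * (S * A * H ^ 4 * B * ι / ε) := by
  have hι0 : 0 < ι := by linarith
  have hH0 : 0 < H := by linarith
  have hB0 : 0 < B := by linarith
  set u : ℝ := S * A * H ^ 4 * B * ι / ε with hu
  have hu0 : S * A * H * H * B * ι ≤ u := by
    rw [hu, le_div_iff₀ hε]
    have h2 : H ^ 3 ≤ H ^ 4 := pow_le_pow_right₀ hH (by norm_num)
    calc S * A * H * H * B * ι * ε ≤
        S * A * H * H * B * ι * H := by gcongr
      _ = S * A * B * ι * H ^ 3 := by ring
      _ ≤ S * A * B * ι * H ^ 4 := by gcongr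
      _ = _ := by ring
  have hu1 : S * A * (H * G) ≤ 2 * u := by
    calc S * A * (H * G) ≤ S * A * (H * H) * (B * (2 * ι)) := by
          have h2 : 1 ≤ B * (2 * ι) := by nlinarith
          calc _ ≤ S * A * (H * H) * 1 := by rw [mul_one]; gcongr
            _ ≤ _ := by gcongr
      _ = 2 * (S * A * H * H * B * ι) := by ring
      _ ≤ _ := by linarith
  have hdiv : ∀ c : ℝ, 0 ≤ c → c / β ≤ 4 * H * c / ε := fun c hc => by
    calc c / β ≤ c / (ε / (4 * H)) := by gcongr
      _ = _ := by field_simp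
  have hu2 : S * A * (576 * H ^ 3 * B * ι / β) ≤ 2304 * u := by
    calc _ ≤ S * A * (4 * H * (576 * H ^ 3 * B * ι) / ε) := by
          exact mul_le_mul_of_nonneg_left (hdiv _ (by positivity)) (by positivity)
      _ = _ := by rw [hu]; ring
  have hu3 : 6 / (H * B) * (2 * (1164 * (S * A * H ^ 5 * ι / β))) ≤ 55872 * u := by
    calc _ ≤ 6 / (H * B) * (2 * (1164 * (4 * H * (S * A * H ^ 5 * ι) / ε))) := by
          refine mul_le_mul_of_nonneg_left ?_ (by positivity)
          refine mul_le_mul_of_nonneg_left ?_ (by norm_num)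
          exact mul_le_mul_of_nonneg_left (hdiv _ (by positivity)) (by norm_num)
      _ = 55872 * (S * A * H ^ 4 * (H / B) * ι / ε) := by field_simp; ring
      _ = _ := by rw [hu, ← hBH, mul_div_cancel_right₀ _ (by positivity)]
  have hu4 : 6 / (H * B) * (2 * ((S + 1) * H) + 2 * H * ι) ≤ 60 * u := by
    have h2 : 6 / (H * B) * (2 * ((S + 1) * H) + 2 * H * ι) =
        (12 * (S + 1) + 12 * ι) / B := by field_simp; ring
    rw [h2, div_le_iff₀ (by positivity)]
    have h3 : S * ι ≤ u := by
      refine le_trans ?_ hu0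
      calc S * ι = S * 1 * 1 * 1 * 1 * ι := by ring
        _ ≤ _ := by gcongr
    have h4 : ι ≤ S * ι := by nlinarith
    have h5 : S ≤ 2 * (S * ι) := by nlinarith
    have h6 : 60 * u ≤ 60 * u * B := le_mul_of_one_le_right (by linarith) hB
    linarith
  have h3 : 6 / (H * B) * (2 * (1164 * (S * A * H ^ 5 * ι / β) + (S + 1) * H) + 2 * H * ι) =
      6 / (H * B) * (2 * (1164 * (S * A * H ^ 5 * ι / β))) +
      6 / (H * B) * (2 * ((S + 1) * H) + 2 * H * ι) := by ring
  have h4 : S * A * (H * G + 576 * H ^ 3 * B * ι / β + 3 * H * G) =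
      4 * (S * A * (H * G)) + S * A * (576 * H ^ 3 * B * ι / β) := by ring
  have hu5 : 0 ≤ u := by positivity
  rw [h4, h3]
  linarith

/-- The part of the Bellman residuals above `(1 - γ) ε / 2`, summed along a typical path. -/
theorem sum_residual_le (hq : q.IsValid) (hS : q.S = Fintype.card 𝒮)
    (hA : q.A = Fintype.card 𝒜) (hc : capConstant ≤ q.c₁)
    (hsel : ∀ (s : 𝒮) (f : 𝒜 → ℝ) (a : 𝒜), f a ≤ f (sel s f))
    (hW : MDP.IsBellmanSolution M q.γ W) (hx : IsTypical M q sel x W) (n : ℕ) :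
    ∑ t ∈ Finset.range n, max (residual M q sel x t (pairAt M q sel x t) - (1 - q.γ) * q.ε / 2) 0 ≤
      60000 * (q.S * q.A * q.H ^ 4 * q.B * q.ι / q.ε) := by
  have he := hq.eChk_isStageSeq
  have hH := hq.one_le_H_cast
  have hB := hq.one_le_B
  have hG := Params.IsValid.horizon_le_H (q := q)
  have hι := hq.half_lt_ι
  have hS1 : (1 : ℝ) ≤ q.S := by exact_mod_cast hq.S_pos
  have hA1 : (1 : ℝ) ≤ q.A := by exact_mod_cast hq.A_pos
  have hg := hq.one_sub_pos
  have hε := hq.ε_pos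
  have hεH := hq.ε_le_H
  have hεG := hq.ε_le
  have hBH : q.B * q.B = q.H := Real.mul_self_sqrt (by positivity)
  set G : ℝ := 1 / (1 - q.γ) with hGdef
  have hG0 : 0 < G := hq.horizon_pos
  set β : ℝ := (1 - q.γ) * q.ε / 4 with hβdef
  have hβ : 0 < β := by positivity
  have hβ1 : β ≤ 1 := by
    rw [le_div_iff₀ hg] at hεG
    linarith
  have hβH : q.ε / (4 * q.H) ≤ β := by
    rw [div_le_iff₀ (by positivity)]
    nlinarith [hq.one_le_one_sub_mul_H]
  have h2β : (1 - q.γ) * q.ε / 2 = 2 * β := by rw [hβdef]; ring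
  rw [h2β]
  -- the decrease of `P V` at `z` is that of `P (V - W)`, a nonnegative antitone sequence
  set ρ : 𝒮 × 𝒜 → ℕ → ℝ := fun z t =>
    max (M.next z.1 z.2 (vTable M q sel x t) - M.next z.1 z.2 W - β) 0 with hρ
  have hρ0 : ∀ z t, 0 ≤ ρ z t := fun z t => le_max_right _ _
  have hρG : ∀ z t, ρ z t ≤ G := fun z t => by
    have h1 := MDP.next_le (M := M) z.1 z.2 (vTable_le (M := M) (sel := sel) (x := x) hq t)
    have h2 := MDP.next_nonneg (M := M) z.1 z.2 hW.nonneg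
    exact max_le (by linarith) hG0.le
  have hnext : ∀ (z : 𝒮 × 𝒜) {t u : ℕ}, t ≤ u →
      M.next z.1 z.2 (vTable M q sel x u) ≤ M.next z.1 z.2 (vTable M q sel x t) :=
    fun z t u htu => MDP.next_mono _ _ fun y => vTable_antitone hq y htu
  have hρa : ∀ (z : 𝒮 × 𝒜) {t u : ℕ}, t ≤ u → ρ z u ≤ ρ z t := fun z t u htu =>
    max_le_max (sub_le_sub_right (sub_le_sub_right (hnext z htu) _) _) le_rfl
  have h1 := sum_time_le_sum_activeVisits (M := M) (sel := sel) (x := x) hq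
    (fun z _ t => max (residual M q sel x t z - 2 * β) 0) n (by
      intro t _ h
      have h2 := (vTable_sub_le_quarter_of_isCapped hq hS hA hc hsel hW hx h).2
      have h3 := MDP.next_mono (M := M) (pairAt M q sel x t).1 (pairAt M q sel x t).2
        (le_vTable hq hW hx t)
      have h4 := mul_le_mul_of_nonneg_left h3 hq.γ_pos.le
      refine max_le ?_ le_rfl
      unfold backup at h2
      unfold residual
      linarith)
  refine h1.trans ?_
  have hper : ∀ z : 𝒮 × 𝒜, ∑ k ∈ Finset.range (activeVisits M q sel x z n),
      max (residual M q sel x (visitTime (pairAt M q sel x) z k) z - 2 * β) 0 ≤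
      q.H * G + 576 * q.H ^ 3 * q.B * q.ι / β + 3 * q.H * G + 6 / (q.H * q.B) *
        ∑ i ∈ Finset.range (activeVisits M q sel x z n),
          ρ z (visitTime (pairAt M q sel x) z i) := by
    intro z
    set K := activeVisits M q sel x z n with hK
    set D : ℕ → ℝ := fun k =>
      max (residual M q sel x (visitTime (pairAt M q sel x) z k) z - 2 * β) 0 with hD
    have hD0 : ∀ k, 0 ≤ D k := fun k => le_max_right _ _
    have hDG : ∀ k, D k ≤ G := fun k => by
      have h2 := qTable_le (M := M) (sel := sel) (x := x) hq (visitTime (pairAt M q sel x) z k) z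
      have h3 := M.r_nonneg z.1 z.2
      have h4 := mul_nonneg hq.γ_pos.le (MDP.next_nonneg (M := M) z.1 z.2
        (vTable_nonneg (M := M) (sel := sel) (x := x) hq (visitTime (pairAt M q sel x) z k)))
      refine max_le ?_ hG0.le
      unfold residual
      linarith
    have h2 : ∑ k ∈ Finset.range K, D k ≤
        ∑ k ∈ Finset.range q.H, D k + ∑ k ∈ Finset.Ico q.H K, D k := by
      rcases le_total q.H K with h | h
      · rw [Finset.sum_range_add_sum_Ico _ h]
      · rw [Finset.Ico_eq_empty_of_le h, Finset.sum_empty, add_zero]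
        exact Finset.sum_le_sum_of_subset_of_nonneg (Finset.range_mono h) fun k _ _ => hD0 k
    have h3 : ∑ k ∈ Finset.range q.H, D k ≤ q.H * G := by
      refine (Finset.sum_le_sum fun k _ => hDG k).trans_eq ?_
      simp
    -- `ρ` along the visits to `z`, cut off to be antitone at all indices
    set σ : ℕ → ℝ := fun i => if i < K then ρ z (visitTime (pairAt M q sel x) z i) else 0 with hσ
    have hσ0 : ∀ i, 0 ≤ σ i := fun i => by
      simp only [hσ]; split_ifs
      · exact hρ0 _ _
      · exact le_rfl
    have hmono : ∀ {i l : ℕ}, i ≤ l → l < K →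
        visitTime (pairAt M q sel x) z i ≤ visitTime (pairAt M q sel x) z l := fun {i l} hil hl => by
      rcases hil.eq_or_lt with rfl | hil
      · exact le_rfl
      · exact (visitTime_lt_visitTime hil ((lt_activeVisits hq).1 hl).1).le
    have hσa : Antitone σ := fun i l hil => by
      simp only [hσ]
      split_ifs with hl hi hi
      · exact hρa z (hmono hil hl)
      · omega
      · exact hρ0 _ _
      · exact le_rfl
    have h4 : ∑ k ∈ Finset.Ico q.H K, D k ≤ ∑ k ∈ Finset.Ico q.H K,
        (max (2 * q.bonus (q.eChk (stagesDone q.eChk k)) - β) 0 + (stageAvg q.eChk σ k - σ k)) := by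
      refine Finset.sum_le_sum fun k hk => ?_
      obtain ⟨k1, k2⟩ := Finset.mem_Ico.1 hk
      have h5 := residual_le hq hx k2 k1
      set α : ℕ → ℝ := fun i =>
        M.next z.1 z.2 (vTable M q sel x (visitTime (pairAt M q sel x) z i)) with hα
      have hα0 : M.next z.1 z.2 W ≤ α k := MDP.next_mono _ _ (le_vTable hq hW hx _)
      have h6 : 0 ≤ stageAvg q.eChk α k - α k := by
        rw [sub_nonneg]
        conv_lhs => rw [← he.stageAvg_const (α k) k1]
        exact IsStageSeq.stageAvg_mono fun i hi => hnext z (hmono hi.le k2)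
      have h7 : 0 ≤ stageAvg q.eChk σ k - σ k := by
        rw [sub_nonneg]
        conv_lhs => rw [← he.stageAvg_const (σ k) k1]
        exact IsStageSeq.stageAvg_mono fun i hi => hσa hi.le
      have h8 : stageAvg q.eChk α k ≤ stageAvg q.eChk σ k + (α k - σ k + β) := by
        conv_rhs => rw [← he.stageAvg_const (α k - σ k + β) k1, ← IsStageSeq.stageAvg_add]
        refine IsStageSeq.stageAvg_mono fun i hi => ?_
        simp only [hσ, if_pos k2, if_pos (hi.trans k2), hρ]
        have h9 : α k ≤ α i := hnext z (hmono hi.le k2)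
        change α i ≤ max (α i - M.next z.1 z.2 W - β) 0 +
          (α k - max (α k - M.next z.1 z.2 W - β) 0 + β)
        have h10 := le_max_left (α i - M.next z.1 z.2 W - β) 0
        rcases le_total (α k - M.next z.1 z.2 W - β) 0 with h | h
        · rw [max_eq_right h]; linarith
        · rw [max_eq_left h]; linarith
      have h11 : q.γ * (stageAvg q.eChk α k - α k) ≤ stageAvg q.eChk α k - α k :=
        mul_le_of_le_one_left h6 hq.γ_lt.le
      have h12 := le_max_left (2 * q.bonus (q.eChk (stagesDone q.eChk k)) - β) 0
      exact max_le (by linarith) (add_nonneg (le_max_right _ _) h7)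
    rw [Finset.sum_add_distrib] at h4
    have h13 := IsStageSeq.sum_bonus_le he (by linarith) hβ K
    have h14 := he.sum_stageAvg_sub_le hσ0 hσa K
    have h15 : ∑ i ∈ Finset.range K, σ i =
        ∑ i ∈ Finset.range K, ρ z (visitTime (pairAt M q sel x) z i) :=
      Finset.sum_congr rfl fun i hi => if_pos (Finset.mem_range.1 hi)
    have h16 : σ 0 ≤ G := by
      simp only [hσ]; split_ifs
      · exact hρG _ _
      · exact hG0.le
    rw [h15] at h14
    have h17 : 3 * (q.H : ℝ) * σ 0 ≤ 3 * q.H * G := by gcongr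
    linarith
  have hsum := Finset.sum_le_sum fun z (_ : z ∈ Finset.univ) => hper z
  rw [Finset.sum_add_distrib, Finset.sum_const, Finset.card_univ, Fintype.card_prod,
    ← Finset.mul_sum, nsmul_eq_mul, Nat.cast_mul, ← hS, ← hA] at hsum
  have hZ : ∑ z, ∑ i ∈ Finset.range (activeVisits M q sel x z n),
      ρ z (visitTime (pairAt M q sel x) z i) ≤
      2 * (1164 * (q.S * q.A * q.H ^ 5 * q.ι / β) + (q.S + 1) * q.H) + 2 * q.H * q.ι := by
    have h2 : ∑ z, ∑ i ∈ Finset.range (activeVisits M q sel x z n),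
        ρ z (visitTime (pairAt M q sel x) z i) ≤
        ∑ t ∈ Finset.range n, ρ (pairAt M q sel x t) t := by
      rw [sum_time_eq_sum_visits (ζ := pairAt M q sel x) (fun z _ t => ρ z t) n]
      exact Finset.sum_le_sum fun z _ => Finset.sum_le_sum_of_subset_of_nonneg
        (Finset.range_mono (min_le_left _ _)) fun k _ _ => hρ0 _ _
    have h3 : ∑ t ∈ Finset.range n, ρ (pairAt M q sel x t) t ≤ ∑ t ∈ Finset.range n,
        M.next (x t) (policy M q sel x t (x t)) (excess M q sel x W t) := by
      refine Finset.sum_le_sum fun t _ => ?_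
      have := MDP.max_next_sub_le (M := M) (x t) (policy M q sel x t (x t))
        (fun s => vTable M q sel x t s - W s) β
      rw [MDP.next_sub] at this
      exact this
    have h4 := hx.excess_sum n
    have h5 := (sum_max_qTable_sub_backup_le hq hS hA hsel hW hx hβ hβ1 n fun t _ h =>
      (vTable_sub_le_quarter_of_isCapped hq hS hA hc hsel hW hx h).1).2
    have h6 : ∑ t ∈ Finset.range n, excess M q sel x W t (x (t + 1)) =
      ∑ t ∈ Finset.range n, max (vTable M q sel x t (x (t + 1)) - W (x (t + 1)) - β) 0 := rfl
    rw [h6] at h4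
    have h7 : 2 * G * q.ι ≤ 2 * q.H * q.ι := by gcongr
    linarith
  refine hsum.trans ?_
  have hκ : 0 ≤ 6 / ((q.H : ℝ) * q.B) := by positivity
  refine (add_le_add_right (mul_le_mul_of_nonneg_left hZ hκ) _).trans ?_
  exact residual_bound_le hS1 hA1 hH hB hBH hι hε hεH hG hβH

end Residual

section Count

variable {𝒮 𝒜 : Type*} [Fintype 𝒮] [Fintype 𝒜] [Nonempty 𝒜] {M : MDP 𝒮 𝒜} {q : Params}
  {sel : 𝒮 → (𝒜 → ℝ) → 𝒜} {x : ℕ → 𝒮} {W : 𝒮 → ℝ}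

omit [Fintype 𝒜] [Nonempty 𝒜] in
theorem gap_nonneg (t : ℕ) (s : 𝒮) : 0 ≤ gap M q sel x t s := le_max_right _ _

omit [Fintype 𝒜] in
theorem gap_le (hq : q.IsValid) (t : ℕ) (s : 𝒮) : gap M q sel x t s ≤ 1 / (1 - q.γ) := by
  have h1 := vTable_le (M := M) (sel := sel) (x := x) hq t s
  have h2 := MDP.value_nonneg (M := M) hq.γ_pos (policy M q sel x t) s
  have h3 := hq.ε_pos
  exact max_le (by linarith) hq.horizon_pos.le

omit [Fintype 𝒜] [Nonempty 𝒜] in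
theorem gap_congr {t u : ℕ} (h : (memory M q sel x t).Q = (memory M q sel x u).Q) :
    gap M q sel x t = gap M q sel x u := by
  have h1 : vTable M q sel x t = vTable M q sel x u := by
    funext s; simp only [vTable, Memory.V, h]
  have h2 : policy M q sel x t = policy M q sel x u := by
    funext s; simp only [policy, Memory.greedy, h]
  funext s
  simp only [gap, h1, h2]

/-- The clipped regret bound satisfies a Bellman inequality with the clipped residual as reward. -/
theorem gap_path_le (hq : q.IsValid) (hsel : ∀ (s : 𝒮) (f : 𝒜 → ℝ) (a : 𝒜), f a ≤ f (sel s f))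
    (t : ℕ) :
    gap M q sel x t (x t) ≤
      max (residual M q sel x t (pairAt M q sel x t) - (1 - q.γ) * q.ε / 2) 0 +
        q.γ * M.next (x t) (policy M q sel x t (x t)) (gap M q sel x t) := by
  have h1 := MDP.max_next_sub_le (M := M) (x t) (policy M q sel x t (x t))
    (fun s => vTable M q sel x t s - M.value q.γ (policy M q sel x t) s) (q.ε / 2)
  have h2 := (le_max_left _ _).trans h1
  rw [MDP.next_sub] at h2
  have h3 := mul_le_mul_of_nonneg_left h2 hq.γ_pos.le
  have h4 := MDP.value_eq (M := M) hq.γ_pos hq.γ_lt (policy M q sel x t) (x t)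
  have h5 := vTable_path_eq (M := M) (q := q) (x := x) hsel t
  have h6 : residual M q sel x t (pairAt M q sel x t) = qTable M q sel x t (pairAt M q sel x t) -
    M.r (x t) (policy M q sel x t (x t)) -
      q.γ * M.next (x t) (policy M q sel x t (x t)) (vTable M q sel x t) := rfl
  have h7 := le_max_left (residual M q sel x t (pairAt M q sel x t) - (1 - q.γ) * q.ε / 2) 0
  have h8 : 0 ≤ M.next (x t) (policy M q sel x t (x t)) (gap M q sel x t) :=
    MDP.next_nonneg _ _ fun s => gap_nonneg t s
  refine max_le ?_ (add_nonneg (le_max_right _ _) (mul_nonneg hq.γ_pos.le h8))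
  have h9 : q.γ * M.next (x t) (policy M q sel x t (x t)) (fun y => max (vTable M q sel x t y -
      M.value q.γ (policy M q sel x t) y - q.ε / 2) 0) =
      q.γ * M.next (x t) (policy M q sel x t (x t)) (gap M q sel x t) := rfl
  rw [h9] at h3
  have h10 : M.next (x t) (policy M q sel x t (x t)) (fun y => M.value q.γ (policy M q sel x t) y) =
    M.next (x t) (policy M q sel x t (x t)) (M.value q.γ (policy M q sel x t)) := rfl
  have h11 : M.next (x t) (policy M q sel x t (x t)) (fun y => vTable M q sel x t y) =
    M.next (x t) (policy M q sel x t (x t)) (vTable M q sel x t) := rfl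
  rw [h10, h11] at h3
  rw [h5, h4]
  linarith

open Classical in
/-- Number of steps with a suboptimal policy along a typical path. -/
theorem card_suboptimal_le (hq : q.IsValid) (hS : q.S = Fintype.card 𝒮)
    (hA : q.A = Fintype.card 𝒜) (hc : capConstant ≤ q.c₁)
    (hsel : ∀ (s : 𝒮) (f : 𝒜 → ℝ) (a : 𝒜), f a ≤ f (sel s f))
    (hW : MDP.IsBellmanSolution M q.γ W) (hx : IsTypical M q sel x W) (n : ℕ) :
    (((Finset.range n).filter fun t =>
      M.optValue q.γ (x t) - M.value q.γ (policy M q sel x t) (x t) > q.ε).card : ℝ) ≤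
    4 * q.H / q.ε * (60000 * (q.S * q.A * q.H ^ 4 * q.B * q.ι / q.ε) +
      q.H * (q.S * q.A * (q.JChk + q.JBar) + 1) + 4 * q.H ^ 2 * q.ι) := by
  have hG := Params.IsValid.horizon_le_H (q := q)
  have hι := hq.half_lt_ι
  have hg := hq.one_sub_pos
  have hε := hq.ε_pos
  set G : ℝ := 1 / (1 - q.γ) with hGdef
  have hG0 : 0 < G := hq.horizon_pos
  set Y := ∑ t ∈ Finset.range n, gap M q sel x t (x t) with hY
  set U : ℝ := (((Finset.range n).filter fun t =>
      (memory M q sel x (t + 1)).Q ≠ (memory M q sel x t).Q).card : ℝ) with hU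
  have hU1 : U ≤ q.S * q.A * (q.JChk + q.JBar) := by
    rw [hS, hA]; exact card_updates_le hq n
  have h1 : Y ≤ ∑ t ∈ Finset.range n,
      max (residual M q sel x t (pairAt M q sel x t) - (1 - q.γ) * q.ε / 2) 0 +
      q.γ * ∑ t ∈ Finset.range n, M.next (x t) (policy M q sel x t (x t)) (gap M q sel x t) := by
    rw [Finset.mul_sum, ← Finset.sum_add_distrib]
    exact Finset.sum_le_sum fun t _ => gap_path_le hq hsel t
  have h2 := sum_residual_le hq hS hA hc hsel hW hx n
  have h3 := hx.gap_sum n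
  -- the functions `gap` change only when the action values are updated
  have h4 : ∑ t ∈ Finset.range n, gap M q sel x t (x (t + 1)) ≤ Y + G + G * U := by
    have h5 : ∑ t ∈ Finset.range n, gap M q sel x t (x (t + 1)) ≤
        ∑ t ∈ Finset.range n, (gap M q sel x (t + 1) (x (t + 1)) +
          G * if (memory M q sel x (t + 1)).Q ≠ (memory M q sel x t).Q then 1 else 0) := by
      refine Finset.sum_le_sum fun t _ => ?_
      split_ifs with h
      · have := gap_le (M := M) (sel := sel) (x := x) hq t (x (t + 1))
        have := gap_nonneg (M := M) (q := q) (sel := sel) (x := x) (t + 1) (x (t + 1))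
        linarith
      · rw [gap_congr (not_ne_iff.1 h)]; simp
    rw [Finset.sum_add_distrib, ← Finset.mul_sum, Finset.sum_boole] at h5
    have h6 : ∑ t ∈ Finset.range n, gap M q sel x (t + 1) (x (t + 1)) - Y =
        gap M q sel x n (x n) - gap M q sel x 0 (x 0) := by
      rw [hY, ← Finset.sum_sub_distrib]
      exact Finset.sum_range_sub (fun t => gap M q sel x t (x t)) n
    have h7 := gap_le (M := M) (sel := sel) (x := x) hq n (x n)
    have h8 := gap_nonneg (M := M) (q := q) (sel := sel) (x := x) 0 (x 0)
    linarith
  have hY0 : 0 ≤ Y := Finset.sum_nonneg fun t _ => gap_nonneg t _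
  have hU0 : 0 ≤ U := Nat.cast_nonneg _
  set R := ∑ t ∈ Finset.range n,
      max (residual M q sel x t (pairAt M q sel x t) - (1 - q.γ) * q.ε / 2) 0 with hR
  have h5 : (1 - q.γ) / 2 * Y ≤ R + G * (U + 1) + 4 * G ^ 2 * q.ι := by
    have h6 := mul_le_mul_of_nonneg_left h3 hq.γ_pos.le
    have h7 : (1 + (1 - q.γ) / 2) * ∑ t ∈ Finset.range n, gap M q sel x t (x (t + 1)) ≤
        (1 + (1 - q.γ) / 2) * (Y + G + G * U) := mul_le_mul_of_nonneg_left h4 (by linarith)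
    have h8 := mul_le_mul_of_nonneg_left h7 hq.γ_pos.le
    have h9 : q.γ * ((1 + (1 - q.γ) / 2) * (Y + G + G * U)) ≤
        (1 - (1 - q.γ) / 2) * (Y + G + G * U) := by
      rw [← mul_assoc]
      refine mul_le_mul_of_nonneg_right ?_ (by positivity)
      nlinarith [hq.γ_pos, hq.γ_lt]
    have h10 : q.γ * (4 * G ^ 2 * q.ι) ≤ 4 * G ^ 2 * q.ι :=
      mul_le_of_le_one_left (by positivity) hq.γ_lt.le
    have h11 : 0 ≤ (1 - q.γ) / 2 * (G + G * U) := by positivity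
    linarith
  have h6 : (((Finset.range n).filter fun t =>
      M.optValue q.γ (x t) - M.value q.γ (policy M q sel x t) (x t) > q.ε).card : ℝ) * (q.ε / 2) ≤
      Y := by
    rw [← nsmul_eq_mul, ← Finset.sum_const, Finset.sum_filter]
    refine Finset.sum_le_sum fun t _ => ?_
    split_ifs with h
    · have h7 := hW.optValue_le hq.γ_pos hq.γ_lt (x t)
      have h8 := le_vTable hq hW hx t (x t)
      exact le_max_of_le_left (by linarith)
    · exact gap_nonneg t _
  have h7 : Y = 2 * G * ((1 - q.γ) / 2 * Y) := by
    have h8 : G * (1 - q.γ) = 1 := one_div_mul_cancel hg.ne'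
    linear_combination (-Y) * h8
  have h8 : Y ≤ 2 * (q.H : ℝ) * (60000 * (q.S * q.A * q.H ^ 4 * q.B * q.ι / q.ε) +
      q.H * (q.S * q.A * (q.JChk + q.JBar) + 1) + 4 * q.H ^ 2 * q.ι) := by
    rw [h7]
    have h9 : R + G * (U + 1) + 4 * G ^ 2 * q.ι ≤
        60000 * (q.S * q.A * q.H ^ 4 * q.B * q.ι / q.ε) +
        q.H * (q.S * q.A * (q.JChk + q.JBar) + 1) + 4 * q.H ^ 2 * q.ι := by
      refine add_le_add (add_le_add h2 ?_) ?_
      · exact mul_le_mul hG (by linarith) (by linarith) (Nat.cast_nonneg _)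
      · gcongr
    have h10 := h5.trans h9
    have h11 : 0 ≤ (1 - q.γ) / 2 * Y := by positivity
    exact mul_le_mul (by linarith) h10 h11 (by positivity)
  rw [div_mul_eq_mul_div, le_div_iff₀ hε]
  linarith

end Count

/-! ### Exponential supermartingales of the interaction -/

section Paths

variable {𝒮 𝒜 : Type*} [Fintype 𝒮] {M : MDP 𝒮 𝒜} {q : Params} {sel : 𝒮 → (𝒜 → ℝ) → 𝒜}

theorem memory_congr {x y : ℕ → 𝒮} {t : ℕ} (h : ∀ i ≤ t, x i = y i) :
    memory M q sel x t = memory M q sel y t := by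
  induction t with
  | zero => rfl
  | succ t ih =>
    have ih' := ih fun i hi => h i (by omega)
    simp only [memory_succ, policy, ih', h t (by omega), h (t + 1) le_rfl]

theorem policy_congr {x y : ℕ → 𝒮} {t : ℕ} (h : ∀ i ≤ t, x i = y i) :
    policy M q sel x t = policy M q sel y t := by
  unfold policy; rw [memory_congr h]

theorem vTable_congr {x y : ℕ → 𝒮} {t : ℕ} (h : ∀ i ≤ t, x i = y i) :
    vTable M q sel x t = vTable M q sel y t := by
  funext s; rw [vTable, vTable, memory_congr h]

theorem pairAt_congr {x y : ℕ → 𝒮} {t : ℕ} (h : ∀ i ≤ t, x i = y i) :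
    pairAt M q sel x t = pairAt M q sel y t := by
  unfold pairAt; rw [policy_congr h, h t le_rfl]

theorem visits_congr {x y : ℕ → 𝒮} {t : ℕ} (h : ∀ i ≤ t, x i = y i) (z : 𝒮 × 𝒜) :
    visits (pairAt M q sel x) z t = visits (pairAt M q sel y) z t := by
  induction t with
  | zero => simp
  | succ t ih =>
    have ih' := ih fun i hi => h i (by omega)
    have hp : pairAt M q sel x t = pairAt M q sel y t := pairAt_congr fun i hi => h i (by omega)
    by_cases hz : pairAt M q sel x t = z
    · rw [visits_succ_of_eq hz, visits_succ_of_eq (hp ▸ hz), ih']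
    · rw [visits_succ_of_ne hz, visits_succ_of_ne (hp ▸ hz), ih']

/-- The infinite path that follows `v` and then stays at its last state. -/
def extendPath (n : ℕ) (v : Fin (n + 1) → 𝒮) (i : ℕ) : 𝒮 := v ⟨min i n, by omega⟩

omit [Fintype 𝒮] in
theorem extendPath_snoc_of_le {n : ℕ} (v : Fin (n + 1) → 𝒮) (s : 𝒮) {i : ℕ} (h : i ≤ n) :
    extendPath (n + 1) (Fin.snoc v s : Fin (n + 2) → 𝒮) i = extendPath n v i := by
  have h1 : (⟨min i (n + 1), by omega⟩ : Fin (n + 2)) = Fin.castSucc ⟨min i n, by omega⟩ := by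
    apply Fin.ext
    simp only [Fin.val_castSucc]
    omega
  unfold extendPath
  rw [h1, Fin.snoc_castSucc (α := fun _ => 𝒮)]

omit [Fintype 𝒮] in
theorem extendPath_snoc_last {n : ℕ} (v : Fin (n + 1) → 𝒮) (s : 𝒮) :
    extendPath (n + 1) (Fin.snoc v s : Fin (n + 2) → 𝒮) (n + 1) = s := by
  have h1 : (⟨min (n + 1) (n + 1), by omega⟩ : Fin (n + 2)) = Fin.last (n + 1) := by
    apply Fin.ext
    simp
  unfold extendPath
  rw [h1, Fin.snoc_last (α := fun _ => 𝒮)]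

/-- The sum of the increments `ξ u` along the first `n` transitions of a path. -/
noncomputable def pathSum (ξ : ℕ → (ℕ → 𝒮) → 𝒮 → ℝ) (n : ℕ) (x : ℕ → 𝒮) : ℝ :=
  ∑ u ∈ Finset.range n, ξ u x (x (u + 1))

omit [Fintype 𝒮] in
theorem pathSum_congr {ξ : ℕ → (ℕ → 𝒮) → 𝒮 → ℝ} (hξ : ∀ u, DependsOn (ξ u) (Set.Iic u)) {n : ℕ}
    {x y : ℕ → 𝒮} (h : ∀ i ≤ n, x i = y i) : pathSum ξ n x = pathSum ξ n y := by
  refine Finset.sum_congr rfl fun u hu => ?_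
  have hu' := Finset.mem_range.1 hu
  rw [hξ u fun i (hi : i ≤ u) => h i (by omega), h (u + 1) (by omega)]

variable (M q sel) in
/-- The increments `ξ u` are determined by the path up to time `u` and the next state, and
`exp (ξ u)` has conditional expectation at most `1`. -/
structure IsExpSupermartingale (ξ : ℕ → (ℕ → 𝒮) → 𝒮 → ℝ) : Prop where
  dependsOn : ∀ u, DependsOn (ξ u) (Set.Iic u)
  next_le_one : ∀ u x, M.next (x u) (policy M q sel x u (x u)) (fun s => Real.exp (ξ u x s)) ≤ 1

variable {Ω : Type*} [MeasurableSpace Ω] {μ : MeasureTheory.Measure Ω}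
  [MeasureTheory.IsProbabilityMeasure μ] {X : ℕ → Ω → 𝒮}

/-- The event that the path follows `v`. -/
def cylinder (X : ℕ → Ω → 𝒮) (n : ℕ) (v : Fin (n + 1) → 𝒮) : Set Ω :=
  {ω | ∀ i ≤ n, X i ω = extendPath n v i}

theorem sum_cylinder_le (hX : ∀ t s, MeasurableSet {ω | X t ω = s}) (n : ℕ) :
    ∑ v : Fin (n + 1) → 𝒮, μ.real (cylinder X n v) ≤ 1 := by
  have hm : ∀ v, MeasurableSet (cylinder X n v) := fun v => by
    have : cylinder X n v = ⋂ i ∈ Set.Iic n, {ω | X i ω = extendPath n v i} := by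
      ext ω; simp [cylinder]
    rw [this]
    exact MeasurableSet.biInter (Set.to_countable _) fun i _ => hX i _
  have hd : Pairwise (Function.onFun Disjoint (cylinder X n)) := fun v w hvw => by
    rw [Function.onFun, Set.disjoint_left]
    intro ω hv hw
    apply hvw
    funext i
    have h1 : extendPath n v i = extendPath n w i := by
      rw [← hv i (by omega), ← hw i (by omega)]
    have h2 : (⟨min (i : ℕ) n, by omega⟩ : Fin (n + 1)) = i := by
      apply Fin.ext
      simp only
      omega
    unfold extendPath at h1
    rwa [h2] at h1
  rw [← MeasureTheory.measureReal_iUnion_fintype hd hm]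
  exact MeasureTheory.measureReal_le_one

theorem sum_cylinder_mul_exp_le (hX : IsInteraction M q sel μ X)
    {ξ : ℕ → (ℕ → 𝒮) → 𝒮 → ℝ} (hξ : IsExpSupermartingale M q sel ξ) (n : ℕ) :
    ∑ v : Fin (n + 1) → 𝒮, μ.real (cylinder X n v) * Real.exp (pathSum ξ n (extendPath n v)) ≤ 1 := by
  induction n with
  | zero => simpa [pathSum] using sum_cylinder_le (μ := μ) hX.measurable 0
  | succ n ih =>
    refine le_trans ?_ ih
    rw [← (Fin.snocEquiv fun _ => 𝒮).sum_comp, Fintype.sum_prod_type, Finset.sum_comm]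
    refine Finset.sum_le_sum fun v _ => ?_
    set y := extendPath n v with hy
    have h1 : ∀ s : 𝒮, μ.real (cylinder X (n + 1) (Fin.snoc v s : Fin (n + 2) → 𝒮)) *
        Real.exp (pathSum ξ (n + 1) (extendPath (n + 1) (Fin.snoc v s : Fin (n + 2) → 𝒮))) =
        μ.real (cylinder X n v) * Real.exp (pathSum ξ n y) *
          (M.P (y n) (policy M q sel y n (y n)) s * Real.exp (ξ n y s)) := by
      intro s
      set y' := extendPath (n + 1) (Fin.snoc v s : Fin (n + 2) → 𝒮) with hy'
      have hyy : ∀ i ≤ n, y' i = y i := fun i hi => extendPath_snoc_of_le v s hi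
      have hys : y' (n + 1) = s := extendPath_snoc_last v s
      have h2 : pathSum ξ (n + 1) y' = pathSum ξ n y + ξ n y s := by
        rw [pathSum, Finset.sum_range_succ, hys, hξ.dependsOn n fun i hi => hyy i hi]
        exact congrArg (· + _) (pathSum_congr hξ.dependsOn hyy)
      have h3 : μ.real (cylinder X (n + 1) (Fin.snoc v s : Fin (n + 2) → 𝒮)) =
          μ.real (cylinder X n v) * M.P (y n) (policy M q sel y n (y n)) s := by
        have h4 := hX.transition n y'
        have h5 : {ω | ∀ i ≤ n, X i ω = y' i} = cylinder X n v := by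
          ext ω
          exact forall₂_congr fun i hi => by rw [hyy i hi]
        rw [h5, policy_congr hyy, hyy n le_rfl, hys] at h4
        have h6 := congrArg ENNReal.toReal h4
        rw [ENNReal.toReal_mul, ENNReal.toReal_ofReal (M.P_nonneg _ _ _)] at h6
        exact h6
      rw [h2, h3, Real.exp_add]
      ring
    calc _ = ∑ s, μ.real (cylinder X n v) * Real.exp (pathSum ξ n y) *
          (M.P (y n) (policy M q sel y n (y n)) s * Real.exp (ξ n y s)) :=
          Finset.sum_congr rfl fun s _ => h1 s
      _ ≤ _ := by
        rw [← Finset.mul_sum]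
        exact mul_le_of_le_one_right (by positivity) (hξ.next_le_one n y)

/-- Markov's inequality for an exponential supermartingale. -/
theorem measure_le_pathSum_le (hX : IsInteraction M q sel μ X)
    {ξ : ℕ → (ℕ → 𝒮) → 𝒮 → ℝ} (hξ : IsExpSupermartingale M q sel ξ) (n : ℕ) (c : ℝ) :
    μ {ω | c ≤ pathSum ξ n fun t => X t ω} ≤ ENNReal.ofReal (Real.exp (-c)) := by
  classical
  have h1 : {ω | c ≤ pathSum ξ n fun t => X t ω} ⊆
      ⋃ v ∈ Finset.univ.filter fun v => c ≤ pathSum ξ n (extendPath n v), cylinder X n v := by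
    intro ω hω
    have h2 : ∀ i ≤ n, X i ω = extendPath n (fun i : Fin (n + 1) => X i ω) i := fun i hi => by
      simp only [extendPath, min_eq_left hi]
    refine Set.mem_biUnion (x := fun i : Fin (n + 1) => X i ω) ?_ h2
    refine Finset.mem_coe.2 (Finset.mem_filter.2 ⟨Finset.mem_univ _, ?_⟩)
    rw [← pathSum_congr hξ.dependsOn h2]
    exact hω
  refine (MeasureTheory.measure_mono h1).trans ((MeasureTheory.measure_biUnion_finset_le _ _).trans ?_)
  have h3 : ∀ v, μ (cylinder X n v) = ENNReal.ofReal (μ.real (cylinder X n v)) := fun v =>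
    (ENNReal.ofReal_toReal (MeasureTheory.measure_ne_top _ _)).symm
  simp_rw [h3]
  rw [← ENNReal.ofReal_sum_of_nonneg fun v _ => MeasureTheory.measureReal_nonneg]
  refine ENNReal.ofReal_le_ofReal ?_
  calc _ ≤ ∑ v ∈ Finset.univ.filter fun v => c ≤ pathSum ξ n (extendPath n v),
        Real.exp (-c) * (μ.real (cylinder X n v) * Real.exp (pathSum ξ n (extendPath n v))) := by
        refine Finset.sum_le_sum fun v hv => ?_
        have h4 : 1 ≤ Real.exp (-c) * Real.exp (pathSum ξ n (extendPath n v)) := by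
          rw [← Real.exp_add]
          exact Real.one_le_exp (by linarith [(Finset.mem_filter.1 hv).2])
        have h5 : 0 ≤ μ.real (cylinder X n v) := MeasureTheory.measureReal_nonneg
        nlinarith
    _ ≤ ∑ v, Real.exp (-c) * (μ.real (cylinder X n v) * Real.exp (pathSum ξ n (extendPath n v))) :=
        Finset.sum_le_sum_of_subset_of_nonneg (Finset.filter_subset _ _) fun v _ _ => by positivity
    _ ≤ _ := by
        rw [← Finset.mul_sum]
        exact mul_le_of_le_one_right (Real.exp_pos _).le (sum_cylinder_mul_exp_le hX hξ n)

/-- Ville's maximal inequality, obtained from Markov's by stopping the supermartingale when it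
first reaches the level `c`. -/
theorem measure_exists_le_pathSum_le (hX : IsInteraction M q sel μ X)
    {ξ : ℕ → (ℕ → 𝒮) → 𝒮 → ℝ} (hξ : IsExpSupermartingale M q sel ξ) (c : ℝ) :
    μ {ω | ∃ n, c ≤ pathSum ξ n fun t => X t ω} ≤ ENNReal.ofReal (Real.exp (-c)) := by
  classical
  let ξ' : ℕ → (ℕ → 𝒮) → 𝒮 → ℝ := fun u x s => if ∀ k ≤ u, pathSum ξ k x < c then ξ u x s else 0
  have hξ' : IsExpSupermartingale M q sel ξ' := by
    refine ⟨fun u x y h => ?_, fun u x => ?_⟩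
    · have h1 : (∀ k ≤ u, pathSum ξ k x < c) ↔ ∀ k ≤ u, pathSum ξ k y < c :=
        forall₂_congr fun k hk => by
          rw [pathSum_congr hξ.dependsOn fun i hi => h i (show i ≤ u by omega)]
      funext s
      simp only [ξ', h1, hξ.dependsOn u h]
    · by_cases h : ∀ k ≤ u, pathSum ξ k x < c
      · simp only [ξ', if_pos h]; exact hξ.next_le_one u x
      · simp only [ξ', if_neg h, Real.exp_zero]
        exact (MDP.next_const _ _ 1).le
  have hfrozen : ∀ x n, ((∀ k ≤ n, pathSum ξ k x < c) → pathSum ξ' n x = pathSum ξ n x) ∧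
      ((∃ k ≤ n, c ≤ pathSum ξ k x) → c ≤ pathSum ξ' n x) := by
    intro x n
    induction n with
    | zero =>
      refine ⟨fun _ => by simp [pathSum], ?_⟩
      rintro ⟨k, hk, h⟩
      obtain rfl : k = 0 := by omega
      simpa [pathSum] using h
    | succ n ih =>
      have hs : ∀ ζ : ℕ → (ℕ → 𝒮) → 𝒮 → ℝ, pathSum ζ (n + 1) x = pathSum ζ n x + ζ n x (x (n + 1)) :=
        fun ζ => Finset.sum_range_succ _ _
      by_cases h : ∀ k ≤ n, pathSum ξ k x < c
      · have h1 : pathSum ξ' (n + 1) x = pathSum ξ (n + 1) x := by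
          rw [hs, hs, ih.1 h]
          simp only [ξ', if_pos h]
        refine ⟨fun _ => h1, ?_⟩
        rintro ⟨k, hk, hk'⟩
        rcases Nat.lt_or_ge n k with h2 | h2
        · obtain rfl : k = n + 1 := by omega
          rwa [h1]
        · exact absurd hk' (not_le.2 (h k h2))
      · have h1 : pathSum ξ' (n + 1) x = pathSum ξ' n x := by
          rw [hs]
          simp only [ξ', if_neg h, add_zero]
        refine ⟨fun h2 => absurd (fun k hk => h2 k (by omega)) h, fun _ => ?_⟩
        rw [h1]
        push Not at h
        exact ih.2 h
  have hun : {ω | ∃ n, c ≤ pathSum ξ n fun t => X t ω} =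
      ⋃ n, {ω | ∃ k ≤ n, c ≤ pathSum ξ k fun t => X t ω} := by
    ext ω
    simp only [Set.mem_ofPred_eq, Set.mem_iUnion]
    exact ⟨fun ⟨n, h⟩ => ⟨n, n, le_rfl, h⟩, fun ⟨_, k, _, h⟩ => ⟨k, h⟩⟩
  have hmono : Monotone fun n => {ω | ∃ k ≤ n, c ≤ pathSum ξ k fun t => X t ω} :=
    fun n m hnm ω ⟨k, hk, h⟩ => ⟨k, hk.trans hnm, h⟩
  rw [hun, hmono.measure_iUnion]
  refine iSup_le fun n => ?_
  refine (MeasureTheory.measure_mono ?_).trans (measure_le_pathSum_le hX hξ' n c)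
  exact fun ω h => (hfrozen _ n).2 h

end Paths

/-! ### Moment generating functions -/

section Moments

theorem exp_le_add_exp_sq (y : ℝ) : Real.exp y ≤ y + Real.exp (y ^ 2) := by
  have h1 := Real.add_one_le_exp (y ^ 2)
  rcases le_or_gt |y| 1 with h | h
  · have h2 := (abs_le.1 (Real.abs_exp_sub_one_sub_id_le h)).2
    linarith
  · rcases lt_abs.1 h with h | h
    · have : Real.exp y ≤ Real.exp (y ^ 2) := Real.exp_le_exp.2 (by nlinarith)
      linarith
    · have : Real.exp y ≤ 1 := Real.exp_le_one_iff.2 (by linarith)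
      nlinarith

variable {𝒮 𝒜 : Type*} [Fintype 𝒮] {M : MDP 𝒮 𝒜}

/-- Hoeffding's bound for one transition. -/
theorem next_exp_deviation_le (s : 𝒮) (a : 𝒜) {f : 𝒮 → ℝ} {c : ℝ} (l : ℝ)
    (hf : ∀ y, |f y - M.next s a f| ≤ c) :
    M.next s a (fun y => Real.exp (l * (f y - M.next s a f) - l ^ 2 * c ^ 2)) ≤ 1 := by
  have h1 : ∀ y, Real.exp (l * (f y - M.next s a f) - l ^ 2 * c ^ 2) ≤
      Real.exp (-(l ^ 2 * c ^ 2)) * (l * (f y - M.next s a f)) + 1 := fun y => by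
    have h2 := exp_le_add_exp_sq (l * (f y - M.next s a f))
    have h3 : Real.exp ((l * (f y - M.next s a f)) ^ 2) ≤ Real.exp (l ^ 2 * c ^ 2) := by
      rw [mul_pow]
      refine Real.exp_le_exp.2 (mul_le_mul_of_nonneg_left ?_ (sq_nonneg l))
      rw [← sq_abs]
      exact pow_le_pow_left₀ (abs_nonneg _) (hf y) 2
    have h4 : Real.exp (-(l ^ 2 * c ^ 2)) * Real.exp (l ^ 2 * c ^ 2) = 1 := by
      rw [← Real.exp_add]; simp
    rw [sub_eq_neg_add, Real.exp_add, ← h4, ← mul_add]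
    exact mul_le_mul_of_nonneg_left (by linarith) (Real.exp_pos _).le
  refine (MDP.next_mono s a h1).trans ?_
  rw [MDP.next_add, MDP.next_smul, MDP.next_smul, MDP.next_sub, MDP.next_const, MDP.next_const]
  simp

/-- One-sided multiplicative bound for one transition with nonnegative bounded values. -/
theorem next_exp_mul_le (s : 𝒮) (a : 𝒜) {f : 𝒮 → ℝ} {c η : ℝ} (hc : 0 < c) (hη : 0 < η)
    (h0 : ∀ y, 0 ≤ f y) (hf : ∀ y, f y ≤ c) :
    M.next s a (fun y => Real.exp (η / ((1 + η) * c) * (M.next s a f - (1 + η) * f y))) ≤ 1 := by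
  set m := M.next s a f with hm
  have h1 : ∀ y, Real.exp (η / ((1 + η) * c) * (m - (1 + η) * f y)) ≤
      Real.exp (η / ((1 + η) * c) * m) * (1 - η / ((1 + η) * c) * f y) := fun y => by
    have h2 : η / ((1 + η) * c) * (m - (1 + η) * f y) =
        η / ((1 + η) * c) * m + (f y / c) * (-η) := by field_simp; ring
    rw [h2, Real.exp_add]
    refine mul_le_mul_of_nonneg_left ?_ (Real.exp_pos _).le
    have hθ1 : f y / c ≤ 1 := (div_le_one hc).2 (hf y)
    have hθ0 : 0 ≤ f y / c := div_nonneg (h0 y) hc.le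
    have h3 := convexOn_exp.2 (Set.mem_univ (0 : ℝ)) (Set.mem_univ (-η)) (sub_nonneg.2 hθ1) hθ0
      (by ring)
    simp only [smul_eq_mul, mul_zero, zero_add, Real.exp_zero, mul_one] at h3
    have h4 : Real.exp (-η) ≤ 1 - η / (1 + η) := by
      have h5 : 1 - η / (1 + η) = (1 + η)⁻¹ := by field_simp; ring
      rw [h5, Real.exp_neg]
      exact inv_anti₀ (by linarith) (by linarith [Real.add_one_le_exp η])
    have h6 : η / ((1 + η) * c) * f y = f y / c * (η / (1 + η)) := by field_simp
    rw [h6]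
    nlinarith [mul_le_mul_of_nonneg_left h4 hθ0]
  refine (MDP.next_mono s a h1).trans ?_
  rw [MDP.next_smul, MDP.next_sub, MDP.next_const, MDP.next_smul, ← hm]
  calc _ ≤ Real.exp (η / ((1 + η) * c) * m) * Real.exp (-(η / ((1 + η) * c) * m)) := by
        gcongr
        linarith [Real.add_one_le_exp (-(η / ((1 + η) * c) * m))]
    _ = 1 := by rw [← Real.exp_add]; simp

end Moments

/-! ### Typical paths have high probability -/

section Probability

variable {𝒮 𝒜 : Type*} [Fintype 𝒮] {M : MDP 𝒮 𝒜} {q : Params} {sel : 𝒮 → (𝒜 → ℝ) → 𝒜}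
  {W : 𝒮 → ℝ} {Ω : Type*} [MeasurableSpace Ω] {μ : MeasureTheory.Measure Ω}
  [MeasureTheory.IsProbabilityMeasure μ] {X : ℕ → Ω → 𝒮}

theorem Params.IsValid.exp_neg_ι (hq : q.IsValid) : Real.exp (-q.ι) = q.δ / 2 := by
  rw [Params.ι, Real.exp_neg, Real.exp_log (div_pos two_pos hq.δ_pos), inv_div]

variable (M q sel) in
/-- The paths along which the empirical mean of the functions `f t` over the `j`-th stage at `z`
exceeds the mean of their conditional expectations by more than the bonus. -/
def stageDeviation (f : ℕ → (ℕ → 𝒮) → 𝒮 → ℝ) (e : ℕ → ℕ) (z : 𝒮 × 𝒜) (j : ℕ) : Set (ℕ → 𝒮) :=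
  {x | ∃ T, stageEnd e j ≤ visits (pairAt M q sel x) z T ∧
    e j * (2 * √((q.H : ℝ) ^ 2 * q.ι / e j)) <
      ∑ k ∈ Finset.Ico (stageEnd e (j - 1)) (stageEnd e j),
        (f (visitTime (pairAt M q sel x) z k) x (nextState M q sel x z k) -
          M.next z.1 z.2 (f (visitTime (pairAt M q sel x) z k) x))}

open Classical in
/-- Chernoff's bound for one stage. The stage ends at a random time, so the exponential supermartingale
runs over all times with increments that vanish outside the stage. -/
theorem measure_stageDeviation_le (hq : q.IsValid) (hX : IsInteraction M q sel μ X)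
    {f : ℕ → (ℕ → 𝒮) → 𝒮 → ℝ} (hdep : ∀ u, DependsOn (f u) (Set.Iic u))
    (hf : ∀ u x s a y, |f u x y - M.next s a (f u x)| ≤ q.H) {e : ℕ → ℕ} (z : 𝒮 × 𝒜) {j : ℕ}
    (hj : 1 ≤ j) (hpos : 1 ≤ e j) :
    μ {ω | (fun t => X t ω) ∈ stageDeviation M q sel f e z j} ≤ ENNReal.ofReal (q.δ / 2) := by
  have hι := hq.half_lt_ι
  have hH := hq.one_le_H_cast
  have hn : (0 : ℝ) < e j := by exact_mod_cast hpos
  -- the optimal parameter of the exponential moment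
  set l : ℝ := √(q.ι / ((q.H : ℝ) ^ 2 * e j)) with hl
  have hl2 : l ^ 2 = q.ι / ((q.H : ℝ) ^ 2 * e j) := Real.sq_sqrt (by positivity)
  have hl0 : 0 < l := Real.sqrt_pos.2 (by positivity)
  let inStage : ℕ → (ℕ → 𝒮) → Prop := fun u x => pairAt M q sel x u = z ∧
    stageEnd e (j - 1) ≤ visits (pairAt M q sel x) z u ∧
      visits (pairAt M q sel x) z u < stageEnd e j
  let ξ : ℕ → (ℕ → 𝒮) → 𝒮 → ℝ := fun u x s => if inStage u x then
    l * (f u x s - M.next z.1 z.2 (f u x)) - l ^ 2 * (q.H : ℝ) ^ 2 else 0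
  have hξ : IsExpSupermartingale M q sel ξ := by
    refine ⟨fun u x y h => ?_, fun u x => ?_⟩
    · have h' : ∀ i ≤ u, x i = y i := fun i hi => h i hi
      have h1 : inStage u x = inStage u y := by
        simp only [inStage, pairAt_congr h', visits_congr h']
      funext s
      simp only [ξ, h1, hdep u h]
    · by_cases h : inStage u x
      · simp only [ξ, if_pos h]
        obtain ⟨rfl, -⟩ := h
        exact next_exp_deviation_le _ _ l fun y => hf u x _ _ y
      · simp only [ξ, if_neg h, Real.exp_zero]
        exact (MDP.next_const _ _ 1).le
  rw [← hq.exp_neg_ι]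
  refine (MeasureTheory.measure_mono ?_).trans (measure_exists_le_pathSum_le hX hξ q.ι)
  rintro ω ⟨T, hT, hdev⟩
  set x : ℕ → 𝒮 := fun t => X t ω with hx
  refine ⟨T, ?_⟩
  set Y := ∑ k ∈ Finset.Ico (stageEnd e (j - 1)) (stageEnd e j),
        (f (visitTime (pairAt M q sel x) z k) x (nextState M q sel x z k) -
          M.next z.1 z.2 (f (visitTime (pairAt M q sel x) z k) x)) with hY
  have h1 : pathSum ξ T x = l * Y - e j * (l ^ 2 * (q.H : ℝ) ^ 2) := by
    have h2 := sum_visits_eq (ζ := pairAt M q sel x) (z := z) (fun k u =>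
      if stageEnd e (j - 1) ≤ k ∧ k < stageEnd e j then
        l * (f u x (x (u + 1)) - M.next z.1 z.2 (f u x)) - l ^ 2 * (q.H : ℝ) ^ 2 else 0) T
    rw [show pathSum ξ T x = _ from Eq.trans (Finset.sum_congr rfl fun u _ => ?_) h2,
      ← Finset.sum_filter]
    rotate_left
    · by_cases h3 : pairAt M q sel x u = z
      · simp only [ξ, inStage, h3, true_and, if_true]
      · simp only [ξ, inStage, h3, false_and, if_false]
    have h4 : ((Finset.range (visits (pairAt M q sel x) z T)).filter fun k =>
        stageEnd e (j - 1) ≤ k ∧ k < stageEnd e j) =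
        Finset.Ico (stageEnd e (j - 1)) (stageEnd e j) := by
      ext k
      simp only [Finset.mem_filter, Finset.mem_range, Finset.mem_Ico]
      omega
    rw [h4, Finset.sum_sub_distrib, ← Finset.mul_sum, Finset.sum_const, Nat.card_Ico,
      IsStageSeq.stageEnd_sub hj, nsmul_eq_mul]
    rfl
  change q.ι ≤ pathSum ξ T x
  have h2 : (e j : ℝ) * (l ^ 2 * (q.H : ℝ) ^ 2) = q.ι := by
    rw [hl2]; field_simp
  have h3 : l * (e j * (2 * √((q.H : ℝ) ^ 2 * q.ι / e j))) = 2 * q.ι := by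
    have h4 : (q.H : ℝ) ^ 2 * q.ι / e j = (q.H ^ 2 * l) ^ 2 := by
      rw [mul_pow, hl2]; field_simp
    rw [h4, Real.sqrt_sq (by positivity), ← h2]
    ring
  have h5 := mul_lt_mul_of_pos_left hdev hl0
  rw [h1, h2]
  linarith

/-- A multiplicative bound, uniform in time, for the conditional expectations of nonnegative bounded
functions along the path. -/
theorem measure_sum_next_le (hq : q.IsValid) (hX : IsInteraction M q sel μ X)
    {f : ℕ → (ℕ → 𝒮) → 𝒮 → ℝ} (hdep : ∀ u, DependsOn (f u) (Set.Iic u)) {c η : ℝ} (hc : 0 < c)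
    (hη : 0 < η) (h0 : ∀ u x y, 0 ≤ f u x y) (hf : ∀ u x y, f u x y ≤ c) :
    μ {ω | (fun t => X t ω) ∈ {x | ∃ n, (1 + η) * ∑ t ∈ Finset.range n, f t x (x (t + 1)) +
      (1 + η) * c / η * q.ι < ∑ t ∈ Finset.range n,
        M.next (x t) (policy M q sel x t (x t)) (f t x)}} ≤ ENNReal.ofReal (q.δ / 2) := by
  let ξ : ℕ → (ℕ → 𝒮) → 𝒮 → ℝ := fun u x s => η / ((1 + η) * c) *
    (M.next (x u) (policy M q sel x u (x u)) (f u x) - (1 + η) * f u x s)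
  have hξ : IsExpSupermartingale M q sel ξ := by
    refine ⟨fun u x y h => ?_, fun u x => next_exp_mul_le _ _ hc hη (h0 u x) (hf u x)⟩
    have h' : ∀ i ≤ u, x i = y i := fun i hi => h i hi
    funext s
    simp only [ξ, hdep u h, policy_congr h', h' u le_rfl]
  rw [← hq.exp_neg_ι]
  refine (MeasureTheory.measure_mono ?_).trans (measure_exists_le_pathSum_le hX hξ q.ι)
  rintro ω ⟨n, hn⟩
  set x : ℕ → 𝒮 := fun t => X t ω with hx
  refine ⟨n, ?_⟩
  change q.ι ≤ pathSum ξ n x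
  have h1 : pathSum ξ n x = η / ((1 + η) * c) * (∑ t ∈ Finset.range n,
      M.next (x t) (policy M q sel x t (x t)) (f t x) -
        (1 + η) * ∑ t ∈ Finset.range n, f t x (x (t + 1))) := by
    rw [Finset.mul_sum, ← Finset.sum_sub_distrib, Finset.mul_sum]
    rfl
  rw [h1]
  have h2 : q.ι = η / ((1 + η) * c) * ((1 + η) * c / η * q.ι) := by field_simp
  conv_lhs => rw [h2]
  refine mul_le_mul_of_nonneg_left ?_ (by positivity)
  linarith

omit [MeasurableSpace Ω] in
/-- A stage deviation exceeds the bonus only if it exceeds its uncapped form, since the deviation of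
one sample is at most `1 / (1 - γ)`. -/
theorem sum_le_bonus_of_notMem {f : ℕ → (ℕ → 𝒮) → 𝒮 → ℝ}
    {x : ℕ → 𝒮} (hf : ∀ u s a y, f u x y - M.next s a (f u x) ≤ 1 / (1 - q.γ)) {e : ℕ → ℕ}
    {z : 𝒮 × 𝒜} {j T : ℕ} (hj : 1 ≤ j) (hT : stageEnd e j ≤ visits (pairAt M q sel x) z T)
    (h : x ∉ stageDeviation M q sel f e z j) :
    ∑ k ∈ Finset.Ico (stageEnd e (j - 1)) (stageEnd e j),
        (f (visitTime (pairAt M q sel x) z k) x (nextState M q sel x z k) -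
          M.next z.1 z.2 (f (visitTime (pairAt M q sel x) z k) x)) ≤ e j * q.bonus (e j) := by
  unfold Params.bonus
  rw [mul_min_of_nonneg _ _ (Nat.cast_nonneg _)]
  refine le_min ?_ ?_
  · by_contra hcon
    exact h ⟨T, hT, not_le.1 hcon⟩
  · refine (Finset.sum_le_sum fun k _ => hf _ _ _ _).trans_eq ?_
    rw [Finset.sum_const, Nat.card_Ico, IsStageSeq.stageEnd_sub hj, nsmul_eq_mul]

theorem abs_sub_next_le {f : 𝒮 → ℝ} {c : ℝ} (h0 : ∀ y, 0 ≤ f y) (hc : ∀ y, f y ≤ c) (s : 𝒮)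
    (a : 𝒜) (y : 𝒮) : |f y - M.next s a f| ≤ c := by
  have h1 := MDP.next_nonneg (M := M) s a h0
  have h2 := MDP.next_le (M := M) s a hc
  rw [abs_le]
  constructor <;> linarith [h0 y, hc y]

theorem next_neg (s : 𝒮) (a : 𝒜) (f : 𝒮 → ℝ) : M.next s a (fun y => -f y) = -M.next s a f := by
  simp [MDP.next]

variable [Fintype 𝒜] [Nonempty 𝒜]

variable (M q sel W) in
/-- The union of the exceptional sets of paths. The multiplicative bounds use the factor `2` for
`excess` and `1 + (1 - γ) / 2` for `gap`; the latter is small enough to be absorbed by the discount. -/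
def atypicalPaths : Set (ℕ → 𝒮) :=
  (⋃ z : 𝒮 × 𝒜, ⋃ j ∈ Finset.Icc 1 q.JChk,
    (stageDeviation M q sel (fun _ _ => W) q.eChk z j ∪
      stageDeviation M q sel (fun _ _ y => -W y) q.eChk z j ∪
      stageDeviation M q sel (fun t x => vTable M q sel x t) q.eChk z j)) ∪
  (⋃ z : 𝒮 × 𝒜, ⋃ j ∈ Finset.Icc 1 q.JBar,
    (stageDeviation M q sel (fun _ _ => W) q.eBar z j ∪
      stageDeviation M q sel (fun _ _ y => -W y) q.eBar z j)) ∪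
  ({x | ∃ n, (1 + 1) * ∑ t ∈ Finset.range n, excess M q sel x W t (x (t + 1)) +
      (1 + 1) * (1 / (1 - q.γ)) / 1 * q.ι < ∑ t ∈ Finset.range n,
        M.next (x t) (policy M q sel x t (x t)) (excess M q sel x W t)} ∪
    {x | ∃ n, (1 + (1 - q.γ) / 2) * ∑ t ∈ Finset.range n, gap M q sel x t (x (t + 1)) +
      (1 + (1 - q.γ) / 2) * (1 / (1 - q.γ)) / ((1 - q.γ) / 2) * q.ι < ∑ t ∈ Finset.range n,
        M.next (x t) (policy M q sel x t (x t)) (gap M q sel x t)})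

omit [Fintype 𝒜] in
theorem isTypical_of_notMem [Finite 𝒜] (hq : q.IsValid) (hW : MDP.IsBellmanSolution M q.γ W)
    {x : ℕ → 𝒮} (h : x ∉ atypicalPaths M q sel W) : IsTypical M q sel x W := by
  simp only [atypicalPaths, Set.mem_union, Set.mem_iUnion, not_or, not_exists] at h
  obtain ⟨⟨hC, hB⟩, hE, hG⟩ := h
  have hdW : ∀ (s : 𝒮) (a : 𝒜) (y : 𝒮), |W y - M.next s a W| ≤ 1 / (1 - q.γ) :=
    abs_sub_next_le hW.nonneg hW.le
  have two_sided : ∀ {e : ℕ → ℕ} {z : 𝒮 × 𝒜} {j T : ℕ}, 1 ≤ j →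
      stageEnd e j ≤ visits (pairAt M q sel x) z T →
      x ∉ stageDeviation M q sel (fun _ _ => W) e z j →
      x ∉ stageDeviation M q sel (fun _ _ y => -W y) e z j →
      |∑ k ∈ Finset.Ico (stageEnd e (j - 1)) (stageEnd e j),
        (W (nextState M q sel x z k) - M.next z.1 z.2 W)| ≤ e j * q.bonus (e j) := by
    intro e z j T hj hT h1 h2
    have h3 := sum_le_bonus_of_notMem (fun _ s a y => (abs_le.1 (hdW s a y)).2) hj hT h1
    have h4 := sum_le_bonus_of_notMem (fun _ s a y => by
      rw [next_neg]; linarith [(abs_le.1 (hdW s a y)).1]) hj hT h2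
    simp only [next_neg] at h4
    rw [abs_le]
    refine ⟨?_, h3⟩
    have h5 : ∑ k ∈ Finset.Ico (stageEnd e (j - 1)) (stageEnd e j),
        (-W (nextState M q sel x z k) - -M.next z.1 z.2 W) =
        -∑ k ∈ Finset.Ico (stageEnd e (j - 1)) (stageEnd e j),
        (W (nextState M q sel x z k) - M.next z.1 z.2 W) := by
      rw [← Finset.sum_neg_distrib]; exact Finset.sum_congr rfl fun k _ => by ring
    rw [h5] at h4
    linarith
  refine ⟨fun z j T h1 h2 hT => ?_, fun z j T h1 h2 hT => ?_, fun z j T h1 h2 hT => ?_,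
    fun n => ?_, fun n => ?_⟩
  · have := hC z j (Finset.mem_Icc.2 ⟨h1, h2⟩)
    exact two_sided h1 hT this.1.1 this.1.2
  · have := hB z j (Finset.mem_Icc.2 ⟨h1, h2⟩)
    exact two_sided h1 hT this.1 this.2
  · have := hC z j (Finset.mem_Icc.2 ⟨h1, h2⟩)
    exact sum_le_bonus_of_notMem (f := fun t x => vTable M q sel x t) (fun u s a y =>
      (abs_le.1 (abs_sub_next_le (vTable_nonneg hq u) (vTable_le hq u) s a y)).2) h1 hT this.2
  · have : ¬ (_ < _) := fun h => hE ⟨n, h⟩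
    refine (not_lt.1 this).trans_eq ?_
    norm_num
  · have : ¬ (_ < _) := fun h => hG ⟨n, h⟩
    refine (not_lt.1 this).trans (add_le_add le_rfl ?_)
    have hg := hq.one_sub_pos
    have hι := hq.half_lt_ι
    have h1 : (1 + (1 - q.γ) / 2) * (1 / (1 - q.γ)) / ((1 - q.γ) / 2) =
        (1 + (1 - q.γ) / 2) * (2 * (1 / (1 - q.γ)) ^ 2) := by field_simp
    rw [h1]
    have h2 : 0 ≤ 2 * (1 / (1 - q.γ)) ^ 2 * q.ι := by positivity
    nlinarith [hq.γ_pos]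

omit [Nonempty 𝒜] [MeasureTheory.IsProbabilityMeasure μ] in
theorem measure_iUnion_stages_le {D : 𝒮 × 𝒜 → ℕ → Set Ω} {d : ℝ≥0∞} {J : ℕ}
    (h : ∀ z j, 1 ≤ j → μ (D z j) ≤ d) :
    μ (⋃ z : 𝒮 × 𝒜, ⋃ j ∈ Finset.Icc 1 J, D z j) ≤
      (Fintype.card 𝒮 * Fintype.card 𝒜 : ℕ) * (J * d) := by
  refine (MeasureTheory.measure_iUnion_fintype_le _ _).trans ?_
  refine (Finset.sum_le_card_nsmul _ _ (J * d) fun z _ => ?_).trans_eq ?_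
  · refine (MeasureTheory.measure_biUnion_finset_le _ _).trans ?_
    refine (Finset.sum_le_card_nsmul _ _ d fun j hj => h z j (Finset.mem_Icc.1 hj).1).trans_eq ?_
    rw [Nat.card_Icc, nsmul_eq_mul, Nat.add_sub_cancel]
  · rw [Finset.card_univ, Fintype.card_prod, nsmul_eq_mul]

theorem Params.IsValid.union_bound_le_failure (hq : q.IsValid) :
    ((q.S * q.A : ℕ) : ℝ≥0∞) * (q.JChk * (3 * ENNReal.ofReal (q.δ / 2))) +
      (q.S * q.A : ℕ) * (q.JBar * (2 * ENNReal.ofReal (q.δ / 2))) +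
      (ENNReal.ofReal (q.δ / 2) + ENNReal.ofReal (q.δ / 2)) ≤ ENNReal.ofReal q.failure := by
  have hδ := hq.δ_pos
  have hδ2 := half_pos hδ
  have h1 : ((q.S * q.A : ℕ) : ℝ≥0∞) * (q.JChk * (3 * ENNReal.ofReal (q.δ / 2))) =
      ENNReal.ofReal ((q.S * q.A : ℕ) * (q.JChk * (3 * (q.δ / 2)))) := by
    rw [ENNReal.ofReal_mul (Nat.cast_nonneg _), ENNReal.ofReal_mul (Nat.cast_nonneg _),
      ENNReal.ofReal_mul (by norm_num), ENNReal.ofReal_natCast, ENNReal.ofReal_natCast,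
      ENNReal.ofReal_ofNat]
  have h2 : ((q.S * q.A : ℕ) : ℝ≥0∞) * (q.JBar * (2 * ENNReal.ofReal (q.δ / 2))) =
      ENNReal.ofReal ((q.S * q.A : ℕ) * (q.JBar * (2 * (q.δ / 2)))) := by
    rw [ENNReal.ofReal_mul (Nat.cast_nonneg _), ENNReal.ofReal_mul (Nat.cast_nonneg _),
      ENNReal.ofReal_mul (by norm_num), ENNReal.ofReal_natCast, ENNReal.ofReal_natCast,
      ENNReal.ofReal_ofNat]
  rw [h1, h2, ← ENNReal.ofReal_add hδ2.le hδ2.le,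
    ← ENNReal.ofReal_add (by positivity) (by positivity),
    ← ENNReal.ofReal_add (by positivity) (by positivity)]
  refine ENNReal.ofReal_le_ofReal ?_
  unfold Params.failure
  push_cast
  have h2 : (0 : ℝ) ≤ q.S * q.A * q.JChk * q.δ := by positivity
  have h3 : (0 : ℝ) ≤ q.S * q.A * q.JBar * q.δ := by positivity
  have h4 : (0 : ℝ) ≤ q.H * q.δ := by positivity
  linarith

/-- The union bound over five deviations of probability `δ / 2` for every pair and stage (three for
type I, two for type II) and two more for the sums over all times. -/
theorem measure_atypicalPaths_le (hq : q.IsValid) (hS : q.S = Fintype.card 𝒮)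
    (hA : q.A = Fintype.card 𝒜) (hW : MDP.IsBellmanSolution M q.γ W)
    (hX : IsInteraction M q sel μ X) :
    μ {ω | (fun t => X t ω) ∈ atypicalPaths M q sel W} ≤ ENNReal.ofReal q.failure := by
  set d : ℝ≥0∞ := ENNReal.ofReal (q.δ / 2) with hd
  have hH := Params.IsValid.horizon_le_H (q := q)
  have hdW : ∀ (s : 𝒮) (a : 𝒜) (y : 𝒮), |W y - M.next s a W| ≤ q.H := fun s a y =>
    (abs_sub_next_le hW.nonneg hW.le s a y).trans hH
  have hdW' : ∀ (s : 𝒮) (a : 𝒜) (y : 𝒮), |-W y - M.next s a (fun y => -W y)| ≤ q.H := by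
    intro s a y
    rw [next_neg, ← neg_sub', abs_neg]
    exact hdW s a y
  have m1 : ∀ {e : ℕ → ℕ} {B : ℝ}, IsStageSeq e q.H B → ∀ (z : 𝒮 × 𝒜) (j : ℕ), 1 ≤ j →
      μ {ω | (fun t => X t ω) ∈ stageDeviation M q sel (fun _ _ => W) e z j} ≤ d :=
    fun he z j hj => measure_stageDeviation_le hq hX (f := fun _ _ => W) (fun u x y _ => rfl)
      (fun _ _ s a y => hdW s a y) z hj (he.pos hj)
  have m2 : ∀ {e : ℕ → ℕ} {B : ℝ}, IsStageSeq e q.H B → ∀ (z : 𝒮 × 𝒜) (j : ℕ), 1 ≤ j →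
      μ {ω | (fun t => X t ω) ∈ stageDeviation M q sel (fun _ _ y => -W y) e z j} ≤ d :=
    fun he z j hj => measure_stageDeviation_le hq hX (f := fun _ _ y => -W y) (fun u x y _ => rfl)
      (fun _ _ s a y => hdW' s a y) z hj (he.pos hj)
  have m3 : ∀ (z : 𝒮 × 𝒜) (j : ℕ), 1 ≤ j →
      μ {ω | (fun t => X t ω) ∈ stageDeviation M q sel (fun t x => vTable M q sel x t) q.eChk z j} ≤ d :=
    fun z j hj => measure_stageDeviation_le hq hX (f := fun t x => vTable M q sel x t)
      (fun u x y h => vTable_congr fun i hi => h i hi)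
      (fun u x s a y => (abs_sub_next_le (vTable_nonneg hq u) (vTable_le hq u) s a y).trans hH) z hj
      (hq.eChk_isStageSeq.pos hj)
  have m4 := measure_sum_next_le (μ := μ) (X := X) (M := M) (sel := sel) hq hX
    (f := fun t x => excess M q sel x W t)
    (fun u x y h => by
      have h' : ∀ i ≤ u, x i = y i := fun i hi => h i hi
      funext s; simp only [excess, vTable_congr h'])
    hq.horizon_pos one_pos (fun _ _ _ => le_max_right _ _) (fun u x y => by
      have h1 := vTable_le (M := M) (sel := sel) (x := x) hq u y
      have h2 := hW.nonneg y
      have h3 := mul_pos hq.one_sub_pos hq.ε_pos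
      exact max_le (by linarith) hq.horizon_pos.le)
  have m5 := measure_sum_next_le (μ := μ) (X := X) (M := M) (sel := sel) hq hX
    (f := fun t x => gap M q sel x t)
    (fun u x y h => by
      have h' : ∀ i ≤ u, x i = y i := fun i hi => h i hi
      funext s; simp only [gap, vTable_congr h', policy_congr h'])
    hq.horizon_pos (half_pos hq.one_sub_pos) (fun _ _ _ => gap_nonneg _ _)
    (fun u x y => gap_le hq u y)
  change μ ((fun ω t => X t ω) ⁻¹' atypicalPaths M q sel W) ≤ _
  rw [atypicalPaths, Set.preimage_union, Set.preimage_union, Set.preimage_union]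
  simp only [Set.preimage_iUnion, Set.preimage_union]
  refine (MeasureTheory.measure_union_le _ _).trans (le_trans ?_ hq.union_bound_le_failure)
  rw [hS, hA]
  refine add_le_add ((MeasureTheory.measure_union_le _ _).trans (add_le_add ?_ ?_))
    ((MeasureTheory.measure_union_le _ _).trans (add_le_add ?_ ?_))
  · refine measure_iUnion_stages_le fun z j hj => ?_
    refine (MeasureTheory.measure_union_le _ _).trans ?_
    refine (add_le_add ((MeasureTheory.measure_union_le _ _).trans (add_le_add
      (m1 hq.eChk_isStageSeq z j hj) (m2 hq.eChk_isStageSeq z j hj))) (m3 z j hj)).trans_eq ?_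
    ring
  · refine measure_iUnion_stages_le fun z j hj => ?_
    refine ((MeasureTheory.measure_union_le _ _).trans (add_le_add
      (m1 hq.eBar_isStageSeq z j hj) (m2 hq.eBar_isStageSeq z j hj))).trans_eq ?_
    ring
  · exact m4
  · exact m5

end Probability

/-! ### The confidence parameter -/

section Confidence

variable {q : Params}

theorem Params.IsValid.withConfidence (hq : q.IsValid) {δ : ℝ} (h0 : 0 < δ) (h1 : δ < 1) :
    ({ q with δ := δ } : Params).IsValid :=
  { S_pos := hq.S_pos, A_pos := hq.A_pos, γ_pos := hq.γ_pos, γ_lt := hq.γ_lt, ε_pos := hq.ε_pos,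
    ε_le := hq.ε_le, δ_pos := h0, δ_lt := h1, c₁_pos := hq.c₁_pos }

theorem Params.IsValid.N₀_withConfidence_mono (hq : q.IsValid) {δ δ' : ℝ} (h0 : 0 < δ)
    (h : δ ≤ δ') : ({ q with δ := δ' } : Params).N₀ ≤ ({ q with δ := δ } : Params).N₀ := by
  have hc := hq.c₁_pos
  have hε := hq.ε_pos
  have h1 : Real.log (2 / δ') ≤ Real.log (2 / δ) :=
    Real.log_le_log (div_pos two_pos (h0.trans_le h)) (div_le_div_of_nonneg_left two_pos.le h0 h)
  change q.c₁ * ((q.S : ℝ) ^ 3 * q.A * (q.H : ℝ) ^ 7 *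
    Real.log (4 * (q.H : ℝ) ^ 2 * q.S / q.ε) ^ 2 * Real.log (2 / δ')) / q.ε ^ 2 ≤
    q.c₁ * ((q.S : ℝ) ^ 3 * q.A * (q.H : ℝ) ^ 7 *
    Real.log (4 * (q.H : ℝ) ^ 2 * q.S / q.ε) ^ 2 * Real.log (2 / δ)) / q.ε ^ 2
  gcongr

/-- The failure probability is `K δ` with an integer `K` that depends on `δ` monotonically. With
`δ = p / k` the least `k` for which the integer is at most `k` is therefore a fixed point. -/
theorem Params.IsValid.exists_failure_eq (hq : q.IsValid) :
    ∃ δ : ℝ, 0 < δ ∧ δ < 1 ∧ ({ q with δ := δ } : Params).failure = q.δ := by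
  have hp0 := hq.δ_pos
  have hp1 := hq.δ_lt
  let r : ℕ → Params := fun k => { q with δ := q.δ / k }
  let T : ℕ → ℕ := fun k => 8 * q.S * q.A * ((r k).JChk + (r k).JBar) + q.H + 3
  have hr : ∀ k : ℕ, 1 ≤ k → 0 < q.δ / k ∧ q.δ / k < 1 := fun k hk => by
    have hk' : (1 : ℝ) ≤ k := by exact_mod_cast hk
    exact ⟨by positivity, (div_le_self hp0.le hk').trans_lt hp1⟩
  have hv : ∀ k, 1 ≤ k → (r k).IsValid := fun k hk => hq.withConfidence (hr k hk).1 (hr k hk).2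
  have hmono : ∀ j k, 1 ≤ j → j ≤ k → T j ≤ T k := by
    intro j k hj hjk
    have hj' : (0 : ℝ) < j := by exact_mod_cast hj
    have hN : (r j).N₀ ≤ (r k).N₀ := hq.N₀_withConfidence_mono (hr k (hj.trans hjk)).1
      (div_le_div_of_nonneg_left hp0.le hj' (by exact_mod_cast hjk))
    have h1 : (r j).JChk ≤ (r k).JChk :=
      (hv j hj).eChk_isStageSeq.stageCount_mono (hv j hj).N₀_nonneg hN
    have h2 : (r j).JBar ≤ (r k).JBar :=
      (hv j hj).eBar_isStageSeq.stageCount_mono (hv j hj).N₀_nonneg hN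
    simp only [T]
    gcongr
  have hex : ∃ k, 1 ≤ k ∧ T k ≤ k := by
    set D : ℝ := q.c₁ * (q.S ^ 3 * q.A * q.H ^ 7 * Real.log (4 * q.H ^ 2 * q.S / q.ε) ^ 2) / q.ε ^ 2
      with hD
    have hc := hq.c₁_pos
    have hε := hq.ε_pos
    have hD0 : 0 ≤ D := by positivity
    set F : ℝ := 8 * q.S * q.A * (2 * D) with hF
    have hF0 : 0 ≤ F := by positivity
    have hT : ∀ k, 1 ≤ k → (T k : ℝ) ≤ (F * Real.log (2 / q.δ) + 8 * q.S * q.A * 2 + q.H + 3) +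
        F * Real.log k := by
      intro k hk
      have hk' : (0 : ℝ) < k := by exact_mod_cast hk
      have h1 : ((r k).JChk : ℝ) ≤ (r k).N₀ + 1 :=
        (hv k hk).eChk_isStageSeq.stageCount_le (hv k hk).N₀_nonneg
      have h2 : ((r k).JBar : ℝ) ≤ (r k).N₀ + 1 :=
        (hv k hk).eBar_isStageSeq.stageCount_le (hv k hk).N₀_nonneg
      have h3 : (r k).N₀ = D * (Real.log (2 / q.δ) + Real.log k) := by
        rw [← Real.log_mul (by positivity) hk'.ne', show 2 / q.δ * k = 2 / (q.δ / k) by field_simp]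
        change q.c₁ * ((q.S : ℝ) ^ 3 * q.A * (q.H : ℝ) ^ 7 *
          Real.log (4 * (q.H : ℝ) ^ 2 * q.S / q.ε) ^ 2 * Real.log (2 / (q.δ / k))) / q.ε ^ 2 = _
        rw [hD]; ring
      have h4 : ((r k).JChk : ℝ) + (r k).JBar ≤
          2 * (D * (Real.log (2 / q.δ) + Real.log k)) + 2 := by rw [← h3]; linarith
      have h5 := mul_le_mul_of_nonneg_left h4 (show (0 : ℝ) ≤ 8 * q.S * q.A by positivity)
      simp only [T]
      push_cast
      rw [hF]
      linarith
    set E : ℝ := F * Real.log (2 / q.δ) + 8 * q.S * q.A * 2 + q.H + 3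
    have h1 : ∀ᶠ k : ℕ in Filter.atTop, ‖Real.log (k : ℝ)‖ ≤ 1 / (2 * (F + 1)) * ‖(k : ℝ)‖ :=
      tendsto_natCast_atTop_atTop.eventually
        (Real.isLittleO_log_id_atTop.bound (show 0 < 1 / (2 * (F + 1)) by positivity))
    have h2 : ∀ᶠ k : ℕ in Filter.atTop, 2 * E ≤ (k : ℝ) :=
      tendsto_natCast_atTop_atTop.eventually_ge_atTop _
    obtain ⟨k, h1, h2, h3⟩ := (h1.and (h2.and (Filter.eventually_ge_atTop 1))).exists
    refine ⟨k, h3, ?_⟩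
    have h4 := hT k h3
    have hk' : (0 : ℝ) < k := by exact_mod_cast h3
    rw [Real.norm_of_nonneg hk'.le] at h1
    have h5 : F * Real.log k ≤ k / 2 := by
      have h6 : F * Real.log k ≤ F * (1 / (2 * (F + 1)) * k) :=
        mul_le_mul_of_nonneg_left ((Real.le_norm_self _).trans h1) hF0
      have h7 : F * (1 / (2 * (F + 1)) * k) = F / (F + 1) * (k / 2) := by field_simp
      have h8 : F / (F + 1) ≤ 1 := (div_le_one (by positivity)).2 (by linarith)
      have h9 := mul_le_mul_of_nonneg_right h8 (half_pos hk').le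
      linarith
    have h6 : (T k : ℝ) ≤ k := by linarith
    exact_mod_cast h6
  classical
  obtain ⟨hk1, hk2⟩ := Nat.find_spec hex
  set k := Nat.find hex
  have hfix : T k = k := by
    refine le_antisymm hk2 (Nat.find_min' hex ⟨?_, ?_⟩)
    · simp only [T]; omega
    · exact hmono _ _ (by simp only [T]; omega) hk2
  refine ⟨q.δ / k, (hr k hk1).1, (hr k hk1).2, ?_⟩
  have hk' : (0 : ℝ) < k := by exact_mod_cast hk1
  have h1 : (r k).failure = T k * (q.δ / k) := by
    change (8 * (q.S : ℝ) * q.A * ((r k).JChk + (r k).JBar) + q.H + 3) * (q.δ / k) = _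
    simp only [T]
    push_cast
    rfl
  change (r k).failure = q.δ
  rw [h1, hfix]
  field_simp

end Confidence

/-! ### Orders of magnitude -/

section Asymptotics

variable {q : Params}

/-- The logarithmic factor of the parameters `q`. -/
noncomputable def Params.logFac (q : Params) : ℝ := logFactor q.S q.A q.γ q.ε

/-- The logarithms of all parameters are dominated by the logarithmic factor. -/
theorem Params.IsValid.log_bounds (hq : q.IsValid) :
    0 ≤ Real.log q.S ∧ 0 ≤ Real.log q.A ∧ 0 ≤ Real.log (1 / (1 - q.γ)) ∧
      0 ≤ Real.log (1 + 1 / q.ε) ∧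
      q.logFac = 1 + Real.log q.S + Real.log q.A + Real.log (1 / (1 - q.γ)) +
        Real.log (1 + 1 / q.ε) := by
  have hg := hq.one_sub_pos
  have hε := hq.ε_pos
  have h1 : (0 : ℝ) < 1 / q.ε := by positivity
  refine ⟨Real.log_natCast_nonneg _, Real.log_natCast_nonneg _, Real.log_nonneg ?_,
    Real.log_nonneg (by linarith), rfl⟩
  rw [le_div_iff₀ hg]; linarith [hq.γ_pos]

theorem Params.IsValid.one_le_logFac (hq : q.IsValid) : 1 ≤ q.logFac := by
  obtain ⟨h1, h2, h3, h4, h5⟩ := hq.log_bounds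
  linarith

theorem Params.IsValid.H_le (hq : q.IsValid) : (q.H : ℝ) ≤ 4 * q.logFac * (1 / (1 - q.γ)) := by
  obtain ⟨h1, h2, h3, h4, h5⟩ := hq.log_bounds
  have hL := hq.one_le_logFac
  have hg := hq.one_sub_pos
  have hε := hq.ε_pos
  have hγ := hq.γ_pos
  set G := 1 / (1 - q.γ) with hG
  have hG1 : 1 ≤ G := by rw [hG, le_div_iff₀ hg]; linarith
  have h6 : Real.log (8 / ((1 - q.γ) * q.ε)) ≤ 3 * q.logFac := by
    have e1 : 8 / ((1 - q.γ) * q.ε) = 2 ^ 3 * (G * (1 / q.ε)) := by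
      rw [hG]; field_simp; norm_num
    rw [e1, Real.log_mul (by norm_num) (by positivity), Real.log_mul (by positivity) (by positivity),
      Real.log_pow]
    have e2 : Real.log (1 / q.ε) ≤ Real.log (1 + 1 / q.ε) :=
      Real.log_le_log (by positivity) (by linarith)
    have e3 := Real.log_two_lt_d9
    push_cast
    linarith
  have h7 : 1 - q.γ ≤ Real.log (1 / q.γ) := by
    rw [one_div, Real.log_inv]
    linarith [Real.log_le_sub_one_of_pos hγ]
  have h8 : Real.log (8 / ((1 - q.γ) * q.ε)) / Real.log (1 / q.γ) ≤ 3 * q.logFac * G := by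
    refine (div_le_div_of_nonneg_right h6 (hg.le.trans h7)).trans ?_
    rw [hG, mul_one_div]
    exact div_le_div_of_nonneg_left (by linarith) hg h7
  have h9 : G ≤ 3 * q.logFac * G := by nlinarith
  have h10 : (q.H : ℝ) < max (Real.log (8 / ((1 - q.γ) * q.ε)) / Real.log (1 / q.γ)) G + 1 :=
    Nat.ceil_lt_add_one (le_max_of_le_right (by positivity))
  have h11 := max_le h8 h9
  nlinarith

theorem Params.IsValid.log_H_le (hq : q.IsValid) : Real.log q.H ≤ 4 * q.logFac := by
  obtain ⟨h1, h2, h3, h4, h5⟩ := hq.log_bounds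
  have hL := hq.one_le_logFac
  have hg := hq.one_sub_pos
  have hH := hq.one_le_H_cast
  have h6 := Real.log_le_log (by linarith) hq.H_le
  rw [Real.log_mul (by positivity) (by positivity), Real.log_mul (by positivity) (by positivity),
    show (4 : ℝ) = 2 ^ 2 by norm_num, Real.log_pow] at h6
  have h7 := Real.log_two_lt_d9
  have h8 := Real.log_le_sub_one_of_pos (show 0 < q.logFac by linarith)
  push_cast at h6
  linarith

theorem Params.IsValid.log_one_add_N₀_le (hq : q.IsValid) :
    Real.log (1 + q.N₀) ≤ (Real.log (1 + 16 * q.c₁) + 49) * q.logFac + q.ι := by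
  obtain ⟨h1, h2, h3, h4, h5⟩ := hq.log_bounds
  have hL := hq.one_le_logFac
  have hc := hq.c₁_pos
  have hε := hq.ε_pos
  have hι := hq.half_lt_ι
  have hH := hq.one_le_H_cast
  have hS : (1 : ℝ) ≤ q.S := by exact_mod_cast hq.S_pos
  have hA : (1 : ℝ) ≤ q.A := by exact_mod_cast hq.A_pos
  have hN := hq.N₀_nonneg
  have h6 : Real.log (4 * q.H ^ 2 * q.S / q.ε) ^ 2 ≤ (4 * q.H ^ 2 * q.S / q.ε) ^ 2 := by
    refine pow_le_pow_left₀ ?_ ?_ 2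
    · linarith [hq.one_le_log]
    · have : 0 < 4 * (q.H : ℝ) ^ 2 * q.S / q.ε := by positivity
      linarith [Real.log_le_sub_one_of_pos this]
  have h7 : q.N₀ ≤ 16 * q.c₁ * (q.S ^ 5 * q.A * q.H ^ 11 * q.ι * (1 / q.ε) ^ 4) := by
    have e1 : q.N₀ ≤ q.c₁ * (q.S ^ 3 * q.A * q.H ^ 7 * (4 * q.H ^ 2 * q.S / q.ε) ^ 2 * q.ι) /
        q.ε ^ 2 := by
      unfold Params.N₀
      gcongr
    refine e1.trans_eq ?_
    field_simp
    ring
  set y : ℝ := q.S ^ 5 * q.A * q.H ^ 11 * (1 + q.ι) * (1 + 1 / q.ε) ^ 4 with hy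
  have hinv : 0 < 1 / q.ε := by positivity
  have hy1 : 1 ≤ y := by
    have e1 : (1 : ℝ) ≤ (q.S : ℝ) ^ 5 := one_le_pow₀ hS
    have e2 : (1 : ℝ) ≤ (q.H : ℝ) ^ 11 := one_le_pow₀ hH
    have e3 : (1 : ℝ) ≤ (1 + 1 / q.ε) ^ 4 := one_le_pow₀ (by linarith)
    exact one_le_mul_of_one_le_of_one_le (one_le_mul_of_one_le_of_one_le
      (one_le_mul_of_one_le_of_one_le (one_le_mul_of_one_le_of_one_le e1 hA) e2) (by linarith)) e3
  have h8 : 1 + q.N₀ ≤ (1 + 16 * q.c₁) * y := by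
    have e1 : (q.S : ℝ) ^ 5 * q.A * q.H ^ 11 * q.ι * (1 / q.ε) ^ 4 ≤ y := by
      rw [hy]
      gcongr <;> linarith
    have e2 := mul_le_mul_of_nonneg_left e1 (show 0 ≤ 16 * q.c₁ by positivity)
    linarith
  have h9 := Real.log_le_log (by linarith) h8
  rw [Real.log_mul (by positivity) (by positivity), hy,
    Real.log_mul (by positivity) (by positivity), Real.log_mul (by positivity) (by positivity),
    Real.log_mul (by positivity) (by positivity), Real.log_mul (by positivity) (by positivity),
    Real.log_pow, Real.log_pow, Real.log_pow] at h9
  have h10 := hq.log_H_le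
  have h11 := Real.log_le_sub_one_of_pos (show 0 < 1 + q.ι by linarith)
  have h12 : 0 ≤ Real.log (1 + 16 * q.c₁) := Real.log_nonneg (by linarith)
  have h13 := mul_le_mul_of_nonneg_left hL h12
  push_cast at h9
  linarith

/-- The number of stages per state-action pair. -/
theorem Params.IsValid.stages_le (hq : q.IsValid) :
    (q.JChk : ℝ) + q.JBar ≤ 4 + 72 * q.H * q.B * Real.log (1 + q.N₀) := by
  have h1 := hq.eChk_isStageSeq.stageCount_le_log hq.N₀_nonneg
  have h2 := hq.eBar_isStageSeq.stageCount_le_log hq.N₀_nonneg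
  rw [← q.JChk_eq] at h1
  rw [← q.JBar_eq] at h2
  have hB := hq.one_le_B
  have h3 : 0 ≤ Real.log (1 + q.N₀) := Real.log_nonneg (by linarith [hq.N₀_nonneg])
  have h4 : 36 * (q.H : ℝ) * 1 * Real.log (1 + q.N₀) ≤ 36 * q.H * q.B * Real.log (1 + q.N₀) := by
    gcongr
  linarith

/-- The constant `a` for which `ι` and `ln (1 + N₀)` are at most `a L ln (2 / p)`. -/
noncomputable def logConstant (c₁ : ℝ) : ℝ := 4 * Real.log (1 + 16 * c₁) + 264

/-- The ratio of the failure probability and the confidence parameter is of the order of the number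
of stages. -/
theorem Params.IsValid.log_failure_factor_le (hq : q.IsValid) :
    Real.log (8 * q.S * q.A * (q.JChk + q.JBar) + q.H + 3) ≤
      16 * q.logFac + Real.log (1 + Real.log (1 + q.N₀)) := by
  obtain ⟨h1, h2, h3, h4, h5⟩ := hq.log_bounds
  have hH := hq.one_le_H_cast
  have hS : (1 : ℝ) ≤ q.S := by exact_mod_cast hq.S_pos
  have hA : (1 : ℝ) ≤ q.A := by exact_mod_cast hq.A_pos
  have hSA : (1 : ℝ) ≤ q.S * q.A := one_le_mul_of_one_le_of_one_le hS hA
  have hst := hq.stages_le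
  have hY0 : 0 ≤ Real.log (1 + q.N₀) := Real.log_nonneg (by linarith [hq.N₀_nonneg])
  generalize Real.log (1 + q.N₀) = Y at hst hY0 ⊢
  have hB : q.B ≤ q.H := by
    rw [Params.B, Real.sqrt_le_left (by positivity)]
    nlinarith
  have hKle : (8 * q.S * q.A * (q.JChk + q.JBar) + q.H + 3 : ℝ) ≤
      2 ^ 10 * (q.S * q.A * q.H ^ 2 * (1 + Y)) := by
    have e0 : 1 ≤ (q.H : ℝ) ^ 2 := one_le_pow₀ hH
    have e00 : (q.H : ℝ) ≤ q.H ^ 2 := by nlinarith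
    have e1 : (q.JChk : ℝ) + q.JBar ≤ 76 * (q.H ^ 2 * (1 + Y)) := by
      have e2 : 72 * (q.H : ℝ) * q.B * Y ≤ 72 * q.H * q.H * Y := by gcongr
      have e3 : 0 ≤ (q.H : ℝ) ^ 2 * Y := by positivity
      linarith
    have e2 := mul_le_mul_of_nonneg_left e1 (show (0 : ℝ) ≤ 8 * (q.S * q.A) by positivity)
    have e4 : 0 ≤ (q.H : ℝ) ^ 2 * Y := by positivity
    have e5 : (q.H : ℝ) ^ 2 * (1 + Y) ≤ (q.S * q.A) * (q.H ^ 2 * (1 + Y)) :=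
      le_mul_of_one_le_left (by positivity) hSA
    have e6 : (0 : ℝ) ≤ (q.S * q.A) * (q.H ^ 2 * (1 + Y)) := by positivity
    linarith
  have e1 := Real.log_le_log (by positivity) hKle
  rw [Real.log_mul (by positivity) (by positivity), Real.log_mul (by positivity) (by positivity),
    Real.log_mul (by positivity) (by positivity), Real.log_mul (by positivity) (by positivity),
    Real.log_pow, Real.log_pow] at e1
  have e2 := hq.log_H_le
  have e3 := Real.log_two_lt_d9
  push_cast at e1
  linarith

/-- If `i` exceeds `l` by a logarithm of a quantity that is linear in `i` itself, then `i` is of the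
order of `L l`. -/
theorem log_bootstrap {L l c i Y K : ℝ} (hL : 1 ≤ L) (hl : 1 / 2 < l) (hc : 0 ≤ c) (hY0 : 0 ≤ Y)
    (hi : i = l + K) (hK : K ≤ 16 * L + Real.log (1 + Y)) (hY : Y ≤ (c + 49) * L + i) :
    i ≤ (4 * c + 264) * (L * l) ∧ Y ≤ (4 * c + 264) * (L * l) := by
  have hlogY : Real.log (1 + Y) ≤ (1 + Y) / 2 := by
    have e1 := Real.log_le_sub_one_of_pos (show 0 < (1 + Y) / 2 by linarith)
    rw [Real.log_div (by linarith) two_ne_zero] at e1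
    linarith [Real.log_two_lt_d9]
  have hLl : L ≤ 2 * (L * l) := by nlinarith
  have hlL : l ≤ L * l := by nlinarith
  have hcL : c * L ≤ c * (2 * (L * l)) := mul_le_mul_of_nonneg_left hLl hc
  have hcL0 : 0 ≤ c * (L * l) := mul_nonneg hc (by linarith)
  have hi2 : i ≤ 2 * l + 82 * L + c * L := by linarith
  constructor <;> linarith

/-- Since `ι = ln (2 / p) + ln K`, where `K = p / δ` is of the order of the number of stages and so
of `1 + ln (1 + N₀)`, and `N₀` is linear in `ι`, the quantity `ι` is bounded in terms of `ln ι`, and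
hence it is at most logarithmic in the parameters. -/
theorem Params.IsValid.ι_le (hq : q.IsValid) (hp : q.failure < 1) :
    q.ι ≤ logConstant q.c₁ * (q.logFac * Real.log (2 / q.failure)) ∧
      Real.log (1 + q.N₀) ≤ logConstant q.c₁ * (q.logFac * Real.log (2 / q.failure)) := by
  have hc := hq.c₁_pos
  have hδ := hq.δ_pos
  have hK := hq.log_failure_factor_le
  have hfail : q.failure = (8 * q.S * q.A * (q.JChk + q.JBar) + q.H + 3) * q.δ := rfl
  have hK0 : (0 : ℝ) < 8 * q.S * q.A * (q.JChk + q.JBar) + q.H + 3 := by positivity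
  generalize (8 * q.S * q.A * (q.JChk + q.JBar) + q.H + 3 : ℝ) = K at hK hfail hK0
  have hp0 : 0 < q.failure := by rw [hfail]; positivity
  have hl : 1 / 2 < Real.log (2 / q.failure) := by
    have e1 : Real.log 2 < Real.log (2 / q.failure) := by
      refine Real.log_lt_log two_pos ?_
      rw [lt_div_iff₀ hp0]; linarith
    linarith [Real.log_two_gt_d9]
  have hι : q.ι = Real.log (2 / q.failure) + Real.log K := by
    rw [← Real.log_mul (by positivity) hK0.ne', hfail, Params.ι]
    congr 1
    field_simp
  exact log_bootstrap hq.one_le_logFac hl (Real.log_nonneg (by linarith))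
    (Real.log_nonneg (by linarith [hq.N₀_nonneg])) hι hK hq.log_one_add_N₀_le

/-- The universal constant of the sample complexity bound. -/
noncomputable def complexityConstant (c₁ : ℝ) : ℝ := 500000000 * logConstant c₁

theorem complexityBound_le (hq : q.IsValid) (hp : q.failure < 1) :
    4 * q.H / q.ε * (60000 * (q.S * q.A * q.H ^ 4 * q.B * q.ι / q.ε) +
      q.H * (q.S * q.A * (q.JChk + q.JBar) + 1) + 4 * q.H ^ 2 * q.ι) ≤
    complexityConstant q.c₁ * q.logFac ^ 7 * ((q.S : ℝ) * q.A * Real.log (2 / q.failure) /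
      (q.ε ^ 2 * (1 - q.γ) ^ (11 / 2 : ℝ))) := by
  obtain ⟨hι, hY⟩ := hq.ι_le hp
  have hL := hq.one_le_logFac
  have hε := hq.ε_pos
  have hεH := hq.ε_le_H
  have hg := hq.one_sub_pos
  have hH := hq.one_le_H_cast
  have hB := hq.one_le_B
  have hS : (1 : ℝ) ≤ q.S := by exact_mod_cast hq.S_pos
  have hA : (1 : ℝ) ≤ q.A := by exact_mod_cast hq.A_pos
  have hSA : (1 : ℝ) ≤ q.S * q.A := one_le_mul_of_one_le_of_one_le hS hA
  have hι0 := hq.half_lt_ι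
  set m := logConstant q.c₁ * (q.logFac * Real.log (2 / q.failure)) with hm
  have hm2 : 1 / 2 < m := hι0.trans_le hι
  set D : ℝ := q.S * q.A with hD
  set u : ℝ := D * q.H ^ 4 * q.B * m / q.ε with hu
  have t1 : (q.S * q.A * q.H ^ 4 * q.B * q.ι / q.ε : ℝ) ≤ u := by
    rw [← hD, hu]; gcongr
  -- `ε ≤ H` absorbs the factor `ε` that the lower-order terms lack
  have key : D * q.H ^ 3 * q.B * m ≤ u := by
    rw [hu, le_div_iff₀ hε]
    calc D * q.H ^ 3 * q.B * m * q.ε ≤ D * q.H ^ 3 * q.B * m * q.H := by gcongr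
      _ = _ := by ring
  have t2 : (q.H : ℝ) * (D * (q.JChk + q.JBar) + 1) ≤ 82 * u := by
    have e1 := hq.stages_le
    have e2 : 72 * (q.H : ℝ) * q.B * Real.log (1 + q.N₀) ≤ 72 * q.H * q.B * m := by gcongr
    have e3 : 1 ≤ (q.H : ℝ) * q.B := one_le_mul_of_one_le_of_one_le hH hB
    have e4 : 1 ≤ 2 * (q.H * q.B * m) := by nlinarith
    have e5 : (q.JChk : ℝ) + q.JBar ≤ 80 * (q.H * q.B * m) := by linarith
    have e6 := mul_le_mul_of_nonneg_left e5 (show 0 ≤ D by linarith)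
    have e7 : 1 ≤ 2 * (D * (q.H * q.B * m)) := by
      have : (q.H : ℝ) * q.B * m ≤ D * (q.H * q.B * m) := le_mul_of_one_le_left (by positivity) hSA
      linarith
    have e8 : (q.H : ℝ) * (D * (q.JChk + q.JBar) + 1) ≤ q.H * (82 * (D * (q.H * q.B * m))) :=
      mul_le_mul_of_nonneg_left (by linarith) (by linarith)
    have e9 : D * (q.H : ℝ) ^ 2 * q.B * m ≤ D * q.H ^ 3 * q.B * m := by
      gcongr
      norm_num
    nlinarith
  have t3 : 4 * (q.H : ℝ) ^ 2 * q.ι ≤ 4 * u := by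
    have e1 : (q.H : ℝ) ^ 2 * q.ι ≤ q.H ^ 3 * m := by
      gcongr
      norm_num
    have e2 : (q.H : ℝ) ^ 3 * m ≤ D * q.B * (q.H ^ 3 * m) :=
      le_mul_of_one_le_left (by positivity) (one_le_mul_of_one_le_of_one_le hSA hB)
    nlinarith
  have step1 : 4 * q.H / q.ε * (60000 * (q.S * q.A * q.H ^ 4 * q.B * q.ι / q.ε) +
      q.H * (D * (q.JChk + q.JBar) + 1) + 4 * q.H ^ 2 * q.ι) ≤
      4 * q.H / q.ε * (60086 * u) := by
    refine mul_le_mul_of_nonneg_left ?_ (by positivity)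
    linarith
  refine step1.trans ?_
  -- the powers of the horizon
  have hHle := hq.H_le
  set G := 1 / (1 - q.γ) with hG
  have hG0 : 0 < G := by positivity
  have hBle : q.B ≤ 2 * q.logFac * √G := by
    rw [Params.B, Real.sqrt_le_left (by positivity), mul_pow, Real.sq_sqrt hG0.le]
    have : q.logFac * G ≤ q.logFac ^ 2 * G := by gcongr; nlinarith
    nlinarith
  have hpow : (q.H : ℝ) ^ 5 * q.B ≤ 2048 * q.logFac ^ 6 * (G ^ 5 * √G) := by
    calc (q.H : ℝ) ^ 5 * q.B ≤ (4 * q.logFac * G) ^ 5 * (2 * q.logFac * √G) := by gcongr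
      _ = _ := by ring
  have hrpow : (1 - q.γ) ^ (11 / 2 : ℝ) = 1 / (G ^ 5 * √G) := by
    rw [show (11 / 2 : ℝ) = (5 : ℕ) + 1 / 2 by norm_num, Real.rpow_add hg, Real.rpow_natCast,
      ← Real.sqrt_eq_rpow, hG, Real.sqrt_div zero_le_one, Real.sqrt_one]
    have := Real.sqrt_pos.2 hg
    field_simp
  have hc := hq.c₁_pos
  have hl0 : 0 < logConstant q.c₁ := by
    have : 0 ≤ Real.log (1 + 16 * q.c₁) := Real.log_nonneg (by linarith)
    unfold logConstant; linarith
  calc 4 * q.H / q.ε * (60086 * u) = 240344 * (D * m / q.ε ^ 2) * (q.H ^ 5 * q.B) := by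
        rw [hu]; field_simp; ring
    _ ≤ 240344 * (D * m / q.ε ^ 2) * (2048 * q.logFac ^ 6 * (G ^ 5 * √G)) := by gcongr
    _ = 492224512 * (D * m / q.ε ^ 2 * q.logFac ^ 6 * (G ^ 5 * √G)) := by ring
    _ ≤ 500000000 * (D * m / q.ε ^ 2 * q.logFac ^ 6 * (G ^ 5 * √G)) := by
        gcongr; norm_num
    _ = _ := by
        rw [hrpow, hm, complexityConstant]
        have := Real.sqrt_pos.2 hG0
        field_simp

end Asymptotics

/-! ### The sample complexity -/

theorem encard_le_of_forall_card_le {p : ℕ → Prop} [DecidablePred p] {R : ℝ}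
    (h : ∀ n, (((Finset.range n).filter p).card : ℝ) ≤ R) :
    (({t : ℕ | p t}.encard : ℕ∞) : ℝ≥0∞) ≤ ENNReal.ofReal R := by
  have hR : 0 ≤ R := (Nat.cast_nonneg _).trans (h 0)
  have hfin : {t : ℕ | p t}.Finite := by
    by_contra hinf
    obtain ⟨F, hF, hcard⟩ := Set.Infinite.exists_subset_card_eq hinf (⌊R⌋₊ + 1)
    obtain ⟨n, hn⟩ := F.exists_nat_subset_range
    have h1 : F ⊆ (Finset.range n).filter p := fun t ht =>
      Finset.mem_filter.2 ⟨hn ht, hF ht⟩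
    have h2 : (F.card : ℝ) ≤ R := (Nat.cast_le.2 (Finset.card_le_card h1)).trans (h n)
    rw [hcard] at h2
    push_cast at h2
    linarith [Nat.lt_floor_add_one R]
  obtain ⟨n, hn⟩ := hfin.toFinset.exists_nat_subset_range
  have h1 : hfin.toFinset ⊆ (Finset.range n).filter p := fun t ht =>
    Finset.mem_filter.2 ⟨hn ht, by simpa using ht⟩
  have h2 : (hfin.toFinset.card : ℝ) ≤ R := (Nat.cast_le.2 (Finset.card_le_card h1)).trans (h n)
  rw [hfin.encard_eq_coe_toFinset_card, ENat.toENNReal_coe, ← ENNReal.ofReal_natCast]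
  exact ENNReal.ofReal_le_ofReal h2

theorem sampleComplexity_le {𝒮 𝒜 : Type*} [Fintype 𝒮] [Fintype 𝒜] [Nonempty 𝒜] {M : MDP 𝒮 𝒜}
    {q : Params} {sel : 𝒮 → (𝒜 → ℝ) → 𝒜} {W : 𝒮 → ℝ} {x : ℕ → 𝒮} (hq : q.IsValid)
    (hS : q.S = Fintype.card 𝒮) (hA : q.A = Fintype.card 𝒜) (hc : capConstant ≤ q.c₁)
    (hp : q.failure < 1) (hsel : ∀ (s : 𝒮) (f : 𝒜 → ℝ) (a : 𝒜), f a ≤ f (sel s f))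
    (hW : MDP.IsBellmanSolution M q.γ W) (hx : IsTypical M q sel x W) :
    ((sampleComplexity M q sel x : ℕ∞) : ℝ≥0∞) ≤ ENNReal.ofReal (complexityConstant q.c₁ *
      q.logFac ^ 7 * ((q.S : ℝ) * q.A * Real.log (2 / q.failure) /
        (q.ε ^ 2 * (1 - q.γ) ^ (11 / 2 : ℝ)))) := by
  classical
  exact encard_le_of_forall_card_le fun n =>
    (card_suboptimal_le hq hS hA hc hsel hW hx n).trans (complexityBound_le hq hp)

open MeasureTheory in
theorem ofReal_one_sub_le_measure {Ω : Type*} [MeasurableSpace Ω] {μ : Measure Ω}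
    [IsProbabilityMeasure μ] {E F : Set Ω} {p : ℝ} (hp : 0 ≤ p) (h : Fᶜ ⊆ E)
    (hF : μ F ≤ ENNReal.ofReal p) : ENNReal.ofReal (1 - p) ≤ μ E := by
  rw [ENNReal.ofReal_sub _ hp, ENNReal.ofReal_one, tsub_le_iff_right, ← measure_univ (μ := μ),
    ← Set.compl_union_self F]
  exact (measure_union_le _ _).trans (add_le_add (measure_mono h) hF)

end UCBMultiStage

theorem theorem2 :
    ∃ (k : ℕ) (c₀ : ℝ), 0 < c₀ ∧ ∀ c₁ : ℝ, c₀ ≤ c₁ → ∃ C : ℝ, 0 < C ∧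
      ∀ (𝒮 𝒜 : Type*) [Fintype 𝒮] [Fintype 𝒜] [Nonempty 𝒮] [Nonempty 𝒜] (γ ε p : ℝ),
        0 < γ → γ < 1 → 0 < ε → ε ≤ 1 / (1 - γ) → 0 < p → p < 1 →
        (∃ δ : ℝ, 0 < δ ∧ δ < 1 ∧
          Params.failure ⟨Fintype.card 𝒮, Fintype.card 𝒜, γ, ε, c₁, δ⟩ = p) ∧
        ∀ δ : ℝ, 0 < δ → δ < 1 →
          Params.failure ⟨Fintype.card 𝒮, Fintype.card 𝒜, γ, ε, c₁, δ⟩ = p →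
          ∀ (M : MDP 𝒮 𝒜) (sel : 𝒮 → (𝒜 → ℝ) → 𝒜), (∀ (s : 𝒮) (f : 𝒜 → ℝ) (a : 𝒜), f a ≤ f (sel s f)) →
          ∀ (Ω : Type*) [MeasurableSpace Ω] (μ : MeasureTheory.Measure Ω)
            [MeasureTheory.IsProbabilityMeasure μ] (X : ℕ → Ω → 𝒮),
            IsInteraction M ⟨Fintype.card 𝒮, Fintype.card 𝒜, γ, ε, c₁, δ⟩ sel μ X →
            ENNReal.ofReal (1 - p) ≤
              μ {ω | ((sampleComplexity M ⟨Fintype.card 𝒮, Fintype.card 𝒜, γ, ε, c₁, δ⟩ sel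
                    (fun t => X t ω) : ℕ∞) : ℝ≥0∞) ≤
                  ENNReal.ofReal
                    (C * logFactor (Fintype.card 𝒮) (Fintype.card 𝒜) γ ε ^ k *
                      ((Fintype.card 𝒮 : ℝ) * Fintype.card 𝒜 * Real.log (2 / p) /
                        (ε ^ 2 * (1 - γ) ^ (11 / 2 : ℝ))))} := by
  refine ⟨7, capConstant, by norm_num [capConstant], fun c₁ hc₁ => ?_⟩
  have hc0 : 0 < c₁ := lt_of_lt_of_le (by norm_num [capConstant]) hc₁
  refine ⟨complexityConstant c₁, ?_, ?_⟩
  · have : 0 ≤ Real.log (1 + 16 * c₁) := Real.log_nonneg (by linarith)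
    unfold complexityConstant logConstant
    positivity
  intro 𝒮 𝒜 _ _ _ _ γ ε p hγ0 hγ1 hε0 hε1 hp0 hp1
  have valid : ∀ δ : ℝ, 0 < δ → δ < 1 →
      Params.IsValid ⟨Fintype.card 𝒮, Fintype.card 𝒜, γ, ε, c₁, δ⟩ := fun δ h0 h1 =>
    { S_pos := Fintype.card_pos, A_pos := Fintype.card_pos, γ_pos := hγ0, γ_lt := hγ1,
      ε_pos := hε0, ε_le := hε1, δ_pos := h0, δ_lt := h1, c₁_pos := hc0 }
  refine ⟨(valid p hp0 hp1).exists_failure_eq, ?_⟩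
  intro δ hδ0 hδ1 hfail M sel hsel Ω _ μ _ X hX
  have hq := valid δ hδ0 hδ1
  obtain ⟨W, hW⟩ := MDP.exists_isBellmanSolution (M := M) hγ0 hγ1
  refine ofReal_one_sub_le_measure hp0.le (fun ω hω => ?_)
    ((measure_atypicalPaths_le hq rfl rfl hW hX).trans_eq (by rw [hfail]))
  have h := sampleComplexity_le hq rfl rfl hc₁ (hfail.trans_lt hp1) hsel hW
    (isTypical_of_notMem hq hW hω)
  rw [hfail] at h
  exact h
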